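/- Let $X_0\sim\mu_0=\mathcal N(0,I_d)$ and $X_1\sim\mu_1$ be independent, where $\mu_1$ is a probability measure on $\mathbb R^d$ with density $e^{-V_1}$, $V_1\in C^2(\mathbb R^d)$ and $\nabla^2V_1(x)\succcurlyeq\kappa I_d$ for all $x$, for some $\kappa\ge 0$. Let $\alpha,\beta\in C^2([0,1])$ satisfy $\alpha_0=\beta_1=1$, $\alpha_1=\beta_0=0$ and $\alpha_t,\beta_t>0$ for $t\in(0,1)$, let $I_t=\alpha_tX_0+\beta_tX_1$, and let $v_t(x)=\mathbb E[\dot\alpha_tX_0+\dot\beta_tX_1\mid I_t=x]$, taken in the version that is continuous in $x$ (this version exists and is unique for every $t\in[0,1]$). Then: 1. There exists $\phi\in C^1([0,1],C^1(\mathbb R^d))$ such that $v_t=\nabla\phi_t$ for all $t\in[0,1]$. 2. For every $t\in[0,1]$, $v_t$ is differentiable, and its Jacobian $Dv_t(x)=\nabla^2\phi_t(x)$ is symmetric and bounded in $x$. At every $t\in[0,1]$ with $\alpha_t\dot\beta_t-\dot\alpha_t\beta_t\ge 0$ (that is, for $t<1$, with $\frac{d}{dt}(\beta_t/\alpha_t)\ge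 0$) and with $\kappa\alpha_t^2+\beta_t^2>0$, $$Dv_t(x)\preccurlyeq\frac{\kappa\alpha_t\dot\alpha_t+\beta_t\dot\beta_t}{\kappa\alpha_t^2+\beta_t^2}\,I_d\qquad\text{for all }x\in\mathbb R^d.$$ 3. There is a unique flow map $f^v$ of $v$, that is, a unique solution on $[0,1]$ of $\partial_tf^v_t(x)=v_t(f^v_t(x))$, $f^v_0(x)=x$, for all $x\in\mathbb R^d$; each $f^v_t$ is differentiable. If $\kappa>0$, then for all $t\in[0,1]$ and $x\in\mathbb R^d$ $$\|Df^v_t(x)\|_{\mathrm{op}}\le\sqrt{\alpha_t^2+\beta_t^2/\kappa},$$ and in particular $\|Df^v_1(x)\|_{\mathrm{op}}\le\kappa^{-1/2}$, which is Caffarelli's constant. -/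

import Mathlib

open MeasureTheory ProbabilityTheory Set

/-- The Hessian of a scalar function, as the Jacobian of its gradient. -/
noncomputable def hessian {d : ℕ} (F : EuclideanSpace ℝ (Fin d) → ℝ)
    (x : EuclideanSpace ℝ (Fin d)) :
    EuclideanSpace ℝ (Fin d) →L[ℝ] EuclideanSpace ℝ (Fin d) :=
  fderiv ℝ (gradient F) x

/-- The measure on `ℝ^d` with density `e^{-V}`. -/
noncomputable def gibbsMeasure {d : ℕ} (V : EuclideanSpace ℝ (Fin d) → ℝ) :
    Measure (EuclideanSpace ℝ (Fin d)) :=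
  volume.withDensity (fun x => ENNReal.ofReal (Real.exp (-V x)))

/-- `e^{-V}` is `κ`-log-concave: `V` is `C²` and `∇²V ≽ κ I`, in the Loewner order. -/
def IsLogConcavePotential {d : ℕ} (κ : ℝ) (V : EuclideanSpace ℝ (Fin d) → ℝ) : Prop :=
  ContDiff ℝ 2 V ∧
    ∀ x, κ • ContinuousLinearMap.id ℝ (EuclideanSpace ℝ (Fin d)) ≤ hessian V x

/-- Time derivative of a coefficient on `[0, 1]`, one-sided at the endpoints. -/
noncomputable def timeDeriv (a : ℝ → ℝ) (t : ℝ) : ℝ :=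
  derivWithin a (Icc 0 1) t

/-- Coefficients of an isotropic linear interpolant. -/
structure IsInterpolantCoeff (α β : ℝ → ℝ) : Prop where
  contDiff_α : ContDiffOn ℝ 2 α (Icc 0 1)
  contDiff_β : ContDiffOn ℝ 2 β (Icc 0 1)
  α_zero : α 0 = 1
  α_one : α 1 = 0
  β_zero : β 0 = 0
  β_one : β 1 = 1
  α_pos : ∀ t ∈ Ioo (0 : ℝ) 1, 0 < α t
  β_pos : ∀ t ∈ Ioo (0 : ℝ) 1, 0 < β t

/-- The isotropic linear interpolant `I_t = α_t X₀ + β_t X₁`. -/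
noncomputable def interpolant {d : ℕ} {Ω : Type*} (α β : ℝ → ℝ)
    (X₀ X₁ : Ω → EuclideanSpace ℝ (Fin d)) (t : ℝ) (ω : Ω) : EuclideanSpace ℝ (Fin d) :=
  α t • X₀ ω + β t • X₁ ω

/-- Its time derivative `∂_t I_t = α̇_t X₀ + β̇_t X₁`. -/
noncomputable def interpolantDeriv {d : ℕ} {Ω : Type*} (α β : ℝ → ℝ)
    (X₀ X₁ : Ω → EuclideanSpace ℝ (Fin d)) (t : ℝ) (ω : Ω) : EuclideanSpace ℝ (Fin d) :=
  timeDeriv α t • X₀ ω + timeDeriv β t • X₁ ω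

/-- `v_t(x) = E[∂_t I_t | I_t = x]` for `t ∈ [0, 1]`: conditional expectations determine `v_t` only
up to null sets of the law of `I_t`, and the version that is continuous in `x` is taken. -/
def IsDrift {d : ℕ} {Ω : Type*} [MeasurableSpace Ω] (P : Measure Ω) (α β : ℝ → ℝ)
    (X₀ X₁ : Ω → EuclideanSpace ℝ (Fin d))
    (v : ℝ → EuclideanSpace ℝ (Fin d) → EuclideanSpace ℝ (Fin d)) : Prop :=
  ∀ t ∈ Icc (0 : ℝ) 1,
    Continuous (v t) ∧
    (fun ω => v t (interpolant α β X₀ X₁ t ω)) =ᵐ[P]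
      P[interpolantDeriv α β X₀ X₁ t |
        MeasurableSpace.comap (interpolant α β X₀ X₁ t) inferInstance]

/-- `φ ∈ C¹([0, 1], C¹(ℝ^d))`, where `C¹(ℝ^d)` carries the topology of locally uniform
convergence of functions and of their derivatives: `ψ` is the time derivative of `φ`. Since
`ψ` and `D_x ψ` are jointly continuous, pointwise time derivatives are locally uniform. -/
def IsC1C1 {d : ℕ} (φ : ℝ → EuclideanSpace ℝ (Fin d) → ℝ) : Prop :=
  ∃ ψ : ℝ → EuclideanSpace ℝ (Fin d) → ℝ,
    (∀ t ∈ Icc (0 : ℝ) 1, ContDiff ℝ 1 (φ t) ∧ ContDiff ℝ 1 (ψ t)) ∧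
    (∀ t ∈ Icc (0 : ℝ) 1, ∀ x,
      HasDerivWithinAt (fun s => φ s x) (ψ t x) (Icc 0 1) t ∧
      HasDerivWithinAt (fun s => fderiv ℝ (φ s) x) (fderiv ℝ (ψ t) x) (Icc 0 1) t) ∧
    ContinuousOn (fun p : ℝ × EuclideanSpace ℝ (Fin d) => ψ p.1 p.2) (Icc 0 1 ×ˢ univ) ∧
    ContinuousOn (fun p : ℝ × EuclideanSpace ℝ (Fin d) => fderiv ℝ (ψ p.1) p.2)
      (Icc 0 1 ×ˢ univ)

/-- `f` solves `∂_t f_t(x) = v_t(f_t(x))` on `[0, 1]`, with `f_0(x) = x`. -/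
def IsFlow {d : ℕ} (v f : ℝ → EuclideanSpace ℝ (Fin d) → EuclideanSpace ℝ (Fin d)) : Prop :=
  ∀ x, f 0 x = x ∧
    ∀ t ∈ Icc (0 : ℝ) 1, HasDerivWithinAt (fun s => f s x) (v t (f t x)) (Icc 0 1) t

/-! Write `(α_t, β_t) = r_t (cos θ_t, sin θ_t)` with `θ_t ∈ [0, π/2]`. Then `v_t(x) = (ṙ_t / r_t) x
+ r_t θ̇_t W_{θ_t}(x / r_t)`, where `W_θ` is the drift of `cos θ X₀ + sin θ X₁`, and the flow of `v`
is `r_t g_{θ_t}`, where `g` is the flow of `W`. The schedule thus enters the flow only through a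
change of clock and a dilation. This is why the Lipschitz bound needs no monotonicity of `β / α`,
whereas the upper bound on `Dv_t` needs `θ̇_t ≥ 0`.

With `σ = tan θ`, `W_θ` is affine in the posterior mean of `X₁` given `X₀ + σ X₁`, and the
derivative of that mean in `x` is `σ` times the posterior covariance. Hence `DW_θ` is symmetric. The
covariance is at most `1 / (κ + σ²)` (`inner_posteriorCov_self_le`): the posterior normalisation `Z`
satisfies `∇² log Z = σ² Cov - I`, and Prékopa–Leindler (`lintegral_mul_le_of_midpoint`) makes `log
Z` concave with modulus `κ / (κ + σ²)`. It follows that `DW_θ ≼ q' / (2 q)` with `q = κ cos² θ +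
sin² θ`, so the squared distance of two trajectories divided by `q` does not increase
(`norm_sub_sq_le_of_isCurveOn_angularField`). Since `q(0) = κ`, undoing the polar coordinates gives
`α² + β² / κ`.

The delicate point is regularity at `θ = π/2`, where `σ` is infinite. There `W_θ` is expressed
through the mean of `Z` given `τ Z + X₁`, with `τ = cot θ`. Expanding the density of `X₁` to first
order in `τ`, the parity of the Gaussian and its identity covariance cancel all negative powers of
`τ`, which gives joint `C¹` regularity down to `τ = 0` from a `C¹` density alone
(`contDiff_noiseMean`).

Joint `C¹` regularity and symmetry give the potential (`exists_potential`) and the uniqueness of the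
flow. For `κ = 0` the rate `q' / (2 q) = cot θ` is not integrable at `0`, so global existence
(`exists_flow`) combines a compactness argument near `θ = 0` with linear radial growth afterwards.
The continuous version of the drift is unique because the law of `I_t` charges every nonempty open
set (`IsDrift.eq_of_isDrift`). -/

/-- A `C¹` function on `[0, 1]` is the restriction of a `C¹` function on `ℝ`. -/
lemma exists_contDiff_eqOn_Icc {F : Type*} [NormedAddCommGroup F] [NormedSpace ℝ F]
    [CompleteSpace F] {f : ℝ → F} (hf : ContDiffOn ℝ 1 f (Icc 0 1)) :
    ∃ g : ℝ → F, ContDiff ℝ 1 g ∧ EqOn g f (Icc 0 1) := by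
  have hd : ContinuousOn (derivWithin f (Icc 0 1)) (Icc 0 1) :=
    hf.continuousOn_derivWithin (uniqueDiffOn_Icc one_pos) le_rfl
  set f' : ℝ → F := IccExtend (zero_le_one' ℝ) ((Icc (0 : ℝ) 1).domRestrict
    (derivWithin f (Icc 0 1))) with hf'
  have hf'c : Continuous f' := hd.domRestrict.Icc_extend'
  have hder : ∀ t, HasDerivAt (fun t => f 0 + ∫ s in (0 : ℝ)..t, f' s) (f' t) t := fun t =>
    (intervalIntegral.integral_hasDerivAt_right (hf'c.intervalIntegrable _ _)
      hf'c.stronglyMeasurable.stronglyMeasurableAtFilter hf'c.continuousAt).const_add _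
  refine ⟨fun t => f 0 + ∫ s in (0 : ℝ)..t, f' s, ?_, fun t ht => ?_⟩
  · rw [contDiff_one_iff_deriv]
    exact ⟨fun t => (hder t).differentiableAt, by simpa only [funext fun t => (hder t).deriv]⟩
  · have h : ∀ s ∈ Icc (0 : ℝ) t, HasDerivWithinAt f (f' s) (Icc 0 1) s := fun s hs => by
      have hs' : s ∈ Icc (0 : ℝ) 1 := ⟨hs.1, hs.2.trans ht.2⟩
      rw [hf', IccExtend_of_mem _ _ hs']
      exact ((hf.differentiableOn one_ne_zero) s hs').hasDerivWithinAt
    have := intervalIntegral.integral_eq_sub_of_hasDeriv_right_of_le ht.1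
      (hf.continuousOn.mono (Icc_subset_Icc_right ht.2))
      (fun s hs => ((h s ⟨hs.1.le, hs.2.le⟩).mono_of_mem_nhdsWithin
        (Icc_mem_nhdsGT_of_mem ⟨hs.1.le, hs.2.trans_le ht.2⟩)))
      (hf'c.intervalIntegrable 0 t)
    simp [this]

/-! ### Potentials of time-dependent symmetric fields -/

section Potential

variable {E : Type*} [NormedAddCommGroup E] [InnerProductSpace ℝ E]

lemma sub_eq_integral_segment_of_hasFDerivAt {F : E → ℝ} {u : E → E} (hu : Continuous u)
    (hF : ∀ x, HasFDerivAt F (innerSL ℝ (u x)) x) (y h : E) :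
    F (y + h) - F y = ∫ r in (0 : ℝ)..1, inner ℝ (u (y + r • h)) h := by
  have hd : ∀ r : ℝ, HasDerivAt (fun r : ℝ => F (y + r • h)) (inner ℝ (u (y + r • h)) h) r := by
    intro r
    have h1 : HasDerivAt (fun r : ℝ => y + r • h) h r := by
      simpa using ((hasDerivAt_id r).smul_const h).const_add y
    exact (hF (y + r • h)).comp_hasDerivAt r h1
  rw [intervalIntegral.integral_eq_sub_of_hasDerivAt (fun r _ => hd r)]
  · simp
  · exact Continuous.intervalIntegrable (by fun_prop) _ _

/-- The time derivative of a time-dependent vector field. -/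
noncomputable def timePartial (v : ℝ → E → E) (t : ℝ) (x : E) : E :=
  fderiv ℝ (fun p : ℝ × E => v p.1 p.2) (t, x) (1, 0)

variable {v : ℝ → E → E}

lemma continuous_timePartial (hv : ContDiff ℝ 1 (fun p : ℝ × E => v p.1 p.2)) :
    Continuous (fun p : ℝ × E => timePartial v p.1 p.2) := by
  unfold timePartial
  exact (hv.continuous_fderiv one_ne_zero).clm_apply continuous_const

lemma hasDerivAt_timePartial (hv : ContDiff ℝ 1 (fun p : ℝ × E => v p.1 p.2)) (t : ℝ) (x : E) :
    HasDerivAt (fun s => v s x) (timePartial v t x) t := by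
  have h1 : HasDerivAt (fun s : ℝ => (s, x)) ((1 : ℝ), (0 : E)) t :=
    (hasDerivAt_id t).prodMk (hasDerivAt_const t x)
  exact ((hv.differentiable one_ne_zero (t, x)).hasFDerivAt.comp_hasDerivAt t h1)

lemma hasDerivAt_integral_segment (hv : ContDiff ℝ 1 (fun p : ℝ × E => v p.1 p.2)) (t : ℝ)
    (y h : E) :
    HasDerivAt (fun s => ∫ r in (0 : ℝ)..1, inner ℝ (v s (y + r • h)) h)
      (∫ r in (0 : ℝ)..1, inner ℝ (timePartial v t (y + r • h)) h) t := by
  have hvc := hv.continuous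
  have hct := continuous_timePartial hv
  have hc1 : ∀ s, Continuous fun r : ℝ => inner ℝ (v s (y + r • h)) h := fun s =>
    (hvc.comp (f := fun r : ℝ => (s, y + r • h)) (by fun_prop)).inner continuous_const
  have hc2 : Continuous fun p : ℝ × ℝ => inner ℝ (timePartial v p.1 (y + p.2 • h)) h :=
    (hct.comp (f := fun p : ℝ × ℝ => (p.1, y + p.2 • h)) (by fun_prop)).inner continuous_const
  obtain ⟨C, hC⟩ := ((isCompact_Icc (a := t - 1) (b := t + 1)).prod
    (isCompact_Icc (a := (0 : ℝ)) (b := 1))).exists_bound_of_continuousOn hc2.continuousOn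
  refine (intervalIntegral.hasDerivAt_integral_of_dominated_loc_of_deriv_le
    (F' := fun s r => inner ℝ (timePartial v s (y + r • h)) h)
    (bound := fun _ => C) (Icc_mem_nhds (a := t - 1) (b := t + 1) (by linarith) (by linarith))
    (.of_forall fun s => (hc1 s).aestronglyMeasurable) ((hc1 t).intervalIntegrable _ _)
    (Continuous.aestronglyMeasurable (hc2.comp (f := fun r : ℝ => (t, r)) (by fun_prop)))
    (.of_forall fun r hr s hs => ?_) (by simp) (.of_forall fun r hr s hs => ?_)).2
  · rw [uIoc_of_le zero_le_one] at hr
    exact hC (s, r) ⟨hs, hr.1.le, hr.2⟩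
  · simpa using (hasDerivAt_timePartial hv s _).inner ℝ (hasDerivAt_const s h)

/-- For each fixed time this is the Poincaré lemma; normalising the potentials to vanish at the
origin makes them differentiable in time. The Poincaré lemma cannot be applied to `∂_t v`, which is
merely continuous. Instead, the increments of `ψ` are obtained by differentiating those of `φ` in
time. -/
lemma exists_potential (hv : ContDiff ℝ 1 (fun p : ℝ × E => v p.1 p.2))
    (hsymm : ∀ t x, (fderiv ℝ (v t) x).IsSymmetric) :
    ∃ φ ψ : ℝ → E → ℝ,
      (∀ t x, HasFDerivAt (φ t) (innerSL ℝ (v t x)) x) ∧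
      (∀ t x, HasFDerivAt (ψ t) (innerSL ℝ (timePartial v t x)) x) ∧
      (∀ t x, HasDerivAt (fun s => φ s x) (ψ t x) t) ∧
      Continuous (fun p : ℝ × E => ψ p.1 p.2) := by
  have hvt : ∀ t, ContDiff ℝ 1 (v t) := fun t =>
    hv.comp (f := fun x => (t, x)) (contDiff_const.prodMk contDiff_id)
  have hct := continuous_timePartial hv
  have hF : ∀ t, ∃ F : E → ℝ, ∀ x, HasFDerivAt F (innerSL ℝ (v t x)) x := by
    intro t
    have hd : ∀ a, HasFDerivAt (fun x => innerSL ℝ (v t x))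
        ((innerSL ℝ : E →L[ℝ] E →L[ℝ] ℝ).comp (fderiv ℝ (v t) a)) a := fun a =>
      (innerSL ℝ : E →L[ℝ] E →L[ℝ] ℝ).hasFDerivAt.comp a
        ((hvt t).differentiable one_ne_zero a).hasFDerivAt
    obtain ⟨F, hF⟩ := convex_univ.exists_forall_hasFDerivAt_of_fderiv_symmetric isOpen_univ
      (fun a _ => (hd a).differentiableAt.differentiableWithinAt) (fun a _ x y => by
        rw [(hd a).fderiv]
        have := hsymm t a x y
        simp only [ContinuousLinearMap.coe_coe] at this
        simp [this, real_inner_comm])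
    exact ⟨F, fun x => hF x (mem_univ x)⟩
  choose F hF using hF
  set φ : ℝ → E → ℝ := fun t x => ∫ r in (0 : ℝ)..1, inner ℝ (v t (0 + r • x)) x with hφ
  set ψ : ℝ → E → ℝ := fun t x => ∫ r in (0 : ℝ)..1, inner ℝ (timePartial v t (0 + r • x)) x with hψ
  have hφF : ∀ t x, φ t x = F t x - F t 0 := fun t x => by
    rw [hφ]; simpa using
      (sub_eq_integral_segment_of_hasFDerivAt (hvt t).continuous (hF t) 0 x).symm
  have hφd : ∀ t x, HasFDerivAt (φ t) (innerSL ℝ (v t x)) x := fun t x => by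
    rw [funext (hφF t)]; exact (hF t x).sub_const _
  have hφt : ∀ t x, HasDerivAt (fun s => φ s x) (ψ t x) t := fun t x =>
    hasDerivAt_integral_segment hv t 0 x
  -- The integral of `∂_t v` along every segment, not only those from the origin, is an increment of
  -- `ψ`; this path independence is inherited from `φ` by uniqueness of the time derivative.
  have hψs : ∀ t y h, ψ t (y + h) - ψ t y =
      ∫ r in (0 : ℝ)..1, inner ℝ (timePartial v t (y + r • h)) h := fun t y h => by
    refine ((hφt t (y + h)).sub (hφt t y)).unique ?_
    refine (hasDerivAt_integral_segment hv t y h).congr_of_eventuallyEq (.of_forall fun s => ?_)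
    exact sub_eq_integral_segment_of_hasFDerivAt (hvt s).continuous (hφd s) y h
  refine ⟨φ, ψ, hφd, fun t x => ?_, hφt, ?_⟩
  · rw [hasFDerivAt_iff_isLittleO_nhds_zero, Asymptotics.isLittleO_iff]
    intro ε hε
    have hcx : ContinuousAt (timePartial v t) x :=
      (hct.comp (f := fun x => (t, x)) (by fun_prop)).continuousAt
    obtain ⟨δ, hδ, hδ'⟩ := Metric.continuousAt_iff.1 hcx ε hε
    filter_upwards [Metric.ball_mem_nhds (0 : E) hδ] with h hh
    have hh' : ‖h‖ < δ := by simpa using hh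
    have hci : Continuous fun r : ℝ => inner ℝ (timePartial v t (x + r • h)) h :=
      (hct.comp (f := fun r : ℝ => (t, x + r • h)) (by fun_prop)).inner continuous_const
    have heq : ψ t (x + h) - ψ t x - innerSL ℝ (timePartial v t x) h =
        ∫ r in (0 : ℝ)..1, inner ℝ (timePartial v t (x + r • h) - timePartial v t x) h := by
      rw [hψs]
      simp_rw [inner_sub_left]
      rw [intervalIntegral.integral_sub (hci.intervalIntegrable _ _) (by simp)]
      simp
    rw [heq]
    refine (intervalIntegral.norm_integral_le_of_norm_le_const (C := ε * ‖h‖) fun r hr => ?_).trans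
      (by simp)
    rw [uIoc_of_le zero_le_one] at hr
    refine (norm_inner_le_norm _ _).trans (mul_le_mul_of_nonneg_right ?_ (norm_nonneg _))
    rw [← dist_eq_norm]
    refine (hδ' ?_).le
    rw [dist_eq_norm, add_sub_cancel_left, norm_smul, Real.norm_of_nonneg hr.1.le]
    nlinarith [norm_nonneg h, hr.1, hr.2]
  · refine intervalIntegral.continuous_parametric_intervalIntegral_of_continuous'
      (f := fun (p : ℝ × E) (r : ℝ) => inner ℝ (timePartial v p.1 (0 + r • p.2)) p.2) ?_ 0 1
    exact (hct.comp (f := fun q : (ℝ × E) × ℝ => (q.1.1, 0 + q.2 • q.1.2)) (by fun_prop)).inner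
      (by fun_prop)

end Potential

lemma exists_isC1C1_gradient {d : ℕ}
    {v : ℝ → EuclideanSpace ℝ (Fin d) → EuclideanSpace ℝ (Fin d)}
    (hv : ContDiff ℝ 1 (fun p : ℝ × EuclideanSpace ℝ (Fin d) => v p.1 p.2))
    (hsymm : ∀ t x, (fderiv ℝ (v t) x).IsSymmetric) :
    ∃ φ : ℝ → EuclideanSpace ℝ (Fin d) → ℝ, IsC1C1 φ ∧ ∀ t, gradient (φ t) = v t := by
  obtain ⟨φ, ψ, hφ, hψ, ht, hc⟩ := exists_potential hv hsymm
  have hct := continuous_timePartial hv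
  have hL := (innerSL ℝ (E := EuclideanSpace ℝ (Fin d))).continuous
  have hC1 : ∀ (f : EuclideanSpace ℝ (Fin d) → ℝ)
      (u : EuclideanSpace ℝ (Fin d) → EuclideanSpace ℝ (Fin d)), Continuous u →
      (∀ x, HasFDerivAt f (innerSL ℝ (u x)) x) → ContDiff ℝ 1 f := fun f u hu hf => by
    rw [contDiff_one_iff_fderiv]
    refine ⟨fun x => (hf x).differentiableAt, ?_⟩
    rw [funext fun x => (hf x).fderiv]
    exact hL.comp hu
  refine ⟨φ, ⟨ψ, fun t _ => ⟨hC1 _ (v t) ?_ (hφ t), hC1 _ (timePartial v t) ?_ (hψ t)⟩,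
    fun t _ x => ⟨(ht t x).hasDerivWithinAt, ?_⟩, hc.continuousOn, ?_⟩, fun t => ?_⟩
  · exact hv.continuous.comp (f := fun x => (t, x)) (by fun_prop)
  · exact hct.comp (f := fun x => (t, x)) (by fun_prop)
  · simp_rw [fun s => (hφ s x).fderiv]
    rw [(hψ t x).fderiv]
    exact ((innerSL ℝ :
      EuclideanSpace ℝ (Fin d) →L[ℝ] EuclideanSpace ℝ (Fin d) →L[ℝ] ℝ).hasFDerivAt.comp_hasDerivAt
      t (hasDerivAt_timePartial hv t x)).hasDerivWithinAt
  · simp_rw [fun p : ℝ × EuclideanSpace ℝ (Fin d) => (hψ p.1 p.2).fderiv]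
    exact (hL.comp hct).continuousOn
  · ext1 x
    exact HasGradientAt.gradient (hasGradientAt_iff_hasFDerivAt.2 (hφ t x))

/-! ### Ordinary differential equations: global existence, uniqueness, differentiability in the
initial value -/

section ODE

open Metric Filter Topology NNReal

/-- `u` is an integral curve on `[0, T]` of the time-dependent field `f`. -/
def IsCurveOn {F : Type*} [NormedAddCommGroup F] [NormedSpace ℝ F] (f : ℝ → F → F) (T : ℝ)
    (u : ℝ → F) : Prop :=
  ∀ t ∈ Icc (0 : ℝ) T, HasDerivWithinAt u (f t (u t)) (Icc 0 T) t

/-- A Lipschitz cutoff equal to `1` on the ball of radius `R`, and to `0` off that of radius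
`2 * R`. -/
noncomputable def radialCutoff {F : Type*} [NormedAddCommGroup F] (R : ℝ) (x : F) : ℝ :=
  max 0 (min 1 (2 - ‖x‖ / R))

section Cutoff

variable {F : Type*} [NormedAddCommGroup F] {R : ℝ}

lemma radialCutoff_nonneg (x : F) : 0 ≤ radialCutoff R x := le_max_left _ _

lemma radialCutoff_le_one (x : F) : radialCutoff R x ≤ 1 :=
  max_le zero_le_one (min_le_left _ _)

lemma radialCutoff_eq_one (hR : 0 < R) {x : F} (hx : ‖x‖ ≤ R) : radialCutoff R x = 1 := by
  have : ‖x‖ / R ≤ 1 := (div_le_one hR).2 hx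
  rw [radialCutoff, min_eq_left (by linarith), max_eq_right zero_le_one]

lemma radialCutoff_eq_zero (hR : 0 < R) {x : F} (hx : 2 * R ≤ ‖x‖) : radialCutoff R x = 0 := by
  have : 2 ≤ ‖x‖ / R := (le_div_iff₀ hR).2 hx
  rw [radialCutoff, max_eq_left]
  exact (min_le_right _ _).trans (by linarith)

lemma abs_radialCutoff_sub_le (hR : 0 < R) (x y : F) :
    |radialCutoff R x - radialCutoff R y| ≤ ‖x - y‖ / R := by
  unfold radialCutoff
  have h1 := abs_max_sub_max_le_abs (min 1 (2 - ‖x‖ / R)) (min 1 (2 - ‖y‖ / R)) 0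
  have h2 := abs_min_sub_min_le_max 1 (2 - ‖x‖ / R) 1 (2 - ‖y‖ / R)
  rw [max_comm 0, max_comm 0]
  refine h1.trans (h2.trans ?_)
  have h3 : |2 - ‖x‖ / R - (2 - ‖y‖ / R)| = |‖y‖ - ‖x‖| / R := by
    rw [show 2 - ‖x‖ / R - (2 - ‖y‖ / R) = (‖y‖ - ‖x‖) / R by ring, abs_div, abs_of_pos hR]
  rw [h3, sub_self, abs_zero, max_eq_right (by positivity)]
  gcongr
  rw [norm_sub_rev]
  exact abs_norm_sub_norm_le y x

variable [NormedSpace ℝ F]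

/-- The cutoff turns a field controlled only on a ball into a globally Lipschitz one, so that
Picard–Lindelöf applies on a whole time interval. The term `M / R` is the bound on the field times
the Lipschitz constant `1 / R` of the cutoff. -/
lemma lipschitzWith_radialCutoff_smul (hR : 0 < R) {K M : ℝ≥0} {f : F → F}
    (hf : LipschitzOnWith K f (closedBall 0 (2 * R))) (hM : ∀ x ∈ closedBall (0 : F) (2 * R),
      ‖f x‖ ≤ M) :
    LipschitzWith (K + M / R.toNNReal) (fun x => radialCutoff R x • f x) := by
  have hRr : ((R.toNNReal : ℝ≥0) : ℝ) = R := Real.coe_toNNReal R hR.le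
  -- Only one of the two points has to lie in the ball: outside it the cutoff vanishes and the size
  -- of `f` is irrelevant.
  have key : ∀ x y : F, ‖x‖ ≤ 2 * R →
      ‖radialCutoff R x • f x - radialCutoff R y • f y‖ ≤ (K + M / R) * ‖x - y‖ := by
    intro x y hx
    have hx' : x ∈ closedBall (0 : F) (2 * R) := by simpa using hx
    have h1 : ‖(radialCutoff R x - radialCutoff R y) • f x‖ ≤ M / R * ‖x - y‖ := by
      rw [norm_smul, Real.norm_eq_abs]
      calc _ ≤ ‖x - y‖ / R * M := mul_le_mul (abs_radialCutoff_sub_le hR x y) (hM x hx')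
            (norm_nonneg _) (by positivity)
        _ = _ := by ring
    rcases le_or_gt (2 * R) ‖y‖ with hy | hy
    · rw [radialCutoff_eq_zero hR hy, sub_zero] at h1
      rw [radialCutoff_eq_zero hR hy, zero_smul, sub_zero]
      refine h1.trans (mul_le_mul_of_nonneg_right ?_ (norm_nonneg _))
      have := K.2
      linarith [show (0 : ℝ) ≤ K from K.2]
    · have hy' : y ∈ closedBall (0 : F) (2 * R) := by simpa using hy.le
      have h2 : ‖radialCutoff R y • (f x - f y)‖ ≤ K * ‖x - y‖ := by
        rw [norm_smul, Real.norm_of_nonneg (radialCutoff_nonneg y)]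
        have h3 := hf.dist_le_mul x hx' y hy'
        rw [dist_eq_norm, dist_eq_norm] at h3
        calc _ ≤ 1 * ‖f x - f y‖ := by gcongr; exact radialCutoff_le_one y
          _ ≤ _ := by rwa [one_mul]
      calc _ = ‖(radialCutoff R x - radialCutoff R y) • f x
            + radialCutoff R y • (f x - f y)‖ := by congr 1; module
        _ ≤ _ := (norm_add_le _ _).trans (by linarith)
  refine LipschitzWith.of_dist_le_mul fun x y => ?_
  rw [dist_eq_norm, dist_eq_norm]
  push_cast
  rw [hRr]
  rcases le_total ‖x‖ (2 * R) with hx | hx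
  · exact key x y hx
  · rcases le_total ‖y‖ (2 * R) with hy | hy
    · rw [norm_sub_rev, norm_sub_rev x]; exact key y x hy
    · rw [radialCutoff_eq_zero hR hx, radialCutoff_eq_zero hR hy]
      simp only [zero_smul, sub_self, norm_zero]
      positivity

lemma exists_isCurveOn_radialCutoff [CompleteSpace F] (hR : 0 < R) {T : ℝ} (hT : 0 ≤ T)
    {f : ℝ → F → F} {K M : ℝ≥0}
    (hf : ∀ t ∈ Icc 0 T, LipschitzOnWith K (f t) (closedBall 0 (2 * R)))
    (hfc : ∀ x, ContinuousOn (f · x) (Icc 0 T))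
    (hM : ∀ t ∈ Icc 0 T, ∀ x ∈ closedBall (0 : F) (2 * R), ‖f t x‖ ≤ M) (x₀ : F) :
    ∃ u : ℝ → F, u 0 = x₀ ∧ IsCurveOn (fun t x => radialCutoff R x • f t x) T u := by
  -- The cut-off field has norm at most `M` everywhere, so within time `T` a solution stays within
  -- distance `M * T` of its start, and the solution exists on all of `[0, T]`.
  have hPL : IsPicardLindelof (fun t x => radialCutoff R x • f t x) (tmin := 0) (tmax := T)
      ⟨0, left_mem_Icc.2 hT⟩ x₀ (M * T.toNNReal) 0 M (K + M / R.toNNReal) :=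
    { lipschitzOnWith := fun t ht =>
        (lipschitzWith_radialCutoff_smul hR (hf t ht) (hM t ht)).lipschitzOnWith
      continuousOn := fun x _ => (hfc x).const_smul _
      norm_le := fun t ht x _ => by
        rw [norm_smul, Real.norm_of_nonneg (radialCutoff_nonneg x)]
        rcases le_total ‖x‖ (2 * R) with hx | hx
        · calc _ ≤ 1 * (M : ℝ) := mul_le_mul (radialCutoff_le_one x)
                (hM t ht x (by simpa using hx)) (norm_nonneg _) zero_le_one
            _ = _ := one_mul _
        · rw [radialCutoff_eq_zero hR hx, zero_mul]; exact M.2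
      mul_max_le := by simp [hT] }
  exact hPL.exists_eq_forall_mem_Icc_hasDerivWithinAt₀

end Cutoff

section Banach

variable {F : Type*} [NormedAddCommGroup F] [NormedSpace ℝ F] {T : ℝ} {f : ℝ → F → F} {u : ℝ → F}

lemma IsCurveOn.continuousOn (hu : IsCurveOn f T u) : ContinuousOn u (Icc 0 T) :=
  fun t ht => (hu t ht).continuousWithinAt

lemma HasDerivWithinAt.Ici_of_Icc {u' : F} {a b t : ℝ} (h : HasDerivWithinAt u u' (Icc a b) t)
    (ht : t ∈ Ico a b) : HasDerivWithinAt u u' (Ici t) t :=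
  h.mono_of_mem_nhdsWithin (Icc_mem_nhdsGE_of_mem ht)

lemma IsCurveOn.of_radialCutoff {R : ℝ} (hR : 0 < R)
    (hu : IsCurveOn (fun t x => radialCutoff R x • f t x) T u)
    (hb : ∀ t ∈ Icc 0 T, ‖u t‖ ≤ R) : IsCurveOn f T u := fun t ht => by
  simpa only [radialCutoff_eq_one hR (hb t ht), one_smul] using hu t ht

/-- Linear differential equations have global solutions. -/
lemma exists_isCurveOn_linear [CompleteSpace F] (hT : 0 ≤ T) {A : ℝ → F →L[ℝ] F}
    (hA : ContinuousOn A (Icc 0 T)) (x₀ : F) :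
    ∃ u : ℝ → F, u 0 = x₀ ∧ IsCurveOn (fun t x => A t x) T u := by
  obtain ⟨C, hC⟩ := isCompact_Icc.exists_bound_of_continuousOn hA
  set K : ℝ≥0 := C.toNNReal
  have hK : ∀ t ∈ Icc 0 T, ‖A t‖ ≤ K := fun t ht => (hC t ht).trans (Real.le_coe_toNNReal C)
  -- `R` dominates the Grönwall bound `‖x₀‖ * exp (K * T)` for the cut-off equation, so the cutoff
  -- is never active along the solution; the `+ 1` keeps `R` positive.
  set R : ℝ := (‖x₀‖ + 1) * Real.exp (K * T) with hRdef
  have hR : 0 < R := by positivity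
  obtain ⟨u, hu0, hu⟩ := exists_isCurveOn_radialCutoff (f := fun t x => A t x)
    (K := K) (M := K * (2 * R).toNNReal) hR hT
    (fun t ht => ((A t).lipschitz.weaken (hK t ht)).lipschitzOnWith)
    (fun x => hA.clm_apply continuousOn_const)
    (fun t ht x hx => by
      rw [NNReal.coe_mul, Real.coe_toNNReal (2 * R) (by linarith)]
      exact (A t).le_of_opNorm_le_of_le (hK t ht) (mem_closedBall_zero_iff.1 hx)) x₀
  refine ⟨u, hu0, hu.of_radialCutoff hR fun t ht => ?_⟩
  have h := norm_le_gronwallBound_of_norm_deriv_right_le (δ := ‖x₀‖) (K := K) (ε := 0)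
    hu.continuousOn (fun s hs => (hu s (Ico_subset_Icc_self hs)).Ici_of_Icc hs)
    (by rw [hu0]) (fun s hs => by
      rw [norm_smul, Real.norm_of_nonneg (radialCutoff_nonneg _), add_zero]
      calc _ ≤ 1 * (K * ‖u s‖) := mul_le_mul (radialCutoff_le_one _)
            ((A s).le_of_opNorm_le (hK s (Ico_subset_Icc_self hs)) _) (norm_nonneg _) zero_le_one
        _ = _ := one_mul _) t ht
  rw [gronwallBound_ε0, sub_zero] at h
  refine h.trans ?_
  rw [hRdef]
  gcongr
  · linarith
  · exact ht.2

end Banach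

section Hilbert

variable {E : Type*} [NormedAddCommGroup E] [InnerProductSpace ℝ E] [FiniteDimensional ℝ E]
  {T : ℝ} {W : ℝ → E → E}

omit [FiniteDimensional ℝ E] in
lemma hasFDerivAt_slice (hW : ContDiff ℝ 1 (fun p : ℝ × E => W p.1 p.2)) (t : ℝ) (x : E) :
    HasFDerivAt (W t) (fderiv ℝ (W t) x) x := by
  have : ContDiff ℝ 1 (W t) := hW.comp (f := fun x => (t, x)) (contDiff_const.prodMk contDiff_id)
  exact (this.differentiable one_ne_zero x).hasFDerivAt

omit [FiniteDimensional ℝ E] in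
lemma continuous_fderiv_slice (hW : ContDiff ℝ 1 (fun p : ℝ × E => W p.1 p.2)) :
    Continuous (fun p : ℝ × E => fderiv ℝ (W p.1) p.2) := by
  have h : ∀ p : ℝ × E, fderiv ℝ (W p.1) p.2 =
      (fderiv ℝ (fun p : ℝ × E => W p.1 p.2) p).comp (ContinuousLinearMap.inr ℝ ℝ E) := fun p => by
    have h1 : HasFDerivAt (fun x : E => (p.1, x)) (ContinuousLinearMap.inr ℝ ℝ E) p.2 :=
      (hasFDerivAt_const p.1 p.2).prodMk (hasFDerivAt_id p.2)
    exact ((hW.differentiable one_ne_zero p).hasFDerivAt.comp p.2 h1).fderiv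
  rw [funext h]
  exact (hW.continuous_fderiv one_ne_zero).clm_comp continuous_const

lemma exists_lipschitzOnWith_closedBall (hW : ContDiff ℝ 1 (fun p : ℝ × E => W p.1 p.2))
    (T R : ℝ) : ∃ K : ℝ≥0, ∀ t ∈ Icc 0 T, LipschitzOnWith K (W t) (closedBall 0 R) := by
  obtain ⟨C, hC⟩ := ((isCompact_Icc (a := (0 : ℝ)) (b := T)).prod
    (isCompact_closedBall (0 : E) R)).exists_bound_of_continuousOn
    (continuous_fderiv_slice hW).continuousOn
  refine ⟨C.toNNReal, fun t ht => ?_⟩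
  refine (convex_closedBall (0 : E) R).lipschitzOnWith_of_nnnorm_fderiv_le
    (fun x _ => (hasFDerivAt_slice hW t x).differentiableAt) fun x hx => ?_
  rw [← NNReal.coe_le_coe]
  exact (hC (t, x) ⟨ht, hx⟩).trans (Real.le_coe_toNNReal C)

lemma IsCurveOn.eqOn (hW : ContDiff ℝ 1 (fun p : ℝ × E => W p.1 p.2)) {u₁ u₂ : ℝ → E}
    (h₁ : IsCurveOn W T u₁) (h₂ : IsCurveOn W T u₂) (h0 : u₁ 0 = u₂ 0) :
    EqOn u₁ u₂ (Icc 0 T) := by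
  obtain ⟨C₁, hC₁⟩ := isCompact_Icc.exists_bound_of_continuousOn h₁.continuousOn
  obtain ⟨C₂, hC₂⟩ := isCompact_Icc.exists_bound_of_continuousOn h₂.continuousOn
  obtain ⟨K, hK⟩ := exists_lipschitzOnWith_closedBall hW T (max C₁ C₂)
  refine ODE_solution_unique_of_mem_Icc_right (v := W) (s := fun _ => closedBall 0 (max C₁ C₂))
    (fun t ht => hK t (Ico_subset_Icc_self ht))
    h₁.continuousOn (fun t ht => (h₁ t (Ico_subset_Icc_self ht)).Ici_of_Icc ht) (fun t ht => ?_)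
    h₂.continuousOn (fun t ht => (h₂ t (Ico_subset_Icc_self ht)).Ici_of_Icc ht) (fun t ht => ?_) h0
  · simpa using Or.inl (hC₁ t (Ico_subset_Icc_self ht))
  · simpa using Or.inr (hC₂ t (Ico_subset_Icc_self ht))

/-- Solutions exist globally if the radial growth of the field is at most linear away from time
`0`, and they are bounded uniformly for initial conditions in a ball. -/
lemma exists_isCurveOn_of_inner_le (hW : ContDiff ℝ 1 (fun p : ℝ × E => W p.1 p.2)) (hT : 0 < T)
    (hgrow : ∀ δ > 0, ∃ C : ℝ, ∀ t ∈ Icc δ T, ∀ x, inner ℝ (W t x) x ≤ C * (1 + ‖x‖ ^ 2))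
    {r : ℝ} (hr : 0 < r) :
    ∃ R : ℝ, ∀ x₀ : E, ‖x₀‖ ≤ r →
      ∃ u : ℝ → E, u 0 = x₀ ∧ IsCurveOn W T u ∧ ∀ t ∈ Icc 0 T, ‖u t‖ ≤ R := by
  obtain ⟨M₀', hM₀'⟩ := ((isCompact_Icc (a := (0 : ℝ)) (b := T)).prod
    (isCompact_closedBall (0 : E) (2 * r))).exists_bound_of_continuousOn hW.continuous.continuousOn
  set M₀ := max M₀' 0
  have hM₀0 : 0 ≤ M₀ := le_max_right _ _
  have hM₀ : ∀ t ∈ Icc 0 T, ∀ x : E, ‖x‖ ≤ 2 * r → ‖W t x‖ ≤ M₀ := fun t ht x hx =>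
    (hM₀' (t, x) ⟨ht, by simpa using hx⟩).trans (le_max_left _ _)
  -- Up to time `δ` a curve started in the ball of radius `r` cannot leave that of radius `2 * r`,
  -- whatever the growth of the field. The speed `M₀ + 1` is used to have the strict inequality
  -- required by the comparison.
  set δ := min T (r / (M₀ + 1)) with hδdef
  have hδ : 0 < δ := lt_min hT (by positivity)
  have hδT : δ ≤ T := min_le_left _ _
  have hδr : (M₀ + 1) * δ ≤ r := by
    have := min_le_right T (r / (M₀ + 1))
    rw [← hδdef, le_div_iff₀ (by positivity)] at this
    linarith
  obtain ⟨C', hC'⟩ := hgrow δ hδ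
  set C := max C' 0
  have hC0 : 0 ≤ C := le_max_right _ _
  have hC : ∀ t ∈ Icc δ T, ∀ x, inner ℝ (W t x) x ≤ C * (1 + ‖x‖ ^ 2) := fun t ht x =>
    (hC' t ht x).trans (by gcongr; exact le_max_left _ _)
  -- The Grönwall bound for `1 + ‖u‖ ^ 2` started at time `δ` from the ball of radius `2 * r`.
  set Q := (1 + (2 * r) ^ 2) * Real.exp (2 * C * T) with hQ
  have hQ1 : 1 ≤ Q := one_le_mul_of_one_le_of_one_le (by nlinarith) (Real.one_le_exp (by positivity))
  set R := 2 * r + Q with hRdef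
  have hR : 0 < R := by positivity
  obtain ⟨K, hK⟩ := exists_lipschitzOnWith_closedBall hW T (2 * R)
  obtain ⟨M, hM⟩ := ((isCompact_Icc (a := (0 : ℝ)) (b := T)).prod
    (isCompact_closedBall (0 : E) (2 * R))).exists_bound_of_continuousOn hW.continuous.continuousOn
  refine ⟨R, fun x₀ hx₀ => ?_⟩
  obtain ⟨u, hu0, hu⟩ := exists_isCurveOn_radialCutoff (f := W) (M := M.toNNReal) hR hT.le hK
    (fun x => (hW.continuous.comp (f := fun t => (t, x)) (by fun_prop)).continuousOn)
    (fun t ht x hx => (hM (t, x) ⟨ht, hx⟩).trans (Real.le_coe_toNNReal M)) x₀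
  have huR : ∀ t ∈ Ico 0 T, HasDerivWithinAt u (radialCutoff R (u t) • W t (u t)) (Ici t) t :=
    fun t ht => (hu t (Ico_subset_Icc_self ht)).Ici_of_Icc ht
  have h1 : ∀ t ∈ Icc 0 δ, ‖u t‖ ≤ 2 * r := by
    intro t ht
    have := image_norm_le_of_norm_deriv_right_lt_deriv_boundary
      (B := fun t => r + (M₀ + 1) * t) (B' := fun _ => M₀ + 1)
      (hu.continuousOn.mono (Icc_subset_Icc_right hδT))
      (fun s hs => huR s ⟨hs.1, hs.2.trans_le hδT⟩) (by simpa [hu0] using hx₀)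
      (fun s => by simpa using ((hasDerivAt_id s).const_mul (M₀ + 1)).const_add r)
      (fun s hs heq => ?_) ht
    · refine this.trans ?_
      have : (M₀ + 1) * t ≤ (M₀ + 1) * δ := by gcongr; exact ht.2
      linarith
    · rw [norm_smul, Real.norm_of_nonneg (radialCutoff_nonneg _)]
      have h2 : ‖u s‖ ≤ 2 * r := by
        have : (M₀ + 1) * s ≤ (M₀ + 1) * δ := by gcongr; exact hs.2.le
        rw [heq]; linarith
      have h3 := hM₀ s ⟨hs.1, hs.2.le.trans hδT⟩ _ h2
      calc _ ≤ 1 * M₀ := mul_le_mul (radialCutoff_le_one _) h3 (norm_nonneg _) zero_le_one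
        _ < _ := by linarith
  have h2 : ∀ t ∈ Icc δ T, 1 + ‖u t‖ ^ 2 ≤ Q := by
    intro t ht
    have hd : ∀ s ∈ Ico δ T, HasDerivWithinAt (fun s => 1 + ‖u s‖ ^ 2)
        (2 * inner ℝ (u s) (radialCutoff R (u s) • W s (u s))) (Ici s) s := fun s hs =>
      ((huR s ⟨hδ.le.trans hs.1, hs.2⟩).norm_sq).const_add 1
    have := le_gronwallBound_of_liminf_deriv_right_le (δ := 1 + (2 * r) ^ 2) (K := 2 * C) (ε := 0)
      (f := fun s => 1 + ‖u s‖ ^ 2)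
      (((hu.continuousOn.mono (Icc_subset_Icc_left hδ.le)).norm.pow 2).const_add 1)
      (fun s hs r hr => (hd s hs).liminf_right_slope_le hr)
      (by have := h1 δ ⟨hδ.le, le_rfl⟩; gcongr) (fun s hs => ?_) t ht
    · rw [gronwallBound_ε0] at this
      refine this.trans ?_
      rw [hQ]
      gcongr
      linarith [ht.2]
    · rw [inner_smul_right, real_inner_comm, add_zero]
      have h3 := hC s (Ico_subset_Icc_self hs) (u s)
      -- The cutoff preserves the one-sided growth bound because it lies in `[0, 1]` and `C` is
      -- nonnegative.
      have h4 : radialCutoff R (u s) * inner ℝ (W s (u s)) (u s) ≤ 1 * (C * (1 + ‖u s‖ ^ 2)) :=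
        (mul_le_mul_of_nonneg_left h3 (radialCutoff_nonneg _)).trans
          (mul_le_mul_of_nonneg_right (radialCutoff_le_one _) (by positivity))
      linarith
  have hb : ∀ t ∈ Icc 0 T, ‖u t‖ ≤ R := by
    intro t ht
    rcases le_total t δ with h | h
    · linarith [h1 t ⟨ht.1, h⟩]
    · have := h2 t ⟨h, ht.2⟩
      nlinarith [norm_nonneg (u t)]
  exact ⟨u, hu0, hu.of_radialCutoff hR hb, hb⟩

/-- Differentiability of solutions with respect to the initial condition. -/
lemma differentiableAt_flow (hW : ContDiff ℝ 1 (fun p : ℝ × E => W p.1 p.2)) (hT : 0 ≤ T)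
    {g : ℝ → E → E} (hg0 : ∀ x, g 0 x = x) (hg : ∀ x, IsCurveOn W T (g · x)) {x : E} {R : ℝ}
    (hR : ∀ᶠ y in 𝓝 x, ∀ t ∈ Icc 0 T, ‖g t y‖ ≤ R) {t : ℝ} (ht : t ∈ Icc 0 T) :
    DifferentiableAt ℝ (g t) x := by
  set X : ℝ → E := (g · x) with hX
  have hXc : ContinuousOn X (Icc 0 T) := (hg x).continuousOn
  have hDc := continuous_fderiv_slice hW
  have hAc : ContinuousOn (fun s => fderiv ℝ (W s) (X s)) (Icc 0 T) :=
    hDc.comp_continuousOn (continuousOn_id.prodMk hXc)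
  -- `Φ` solves the variational equation `Φ' = DW(X) Φ` with `Φ 0 = id`; it is the candidate
  -- derivative of the flow.
  obtain ⟨Φ, hΦ0, hΦ⟩ := exists_isCurveOn_linear (F := E →L[ℝ] E) hT
    (A := fun s => ContinuousLinearMap.compL ℝ E E E (fderiv ℝ (W s) (X s)))
    ((ContinuousLinearMap.compL ℝ E E E).continuous.comp_continuousOn hAc)
    (ContinuousLinearMap.id ℝ E)
  obtain ⟨B', hB'⟩ := isCompact_Icc.exists_bound_of_continuousOn hΦ.continuousOn
  set B := max B' 1
  have hB1 : 1 ≤ B := le_max_right _ _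
  have hB : ∀ s ∈ Icc 0 T, ‖Φ s‖ ≤ B := fun s hs => (hB' s hs).trans (le_max_left _ _)
  have hXR : ∀ s ∈ Icc 0 T, ‖X s‖ ≤ R := hR.self_of_nhds
  -- The radius `R + 1` leaves room for the approximate solution `X + Φ h`. Taking `K ≥ 1` below
  -- avoids the separate form of the Grönwall bound at `K = 0`.
  obtain ⟨K', hK'⟩ := exists_lipschitzOnWith_closedBall hW T (R + 1)
  set K : ℝ≥0 := max K' 1
  have hK1 : (1 : ℝ) ≤ K := by exact_mod_cast le_max_right K' 1
  have hK : ∀ s ∈ Icc 0 T, LipschitzOnWith K (W s) (closedBall 0 (R + 1)) := fun s hs =>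
    (hK' s hs).weaken (le_max_left _ _)
  have huc := ((isCompact_Icc (a := (0 : ℝ)) (b := T)).prod
    (isCompact_closedBall (0 : E) (R + 1))).uniformContinuousOn_of_continuous hDc.continuousOn
  set G := (Real.exp (K * T) - 1) / K with hG
  have hG0 : 0 ≤ G := by
    have : 1 ≤ Real.exp (K * T) := Real.one_le_exp (by positivity)
    exact div_nonneg (by linarith) (by linarith)
  suffices HasFDerivAt (g t) (Φ t) x from this.differentiableAt
  rw [hasFDerivAt_iff_isLittleO_nhds_zero, Asymptotics.isLittleO_iff]
  intro ε₀ hε₀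
  -- Chosen so that the final Grönwall error `ε * B * G * ‖h‖` is at most `ε₀ * ‖h‖`.
  set ε := ε₀ / (B * (G + 1)) with hεdef
  have hε : 0 < ε := by positivity
  obtain ⟨η', hη', hη''⟩ := Metric.uniformContinuousOn_iff.1 huc ε hε
  set η := min η' 1
  have hη : 0 < η := lt_min hη' one_pos
  have hR' : ∀ᶠ h in 𝓝 (0 : E), ∀ t ∈ Icc 0 T, ‖g t (x + h)‖ ≤ R := by
    have : Tendsto (fun h => x + h) (𝓝 0) (𝓝 x) := by
      simpa using (continuous_const.add continuous_id).tendsto (f := fun h : E => x + h) 0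
    exact this.eventually hR
  filter_upwards [hR', Metric.ball_mem_nhds (0 : E) (show 0 < η / B by positivity)] with h hhR hh
  have hhη : B * ‖h‖ < η := by
    rw [mem_ball_zero_iff, lt_div_iff₀ (by positivity)] at hh
    linarith
  have hΦh : ∀ s ∈ Icc 0 T, ‖Φ s h‖ ≤ B * ‖h‖ := fun s hs =>
    (Φ s).le_of_opNorm_le (hB s hs) h
  have hYmem : ∀ s ∈ Icc 0 T, ∀ z : E, ‖z - X s‖ ≤ B * ‖h‖ → z ∈ closedBall (0 : E) (R + 1) := by
    intro s hs z hz
    rw [mem_closedBall_zero_iff]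
    calc ‖z‖ = ‖X s + (z - X s)‖ := by congr 1; abel
      _ ≤ ‖X s‖ + ‖z - X s‖ := norm_add_le _ _
      _ ≤ R + 1 := by linarith [hXR s hs, min_le_right η' 1]
  have hYd : ∀ s ∈ Icc 0 T, HasDerivWithinAt (fun s => X s + Φ s h)
      (W s (X s) + fderiv ℝ (W s) (X s) (Φ s h)) (Icc 0 T) s := fun s hs => by
    have h1 := (hΦ s hs).clm_apply (hasDerivWithinAt_const s (Icc 0 T) h)
    simp only [map_zero, add_zero] at h1
    exact ((hg x) s hs).add h1
  -- The curve `X + Φ h` solves the equation up to an error `ε * (B * ‖h‖)`: the linearisation error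
  -- is controlled by the oscillation of `DW` on the segment, which is small by uniform continuity
  -- on a compact set.
  have hYerr : ∀ s ∈ Icc 0 T, dist (W s (X s) + fderiv ℝ (W s) (X s) (Φ s h))
      (W s (X s + Φ s h)) ≤ ε * (B * ‖h‖) := by
    intro s hs
    have hseg : ∀ z ∈ segment ℝ (X s) (X s + Φ s h), ‖fderiv ℝ (W s) z - fderiv ℝ (W s) (X s)‖
        ≤ ε := by
      intro z hz
      have hz1 : ‖z - X s‖ ≤ B * ‖h‖ := by
        have := norm_sub_le_of_mem_segment hz
        rw [add_sub_cancel_left] at this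
        exact this.trans (hΦh s hs)
      rw [← dist_eq_norm]
      refine (hη'' (s, z) ⟨hs, hYmem s hs z hz1⟩ (s, X s)
        ⟨hs, hYmem s hs _ (by simp; positivity)⟩ ?_).le
      rw [Prod.dist_eq, dist_self, max_eq_right dist_nonneg, dist_eq_norm]
      exact hz1.trans_lt (hhη.trans_le (min_le_left _ _))
    have := (convex_segment (X s) (X s + Φ s h)).norm_image_sub_le_of_norm_hasFDerivWithin_le'
      (fun z _ => (hasFDerivAt_slice hW s z).hasFDerivWithinAt) hseg
      (left_mem_segment ℝ _ _) (right_mem_segment ℝ _ _)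
    rw [add_sub_cancel_left] at this
    rw [dist_eq_norm, norm_sub_rev, ← sub_sub]
    exact this.trans (mul_le_mul_of_nonneg_left (hΦh s hs) hε.le)
  have hfin := dist_le_of_approx_trajectories_ODE_of_mem (v := W)
    (s := fun _ => closedBall (0 : E) (R + 1)) (K := K) (a := 0) (b := T) (δ := 0)
    (f := (g · (x + h))) (f' := fun s => W s (g s (x + h))) (εf := 0)
    (g := fun s => X s + Φ s h) (g' := fun s => W s (X s) + fderiv ℝ (W s) (X s) (Φ s h))
    (εg := ε * (B * ‖h‖))
    (fun s hs => hK s (Ico_subset_Icc_self hs)) (hg (x + h)).continuousOn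
    (fun s hs => ((hg (x + h)) s (Ico_subset_Icc_self hs)).Ici_of_Icc hs)
    (fun s hs => by simp)
    (fun s hs => by
      rw [mem_closedBall_zero_iff]
      linarith [hhR s (Ico_subset_Icc_self hs)])
    (fun s hs => (hYd s hs).continuousWithinAt)
    (fun s hs => (hYd s (Ico_subset_Icc_self hs)).Ici_of_Icc hs)
    (fun s hs => hYerr s (Ico_subset_Icc_self hs))
    (fun s hs => hYmem s (Ico_subset_Icc_self hs) _ (by
      rw [add_sub_cancel_left]; exact hΦh s (Ico_subset_Icc_self hs)))
    (by simp [hX, hg0, hΦ0]) t ht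
  rw [dist_eq_norm, ← sub_sub, zero_add, sub_zero,
    gronwallBound_of_K_ne_0 (zero_lt_one.trans_le hK1).ne'] at hfin
  refine hfin.trans ?_
  have hexp : Real.exp (K * t) ≤ Real.exp (K * T) := by
    gcongr
    exact ht.2
  calc 0 * Real.exp (K * t) + ε * (B * ‖h‖) / K * (Real.exp (K * t) - 1)
      ≤ ε * (B * ‖h‖) / K * (Real.exp (K * T) - 1) := by
        rw [zero_mul, zero_add]
        gcongr
    _ = ε * B * G * ‖h‖ := by rw [hG]; ring
    _ ≤ ε * B * (G + 1) * ‖h‖ := by gcongr; linarith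
    _ = ε₀ * ‖h‖ := by
        have : B ≠ 0 := by positivity
        have : G + 1 ≠ 0 := by positivity
        rw [hεdef]; field_simp

/-- Existence of a global flow, its differentiability, and a bound that is locally uniform in the
initial condition. -/
lemma exists_flow (hW : ContDiff ℝ 1 (fun p : ℝ × E => W p.1 p.2)) (hT : 0 < T)
    (hgrow : ∀ δ > 0, ∃ C : ℝ, ∀ t ∈ Icc δ T, ∀ x, inner ℝ (W t x) x ≤ C * (1 + ‖x‖ ^ 2)) :
    ∃ g : ℝ → E → E, (∀ x, g 0 x = x) ∧ (∀ x, IsCurveOn W T (g · x)) ∧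
      ∀ t ∈ Icc 0 T, Differentiable ℝ (g t) := by
  -- The radius `‖x‖ + 1` makes the bound `R x` uniform over the unit ball around `x`, as
  -- differentiability at `x` requires.
  choose R hR using fun x : E =>
    exists_isCurveOn_of_inner_le hW hT hgrow (r := ‖x‖ + 1) (by positivity)
  choose! u hu0 hu _ using fun x => hR x x (by linarith)
  refine ⟨fun t x => u x t, hu0, hu, fun t ht x =>
    differentiableAt_flow (R := R x) hW hT.le hu0 hu ?_ ht⟩
  filter_upwards [Metric.ball_mem_nhds x one_pos] with y hy s hs
  have hy' : ‖y‖ ≤ ‖x‖ + 1 := by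
    have := norm_sub_norm_le y x
    rw [mem_ball, dist_eq_norm] at hy
    linarith
  obtain ⟨w, hw0, hw, hwR⟩ := hR x y hy'
  -- The curve chosen for `y` itself carries no bound by `R x`; uniqueness identifies it with the
  -- bounded curve `w`.
  rw [(hu y).eqOn hW hw (by rw [hu0, hw0]) hs]
  exact hwR s hs

end Hilbert

end ODE

/-! ### The Brunn–Minkowski and Prékopa–Leindler inequalities at midpoints -/

section PrekopaLeindler

open scoped ENNReal

lemma volume_preimage_two_mul_sub (s : Set ℝ) (c : ℝ) :
    2 * volume ((fun z : ℝ => 2 * z - c) ⁻¹' s) = volume s := by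
  have h : (fun z : ℝ => 2 * z - c) ⁻¹' s = (2 * ·) ⁻¹' ((· + (-c)) ⁻¹' s) := by
    ext z; simp [sub_eq_add_neg]
  rw [h, Real.volume_preimage_mul_left two_ne_zero, measure_preimage_add_right, ← mul_assoc,
    abs_of_pos (by norm_num), ENNReal.ofReal_inv_of_pos two_pos, ENNReal.ofReal_ofNat,
    ENNReal.mul_inv_cancel two_ne_zero (by simp), one_mul]

/-- With `a = max A` and `b = min B`, the half-size copies `(A + b) / 2` and `(a + B) / 2` both lie
in `C`, on opposite sides of `(a + b) / 2`, so they overlap in at most one point. -/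
lemma volume_add_le_of_midpoint_mem_of_isCompact {A B C : Set ℝ} (hA : IsCompact A)
    (hB : IsCompact B) (hA' : A.Nonempty) (hB' : B.Nonempty)
    (h : ∀ a ∈ A, ∀ b ∈ B, (a + b) / 2 ∈ C) : volume A + volume B ≤ 2 * volume C := by
  obtain ⟨a, ha, hmax⟩ := hA.exists_isGreatest hA'
  obtain ⟨b, hb, hmin⟩ := hB.exists_isLeast hB'
  have hA₁ : (fun z : ℝ => 2 * z - b) ⁻¹' A ⊆ C ∩ Iic ((a + b) / 2) := fun z hz => by
    have h1 := h _ hz b hb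
    have h2 := hmax hz
    simp only [sub_add_cancel, mul_div_cancel_left₀ z (two_ne_zero' ℝ)] at h1
    exact ⟨h1, by simp only [mem_Iic]; linarith⟩
  have hB₁ : (fun z : ℝ => 2 * z - a) ⁻¹' B ⊆ C ∩ Ici ((a + b) / 2) := fun z hz => by
    have h1 := h a ha _ hz
    have h2 := hmin hz
    simp only [add_sub_cancel, mul_div_cancel_left₀ z (two_ne_zero' ℝ)] at h1
    exact ⟨h1, by simp only [mem_Ici]; linarith⟩
  have hIci : volume (C ∩ Ici ((a + b) / 2)) = volume (C ∩ Ioi ((a + b) / 2)) :=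
    measure_congr ((ae_eq_refl C).inter Ioi_ae_eq_Ici.symm)
  rw [← volume_preimage_two_mul_sub A b, ← volume_preimage_two_mul_sub B a, ← mul_add]
  gcongr
  calc _ ≤ volume (C ∩ Iic ((a + b) / 2)) + volume (C ∩ Ioi ((a + b) / 2)) :=
        add_le_add (measure_mono hA₁) ((measure_mono hB₁).trans hIci.le)
    _ = volume C := by
        rw [← measure_inter_add_sdiff C (measurableSet_Iic (a := (a + b) / 2)), sdiff_eq, compl_Iic]

/-- The Brunn–Minkowski inequality on the line. -/
lemma volume_add_le_of_midpoint_mem {A B C : Set ℝ} (hA : MeasurableSet A)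
    (hB : MeasurableSet B) (hA' : A.Nonempty) (hB' : B.Nonempty)
    (h : ∀ a ∈ A, ∀ b ∈ B, (a + b) / 2 ∈ C) : volume A + volume B ≤ 2 * volume C := by
  obtain ⟨a, ha⟩ := hA'
  obtain ⟨b, hb⟩ := hB'
  by_contra! hlt
  -- If one set is null, a half-size copy of the other already lies in `C`. Both measures must be
  -- nonzero for the splitting of the strict inequality below.
  have hA0 : volume A ≠ 0 := by
    intro h0
    rw [h0, zero_add, ← volume_preimage_two_mul_sub B a] at hlt
    refine hlt.not_ge ?_
    gcongr
    intro z hz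
    have h1 := h a ha _ hz
    simpa only [add_sub_cancel, mul_div_cancel_left₀ z (two_ne_zero' ℝ)] using h1
  have hB0 : volume B ≠ 0 := by
    intro h0
    rw [h0, add_zero, ← volume_preimage_two_mul_sub A b] at hlt
    refine hlt.not_ge ?_
    gcongr
    intro z hz
    have h1 := h _ hz b hb
    simpa only [sub_add_cancel, mul_div_cancel_left₀ z (two_ne_zero' ℝ)] using h1
  -- Inner regularity: the strict inequality persists for compact subsets of nearly full measure.
  obtain ⟨r, hr, s, hs, hrs⟩ := ENNReal.exists_lt_add_of_lt_add hlt hA0 hB0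
  obtain ⟨K, hKA, hK, hrK⟩ := hA.exists_lt_isCompact hr
  obtain ⟨L, hLB, hL, hsL⟩ := hB.exists_lt_isCompact hs
  have hK' : K.Nonempty := nonempty_of_measure_ne_zero (ne_bot_of_gt hrK)
  have hL' : L.Nonempty := nonempty_of_measure_ne_zero (ne_bot_of_gt hsL)
  have := volume_add_le_of_midpoint_mem_of_isCompact hK hL hK' hL'
    fun x hx y hy => h x (hKA hx) y (hLB hy)
  exact (hrs.trans (ENNReal.add_lt_add hrK hsL)).not_ge this

/-- Layer-cake formula together with Brunn–Minkowski on superlevel sets. Normalising both suprema to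
one makes the superlevel sets of `f` and `g` nonempty at exactly the same levels. -/
lemma lintegral_add_le_of_midpoint_of_sup_eq_one {f g h : ℝ → ℝ} (hf : Measurable f)
    (hg : Measurable g) (hh : Measurable h) (hf0 : ∀ x, 0 ≤ f x) (hg0 : ∀ x, 0 ≤ g x)
    (hh0 : ∀ x, 0 ≤ h x) (hf1 : ∀ x, f x ≤ 1) (hg1 : ∀ x, g x ≤ 1)
    (hfs : ∀ r < 1, ∃ x, r < f x) (hgs : ∀ r < 1, ∃ x, r < g x)
    (hfgh : ∀ a b, f a * g b ≤ h ((a + b) / 2) ^ 2) :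
    (∫⁻ x, ENNReal.ofReal (f x)) + ∫⁻ x, ENNReal.ofReal (g x) ≤
      2 * ∫⁻ x, ENNReal.ofReal (h x) := by
  have hm : ∀ u : ℝ → ℝ, Measurable fun t => volume {a | t < u a} := fun u =>
    Antitone.measurable fun s t hst => measure_mono fun a ha => lt_of_le_of_lt hst ha
  rw [lintegral_eq_lintegral_meas_lt volume (.of_forall hf0) hf.aemeasurable,
    lintegral_eq_lintegral_meas_lt volume (.of_forall hg0) hg.aemeasurable,
    lintegral_eq_lintegral_meas_lt volume (.of_forall hh0) hh.aemeasurable,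
    ← lintegral_add_left (hm f),
    ← lintegral_const_mul _ (hm h)]
  refine setLIntegral_mono' measurableSet_Ioi fun r hr => ?_
  rw [mem_Ioi] at hr
  rcases lt_or_ge r 1 with hr1 | hr1
  · refine volume_add_le_of_midpoint_mem (measurableSet_lt measurable_const hf)
      (measurableSet_lt measurable_const hg) (hfs r hr1) (hgs r hr1) fun a ha b hb => ?_
    rw [mem_ofPred_eq] at ha hb ⊢
    have h1 := hfgh a b
    have h2 : r * r < f a * g b := mul_lt_mul'' ha hb hr.le hr.le
    exact lt_of_pow_lt_pow_left₀ 2 (hh0 _) (by nlinarith)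
  · have h1 : {a | r < f a} = ∅ := by ext x; simpa using (hf1 x).trans hr1
    have h2 : {a | r < g a} = ∅ := by ext x; simpa using (hg1 x).trans hr1
    simp [h1, h2]

lemma ENNReal.mul_le_sq_of_add_le_two_mul {a b c : ℝ≥0∞} (h : a + b ≤ 2 * c) : a * b ≤ c ^ 2 := by
  rcases eq_or_ne c ∞ with rfl | hc
  · simp
  have hab : a + b ≠ ∞ := ne_top_of_le_ne_top (ENNReal.mul_ne_top (by simp) hc) h
  lift c to NNReal using hc
  lift a to NNReal using fun h => by simp [h] at hab
  lift b to NNReal using fun h => by simp [h] at hab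
  norm_cast at h ⊢
  rw [← NNReal.coe_le_coe] at h ⊢
  push_cast at h ⊢
  nlinarith [sq_nonneg ((a : ℝ) - b), a.2, b.2, c.2]

/-- Dividing `f`, `g`, `h` by `sup f`, `sup g` and the geometric mean of these suprema reduces to
the additive inequality, which the arithmetic–geometric mean inequality makes multiplicative. -/
lemma lintegral_mul_le_of_midpoint_of_bounded {f g h : ℝ → ℝ} (hf : Measurable f)
    (hg : Measurable g) (hh : Measurable h) (hf0 : ∀ x, 0 ≤ f x) (hg0 : ∀ x, 0 ≤ g x)
    (hh0 : ∀ x, 0 ≤ h x) {M : ℝ} (hfM : ∀ x, f x ≤ M) (hgM : ∀ x, g x ≤ M)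
    (hfgh : ∀ a b, f a * g b ≤ h ((a + b) / 2) ^ 2) :
    (∫⁻ x, ENNReal.ofReal (f x)) * ∫⁻ x, ENNReal.ofReal (g x) ≤
      (∫⁻ x, ENNReal.ofReal (h x)) ^ 2 := by
  have hfb : BddAbove (range f) := ⟨M, forall_mem_range.2 hfM⟩
  have hgb : BddAbove (range g) := ⟨M, forall_mem_range.2 hgM⟩
  set A := ⨆ x, f x with hA
  set B := ⨆ x, g x with hB
  have hfA : ∀ x, f x ≤ A := le_ciSup hfb
  have hgB : ∀ x, g x ≤ B := le_ciSup hgb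
  rcases le_or_gt A 0 with hA0 | hA0
  · have : ∀ x, ENNReal.ofReal (f x) = 0 := fun x => ENNReal.ofReal_of_nonpos ((hfA x).trans hA0)
    simp [this]
  rcases le_or_gt B 0 with hB0 | hB0
  · have : ∀ x, ENNReal.ofReal (g x) = 0 := fun x => ENNReal.ofReal_of_nonpos ((hgB x).trans hB0)
    simp [this]
  have hC0 : 0 < √(A * B) := Real.sqrt_pos.2 (by positivity)
  have hC2 : √(A * B) ^ 2 = A * B := Real.sq_sqrt (by positivity)
  have hscale : ∀ (u : ℝ → ℝ) (c : ℝ), 0 < c → Measurable u →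
      ∫⁻ x, ENNReal.ofReal (u x) = ENNReal.ofReal c * ∫⁻ x, ENNReal.ofReal (u x / c) := by
    intro u c hc hu
    rw [← lintegral_const_mul _ (by fun_prop)]
    congr with x
    rw [← ENNReal.ofReal_mul hc.le, mul_div_cancel₀ _ hc.ne']
  have key := lintegral_add_le_of_midpoint_of_sup_eq_one (hf.div_const A) (hg.div_const B)
    (hh.div_const √(A * B)) (fun x => div_nonneg (hf0 x) hA0.le)
    (fun x => div_nonneg (hg0 x) hB0.le) (fun x => div_nonneg (hh0 x) hC0.le)
    (fun x => (div_le_one hA0).2 (hfA x)) (fun x => (div_le_one hB0).2 (hgB x))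
    (fun r hr => by
      obtain ⟨x, hx⟩ := exists_lt_of_lt_ciSup (show r * A < ⨆ x, f x by rw [← hA]; nlinarith)
      exact ⟨x, (lt_div_iff₀ hA0).2 hx⟩)
    (fun r hr => by
      obtain ⟨x, hx⟩ := exists_lt_of_lt_ciSup (show r * B < ⨆ x, g x by rw [← hB]; nlinarith)
      exact ⟨x, (lt_div_iff₀ hB0).2 hx⟩)
    (fun a b => by
      rw [div_pow, hC2, div_mul_div_comm]
      gcongr
      exact hfgh a b)
  rw [hscale f A hA0 hf, hscale g B hB0 hg, hscale h _ hC0 hh, mul_mul_mul_comm, mul_pow,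
    ← ENNReal.ofReal_mul hA0.le, ← ENNReal.ofReal_pow hC0.le, hC2]
  gcongr
  exact ENNReal.mul_le_sq_of_add_le_two_mul key

lemma tendsto_lintegral_min_natCast {α : Type*} [MeasurableSpace α] {μ : Measure α}
    {f : α → ℝ≥0∞} (hf : Measurable f) :
    Filter.Tendsto (fun n : ℕ => ∫⁻ x, min (f x) n ∂μ) Filter.atTop (nhds (∫⁻ x, f x ∂μ)) := by
  refine lintegral_tendsto_of_tendsto_of_monotone (fun n => (hf.min measurable_const).aemeasurable)
    (.of_forall fun x m n hmn => min_le_min le_rfl (by exact_mod_cast hmn)) (.of_forall fun x => ?_)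
  have := (tendsto_const_nhds (x := f x)).min ENNReal.tendsto_nat_nhds_top
  simpa using this

/-- The midpoint case of the Prékopa–Leindler inequality on the line. -/
lemma lintegral_mul_le_of_midpoint_real {f g h : ℝ → ℝ≥0∞} (hf : Measurable f)
    (hg : Measurable g) (hh : Measurable h)
    (hfgh : ∀ a b, f a * g b ≤ h ((a + b) / 2) ^ 2) :
    (∫⁻ x, f x) * ∫⁻ x, g x ≤ (∫⁻ x, h x) ^ 2 := by
  rcases eq_or_ne (∫⁻ x, f x) 0 with h0 | hf0
  · simp [h0]
  rcases eq_or_ne (∫⁻ x, g x) 0 with h0 | hg0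
  · simp [h0]
  -- Truncating all three functions at the same level `n` preserves the midpoint hypothesis and
  -- gives bounded functions.
  refine le_of_tendsto' (ENNReal.Tendsto.mul (tendsto_lintegral_min_natCast hf) (.inl hf0)
    (tendsto_lintegral_min_natCast hg) (.inl hg0)) fun n => ?_
  have hfin : ∀ u : ℝ≥0∞, min u n ≠ ∞ := fun u =>
    ne_top_of_le_ne_top (ENNReal.natCast_ne_top n) (min_le_right _ _)
  have hle : ∀ u : ℝ≥0∞, (min u n).toReal ≤ n := fun u =>
    ENNReal.toReal_le_of_le_ofReal (by positivity) (by simp)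
  have hm : ∀ u : ℝ → ℝ≥0∞, Measurable u → Measurable fun x => (min (u x) n).toReal := fun u hu =>
    (hu.min measurable_const).ennreal_toReal
  have := lintegral_mul_le_of_midpoint_of_bounded (f := fun x => (min (f x) n).toReal)
    (g := fun x => (min (g x) n).toReal) (h := fun x => (min (h x) n).toReal) (hm f hf) (hm g hg)
    (hm h hh) (fun _ => ENNReal.toReal_nonneg) (fun _ => ENNReal.toReal_nonneg)
    (fun _ => ENNReal.toReal_nonneg) (M := n) (fun _ => hle _) (fun _ => hle _) (fun a b => by
      rw [← ENNReal.toReal_mul, ← ENNReal.toReal_pow]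
      refine ENNReal.toReal_mono (ENNReal.pow_ne_top (hfin _)) ?_
      rcases le_total (h ((a + b) / 2)) n with hn | hn
      · rw [min_eq_left hn]
        exact (mul_le_mul' (min_le_left _ _) (min_le_left _ _)).trans (hfgh a b)
      · rw [min_eq_right hn, sq]
        exact mul_le_mul' (min_le_right _ _) (min_le_right _ _))
  simp only [ENNReal.ofReal_toReal (hfin _)] at this
  refine this.trans ?_
  gcongr
  exact min_le_left _ _

/-- The midpoint case of the Prékopa–Leindler inequality. -/
lemma lintegral_mul_le_of_midpoint_pi (n : ℕ) {f g h : (Fin n → ℝ) → ℝ≥0∞} (hf : Measurable f)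
    (hg : Measurable g) (hh : Measurable h)
    (hfgh : ∀ a b, f a * g b ≤ h ((2 : ℝ)⁻¹ • (a + b)) ^ 2) :
    (∫⁻ x, f x) * ∫⁻ x, g x ≤ (∫⁻ x, h x) ^ 2 := by
  induction n with
  | zero =>
    have hdef : ∀ u : (Fin 0 → ℝ) → ℝ≥0∞, ∫⁻ x, u x = u default := fun u => by
      rw [lintegral_unique, volume_pi, Measure.pi_univ]; simp; congr!
    rw [hdef, hdef, hdef]
    convert hfgh default default
  | succ n ih =>
    have e := (volume_preserving_piFinSuccAbove (fun _ : Fin (n + 1) => ℝ) 0).symm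
    set e' := (MeasurableEquiv.piFinSuccAbove (fun _ : Fin (n + 1) => ℝ) 0).symm with he'
    have hint : ∀ u : (Fin (n + 1) → ℝ) → ℝ≥0∞, Measurable u →
        ∫⁻ x, u x = ∫⁻ s : ℝ, ∫⁻ y : Fin n → ℝ, u (e' (s, y)) := fun u hu => by
      rw [← e.lintegral_comp hu, Measure.volume_eq_prod,
        lintegral_prod (fun p => u (e' p)) (hu.comp e'.measurable).aemeasurable]
    have hms : ∀ u : (Fin (n + 1) → ℝ) → ℝ≥0∞, Measurable u →
        Measurable fun s : ℝ => ∫⁻ y : Fin n → ℝ, u (e' (s, y)) := fun u hu =>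
      (hu.comp e'.measurable).lintegral_prod_right'
    have hmy : ∀ u : (Fin (n + 1) → ℝ) → ℝ≥0∞, Measurable u → ∀ s : ℝ,
        Measurable fun y : Fin n → ℝ => u (e' (s, y)) := fun u hu s =>
      (hu.comp e'.measurable).comp measurable_prodMk_left
    rw [hint f hf, hint g hg, hint h hh]
    -- The inequality in dimension `n`, applied to slices over `s`, `t` and their midpoint, is the
    -- hypothesis of the one-dimensional inequality for the slice integrals.
    refine lintegral_mul_le_of_midpoint_real (hms f hf) (hms g hg) (hms h hh) fun s t => ?_
    refine ih (hmy f hf s) (hmy g hg t) (hmy h hh _) fun a b => ?_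
    convert hfgh (e' (s, a)) (e' (t, b)) using 3
    ext i
    refine Fin.cases ?_ (fun j => ?_) i
    · simp [he', MeasurableEquiv.piFinSuccAbove, Fin.insertNthEquiv]; ring
    · simp [he', MeasurableEquiv.piFinSuccAbove, Fin.insertNthEquiv, mul_add]

/-- The midpoint case of the Prékopa–Leindler inequality on Euclidean space. -/
lemma lintegral_mul_le_of_midpoint {d : ℕ} {f g h : EuclideanSpace ℝ (Fin d) → ℝ≥0∞}
    (hf : Measurable f) (hg : Measurable g) (hh : Measurable h)
    (hfgh : ∀ a b, f a * g b ≤ h ((2 : ℝ)⁻¹ • (a + b)) ^ 2) :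
    (∫⁻ x, f x) * ∫⁻ x, g x ≤ (∫⁻ x, h x) ^ 2 := by
  have e := PiLp.volume_preserving_toLp (Fin d)
  rw [← e.lintegral_comp hf, ← e.lintegral_comp hg, ← e.lintegral_comp hh]
  exact lintegral_mul_le_of_midpoint_pi d (hf.comp e.measurable) (hg.comp e.measurable)
    (hh.comp e.measurable) fun a b => hfgh _ _

end PrekopaLeindler

/-! ### Log-concave densities: convexity, linear growth of the potential, moments -/

section Potential

variable {d : ℕ} {V : EuclideanSpace ℝ (Fin d) → ℝ} {κ : ℝ}

lemma hasDerivAt_line {E : Type*} [NormedAddCommGroup E] [NormedSpace ℝ E] (x h : E) (t : ℝ) :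
    HasDerivAt (fun t : ℝ => x + t • h) h t := by
  simpa using ((hasDerivAt_id t).smul_const h).const_add x

lemma ContDiff.differentiable_gradient (hV : ContDiff ℝ 2 V) : Differentiable ℝ (gradient V) := by
  have h1 : ContDiff ℝ 1 (fderiv ℝ V) := hV.fderiv_right (by norm_num)
  have h2 : Differentiable ℝ (InnerProductSpace.toDual ℝ (EuclideanSpace ℝ (Fin d))).symm :=
    IsBoundedLinearMap.differentiable ⟨⟨map_add _, fun c x => by simp⟩, 1, one_pos, fun x => by simp⟩
  exact h2.comp (h1.differentiable one_ne_zero)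

/-- A `κ`-log-concave potential minus `κ / 2 * ‖x‖ ^ 2` is convex. -/
lemma IsLogConcavePotential.convexOn_sub_sq (hV : IsLogConcavePotential κ V) :
    ConvexOn ℝ univ (fun x => V x - κ / 2 * ‖x‖ ^ 2) := by
  -- Convexity is tested on lines, where the second derivative is `⟨(∇²V - κ) h, h⟩ ≥ 0`.
  have hline : ∀ x h, ConvexOn ℝ univ (fun t : ℝ => V (x + t • h) - κ / 2 * ‖x + t • h‖ ^ 2) := by
    intro x h
    have hd1 : ∀ t, HasDerivAt (fun t : ℝ => V (x + t • h) - κ / 2 * ‖x + t • h‖ ^ 2)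
        (inner ℝ (gradient V (x + t • h)) h - κ * inner ℝ (x + t • h) h) t := fun t => by
      have h1 : HasGradientAt V (gradient V (x + t • h)) (x + t • h) :=
        (hV.1.differentiable two_ne_zero _).hasGradientAt
      have h2 := h1.hasFDerivAt.comp_hasDerivAt t (hasDerivAt_line x h t)
      have h3 := ((hasDerivAt_line x h t).norm_sq).const_mul (κ / 2)
      refine (h2.sub h3).congr_deriv ?_
      simp only [InnerProductSpace.toDual_apply_apply]
      ring
    have hd2 : ∀ t, HasDerivAt
        (fun t : ℝ => inner ℝ (gradient V (x + t • h)) h - κ * inner ℝ (x + t • h) h)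
        (inner ℝ (hessian V (x + t • h) h) h - κ * inner ℝ h h) t := fun t => by
      have h1 := (hV.1.differentiable_gradient (x + t • h)).hasFDerivAt.comp_hasDerivAt t
        (hasDerivAt_line x h t)
      have h2 := h1.inner ℝ (hasDerivAt_const t h)
      have h3 := (((hasDerivAt_line x h t).inner ℝ (hasDerivAt_const t h))).const_mul κ
      simpa using! h2.sub h3
    have e1 := funext fun t => (hd1 t).deriv
    refine convexOn_univ_of_deriv2_nonneg (fun t => (hd1 t).differentiableAt) ?_ fun t => ?_
    · rw [e1]; exact fun t => (hd2 t).differentiableAt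
    · rw [Function.iterate_succ, Function.iterate_one, Function.comp, e1, (hd2 t).deriv]
      have := (ContinuousLinearMap.le_def _ _).1 (hV.2 (x + t • h))
      have h3 := this.inner_nonneg_left h
      simpa [inner_sub_left, inner_smul_left] using h3
  refine ⟨convex_univ, fun x _ y _ a b ha hb hab => ?_⟩
  have h1 := (hline x (y - x)).2 (mem_univ 0) (mem_univ 1) ha hb hab
  have h2 : x + (a • (0 : ℝ) + b • (1 : ℝ)) • (y - x) = a • x + b • y := by
    have : a = 1 - b := by linarith
    subst this
    simp only [smul_eq_mul, mul_zero, mul_one, zero_add]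
    module
  simp only [h2] at h1
  simpa using h1

lemma IsLogConcavePotential.convexOn (hκ : 0 ≤ κ) (hV : IsLogConcavePotential κ V) :
    ConvexOn ℝ univ V := by
  have h1 : ConvexOn ℝ univ (fun x : EuclideanSpace ℝ (Fin d) => κ / 2 * ‖x‖ ^ 2) :=
    ((convexOn_univ_norm).pow (fun _ _ => norm_nonneg _) 2).smul (by positivity)
  have := hV.convexOn_sub_sq.add h1
  have e : V = (fun x => V x - κ / 2 * ‖x‖ ^ 2) + fun x => κ / 2 * ‖x‖ ^ 2 :=
    funext fun x => (sub_add_cancel (V x) _).symm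
  rw [e]
  exact this

/-- A convex function with integrable `e^{-V}` grows at least linearly. -/
lemma ConvexOn.exists_linear_lower_bound (hc : ConvexOn ℝ univ V) (hcont : Continuous V)
    (hfin : IsFiniteMeasure (gibbsMeasure V)) :
    ∃ a b : ℝ, 0 < a ∧ ∀ x, a * ‖x‖ - b ≤ V x := by
  obtain ⟨M, hM⟩ := (isCompact_closedBall (0 : EuclideanSpace ℝ (Fin d)) 1).exists_bound_of_continuousOn
    hcont.continuousOn
  -- A point `y` within `1 / 2` of `x / 2` is the midpoint of `x` and a point of the unit ball, so
  -- `V y ≤ (V x + M) / 2`. A small value of `V` at `x` therefore forces a definite mass near `x /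
  -- 2`.
  have hball : ∀ x, ENNReal.ofReal (Real.exp (-((V x + M) / 2))) *
      volume (Metric.ball (0 : EuclideanSpace ℝ (Fin d)) (1 / 2)) ≤
      gibbsMeasure V (Metric.ball ((1 / 2 : ℝ) • x) (1 / 2)) := by
    intro x
    rw [gibbsMeasure, withDensity_apply _ Metric.isOpen_ball.measurableSet,
      ← Measure.addHaar_ball_center volume ((1 / 2 : ℝ) • x), ← setLIntegral_const]
    refine setLIntegral_mono' Metric.isOpen_ball.measurableSet fun y hy => ?_
    refine ENNReal.ofReal_le_ofReal (Real.exp_le_exp.2 (neg_le_neg ?_))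
    have hz : (2 : ℝ) • y - x ∈ Metric.closedBall (0 : EuclideanSpace ℝ (Fin d)) 1 := by
      rw [Metric.mem_ball, dist_eq_norm] at hy
      rw [mem_closedBall_zero_iff,
        show (2 : ℝ) • y - x = (2 : ℝ) • (y - (1 / 2 : ℝ) • x) by module, norm_smul]
      norm_num
      norm_num at hy
      linarith
    have h1 := hc.2 (mem_univ x) (mem_univ ((2 : ℝ) • y - x))
      (show (0 : ℝ) ≤ 1 / 2 by norm_num) (show (0 : ℝ) ≤ 1 / 2 by norm_num) (by norm_num)
    rw [show (1 / 2 : ℝ) • x + (1 / 2 : ℝ) • ((2 : ℝ) • y - x) = y by module] at h1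
    have h2 := (le_abs_self _).trans (hM _ hz)
    simp only [smul_eq_mul] at h1
    linarith
  set ε := ENNReal.ofReal (Real.exp (-((V 0 + 1 + M) / 2))) *
      volume (Metric.ball (0 : EuclideanSpace ℝ (Fin d)) (1 / 2)) with hε
  have hvol0 : volume (Metric.ball (0 : EuclideanSpace ℝ (Fin d)) (1 / 2)) ≠ 0 :=
    (Metric.measure_ball_pos _ _ (by norm_num)).ne'
  have hvolt : volume (Metric.ball (0 : EuclideanSpace ℝ (Fin d)) (1 / 2)) ≠ ⊤ :=
    measure_ball_lt_top.ne
  have hε0 : ε ≠ 0 := mul_ne_zero (by simpa using Real.exp_pos _) hvol0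
  obtain ⟨K, -, hK, hKε⟩ := MeasurableSet.univ.exists_isCompact_sdiff_lt (μ := gibbsMeasure V)
    (measure_ne_top _ _) hε0
  obtain ⟨R₀, hR₀⟩ := hK.isBounded.subset_closedBall (0 : EuclideanSpace ℝ (Fin d))
  -- For `‖x‖ ≥ R` the ball of radius `1 / 2` around `x / 2` misses the ball of radius `R₀`
  -- containing `K`.
  set R := 2 * |R₀| + 2 with hRdef
  have hR : 0 < R := by positivity
  -- Otherwise a ball outside `K` would have mass at least `ε`, against tightness.
  have hfar : ∀ x, R ≤ ‖x‖ → V 0 + 1 ≤ V x := by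
    intro x hx
    by_contra! hlt
    have h1 : ε ≤ gibbsMeasure V (Metric.ball ((1 / 2 : ℝ) • x) (1 / 2)) := by
      refine le_trans ?_ (hball x)
      rw [hε]
      gcongr
    refine (h1.trans (measure_mono fun y hy => ?_)).not_gt hKε
    refine ⟨mem_univ y, fun hyK => ?_⟩
    have h2 := hR₀ hyK
    rw [mem_closedBall_zero_iff] at h2
    rw [Metric.mem_ball, dist_eq_norm] at hy
    have h3 : ‖(1 / 2 : ℝ) • x‖ = ‖x‖ / 2 := by rw [norm_smul]; norm_num; ring
    have h4 := norm_sub_norm_le ((1 / 2 : ℝ) • x) y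
    rw [norm_sub_rev, h3] at h4
    have := le_abs_self R₀
    linarith
  obtain ⟨m, hm⟩ := (isCompact_closedBall (0 : EuclideanSpace ℝ (Fin d)) R).exists_bound_of_continuousOn
    hcont.continuousOn
  refine ⟨1 / R, 1 + |V 0| + |m|, by positivity, fun x => ?_⟩
  rcases le_or_gt ‖x‖ R with hx | hx
  · have h1 := neg_le_of_abs_le (hm x (by simpa using hx))
    have h2 : 1 / R * ‖x‖ ≤ 1 := by rw [one_div_mul_eq_div]; exact (div_le_one hR).2 hx
    have := le_abs_self m
    have := abs_nonneg (V 0)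
    linarith
  · have hx0 : 0 < ‖x‖ := hR.trans hx
    have hl1 : R / ‖x‖ ≤ 1 := (div_le_one hx0).2 hx.le
    have hl0 : 0 < R / ‖x‖ := by positivity
    -- On the ray from the origin, `V` has increased by at least one at radius `R`; by convexity its
    -- slope beyond is at least `1 / R`.
    have h1 := hc.2 (mem_univ x) (mem_univ (0 : EuclideanSpace ℝ (Fin d))) hl0.le
      (sub_nonneg.2 hl1) (by ring)
    rw [smul_zero, add_zero] at h1
    have h2 := hfar ((R / ‖x‖) • x) (by
      rw [norm_smul, Real.norm_of_nonneg hl0.le, div_mul_cancel₀ _ hx0.ne'])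
    simp only [smul_eq_mul] at h1
    have h3 : 1 ≤ R / ‖x‖ * (V x - V 0) := by linarith
    have h4 : 1 / R * ‖x‖ ≤ V x - V 0 := by
      rw [one_div_mul_eq_div, div_le_iff₀ hR]
      rw [div_mul_eq_mul_div, le_div_iff₀ hx0] at h3
      linarith
    have := neg_abs_le (V 0)
    have := abs_nonneg m
    linarith

/-- A positive function all of whose moments are integrable. -/
structure HasMoments (ρ : EuclideanSpace ℝ (Fin d) → ℝ) : Prop where
  continuous : Continuous ρ
  pos : ∀ y, 0 < ρ y
  integrable : ∀ n : ℕ, Integrable (fun y => (1 + ‖y‖) ^ n * ρ y)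

lemma exists_pow_mul_exp_neg_le {a b : ℝ} (ha : 0 < a) (hV : ∀ x, a * ‖x‖ - b ≤ V x) (k : ℕ) :
    ∃ C : ℝ, ∀ y, (1 + ‖y‖) ^ k * Real.exp (-V y) ≤ C := by
  refine ⟨k.factorial / a ^ k * Real.exp (a + b), fun y => ?_⟩
  have h1 := Real.pow_div_factorial_le_exp (a * (1 + ‖y‖)) (by positivity) k
  have h2 : (1 + ‖y‖) ^ k ≤ k.factorial / a ^ k * Real.exp (a * (1 + ‖y‖)) := by
    rw [div_le_iff₀ (by positivity), mul_pow] at h1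
    rw [div_mul_eq_mul_div, le_div_iff₀ (by positivity)]
    linarith
  calc _ ≤ k.factorial / a ^ k * Real.exp (a * (1 + ‖y‖)) * Real.exp (-V y) := by gcongr
    _ = k.factorial / a ^ k * Real.exp (a * (1 + ‖y‖) + -V y) := by rw [mul_assoc, ← Real.exp_add]
    _ ≤ _ := mul_le_mul_of_nonneg_left (Real.exp_le_exp.2 (by linarith [hV y])) (by positivity)

lemma hasMoments_exp_neg {a b : ℝ} (ha : 0 < a) (hV : ∀ x, a * ‖x‖ - b ≤ V x)
    (hcont : Continuous V) : HasMoments (fun y => Real.exp (-V y)) where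
  continuous := by fun_prop
  pos y := Real.exp_pos _
  integrable n := by
    -- The `d + 1` spare powers leave the integrable weight `(1 + ‖y‖) ^ (-(d + 1))`.
    obtain ⟨C, hC⟩ := exists_pow_mul_exp_neg_le ha hV (n + (d + 1))
    have hint : Integrable (fun y : EuclideanSpace ℝ (Fin d) => (1 + ‖y‖) ^ (-((d + 1 : ℕ) : ℝ))) :=
      integrable_one_add_norm (by simp)
    refine (hint.const_mul C).mono' (Continuous.aestronglyMeasurable (by fun_prop))
      (.of_forall fun y => ?_)
    have hpos : 0 < 1 + ‖y‖ := by positivity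
    rw [Real.norm_of_nonneg (by positivity), Real.rpow_neg hpos.le, Real.rpow_natCast,
      ← div_eq_mul_inv, le_div_iff₀ (by positivity)]
    calc _ = (1 + ‖y‖) ^ (n + (d + 1)) * Real.exp (-V y) := by ring
      _ ≤ C := hC y

end Potential

/-! ### Posterior expectations and their differentiation under the integral -/

section Posterior

variable {d : ℕ} {F G : Type*} [NormedAddCommGroup F] [NormedSpace ℝ F]
  [NormedAddCommGroup G] [NormedSpace ℝ G]

/-- Continuous functions of at most polynomial growth. -/
structure PolyGrowth (Q : EuclideanSpace ℝ (Fin d) → F) : Prop where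
  continuous : Continuous Q
  bound : ∃ (C : ℝ) (n : ℕ), ∀ y, ‖Q y‖ ≤ C * (1 + ‖y‖) ^ n

namespace PolyGrowth

variable {Q : EuclideanSpace ℝ (Fin d) → F} {R : EuclideanSpace ℝ (Fin d) → G}

lemma const (c : F) : PolyGrowth (fun _ : EuclideanSpace ℝ (Fin d) => c) :=
  ⟨continuous_const, ‖c‖, 0, fun y => by simp⟩

lemma id : PolyGrowth (fun y : EuclideanSpace ℝ (Fin d) => y) :=
  ⟨continuous_id, 1, 1, fun y => by simp⟩

lemma of_le (hQ : PolyGrowth Q) {R : EuclideanSpace ℝ (Fin d) → G} (hR : Continuous R)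
    {c : ℝ} (h : ∀ y, ‖R y‖ ≤ c * ‖Q y‖) (hc : 0 ≤ c) : PolyGrowth R := by
  obtain ⟨C, n, hC⟩ := hQ.bound
  exact ⟨hR, c * C, n, fun y => (h y).trans (by rw [mul_assoc]; gcongr; exact hC y)⟩

lemma bilin {H : Type*} [NormedAddCommGroup H] [NormedSpace ℝ H] (B : F →L[ℝ] G →L[ℝ] H)
    (hQ : PolyGrowth Q) (hR : PolyGrowth R) : PolyGrowth (fun y => B (Q y) (R y)) := by
  obtain ⟨C, n, hC⟩ := hQ.bound
  obtain ⟨C', m, hC'⟩ := hR.bound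
  have hC0 : 0 ≤ C := by simpa using (norm_nonneg _).trans (hC 0)
  refine ⟨by have := hQ.continuous; have := hR.continuous; fun_prop, ‖B‖ * (C * C'), n + m,
    fun y => (B.le_opNorm₂ _ _).trans ?_⟩
  calc ‖B‖ * ‖Q y‖ * ‖R y‖ ≤ ‖B‖ * (C * (1 + ‖y‖) ^ n) * (C' * (1 + ‖y‖) ^ m) := by
        gcongr
        · exact hC y
        · exact hC' y
    _ = _ := by ring

lemma smul {q : EuclideanSpace ℝ (Fin d) → ℝ} (hq : PolyGrowth q) (hQ : PolyGrowth Q) :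
    PolyGrowth (fun y => q y • Q y) :=
  bilin (ContinuousLinearMap.lsmul ℝ ℝ) hq hQ

lemma inner {H : Type*} [NormedAddCommGroup H] [InnerProductSpace ℝ H]
    {Q R : EuclideanSpace ℝ (Fin d) → H} (hQ : PolyGrowth Q) (hR : PolyGrowth R) :
    PolyGrowth (fun y => inner ℝ (Q y) (R y)) :=
  bilin (innerSL ℝ : H →L[ℝ] H →L[ℝ] ℝ) hQ hR

lemma add {R : EuclideanSpace ℝ (Fin d) → F} (hQ : PolyGrowth Q) (hR : PolyGrowth R) :
    PolyGrowth (fun y => Q y + R y) := by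
  obtain ⟨C, n, hC⟩ := hQ.bound
  obtain ⟨C', m, hC'⟩ := hR.bound
  have hC0 : 0 ≤ C := by simpa using (norm_nonneg _).trans (hC 0)
  have hC0' : 0 ≤ C' := by simpa using (norm_nonneg _).trans (hC' 0)
  refine ⟨hQ.continuous.add hR.continuous, C + C', max n m, fun y => (norm_add_le _ _).trans ?_⟩
  have hy : 1 ≤ 1 + ‖y‖ := by simp
  have h2 := pow_le_pow_right₀ hy (le_max_left n m)
  have h3 := pow_le_pow_right₀ hy (le_max_right n m)
  calc _ ≤ C * (1 + ‖y‖) ^ n + C' * (1 + ‖y‖) ^ m := add_le_add (hC y) (hC' y)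
    _ ≤ C * (1 + ‖y‖) ^ max n m + C' * (1 + ‖y‖) ^ max n m := by gcongr
    _ = _ := by ring

lemma integrable {ρ : EuclideanSpace ℝ (Fin d) → ℝ} (hρ : HasMoments ρ) (hQ : PolyGrowth Q) :
    Integrable (fun y => ρ y * ‖Q y‖) := by
  obtain ⟨C, n, hC⟩ := hQ.bound
  refine ((hρ.integrable n).const_mul C).mono'
    ((hρ.continuous.mul hQ.continuous.norm).aestronglyMeasurable) (.of_forall fun y => ?_)
  rw [Real.norm_of_nonneg (mul_nonneg (hρ.pos y).le (norm_nonneg _))]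
  have := mul_le_mul_of_nonneg_left (hC y) (hρ.pos y).le
  linarith

end PolyGrowth

/-- The unnormalised density of `X₁` given `X₀ + σ X₁ = x`, where `p = (σ, x)` and `X₁` has
density `ρ`. -/
noncomputable def posteriorWeight (ρ : EuclideanSpace ℝ (Fin d) → ℝ)
    (p : ℝ × EuclideanSpace ℝ (Fin d)) (y : EuclideanSpace ℝ (Fin d)) : ℝ :=
  Real.exp (-(‖p.2 - p.1 • y‖ ^ 2 / 2)) * ρ y

/-- The integral of `Q` against `posteriorWeight`. -/
noncomputable def posteriorIntegral (ρ : EuclideanSpace ℝ (Fin d) → ℝ)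
    (Q : EuclideanSpace ℝ (Fin d) → F) (p : ℝ × EuclideanSpace ℝ (Fin d)) : F :=
  ∫ y, posteriorWeight ρ p y • Q y

/-- The logarithmic derivative of `posteriorWeight` in `p`. -/
noncomputable def posteriorLogDeriv (p : ℝ × EuclideanSpace ℝ (Fin d))
    (y : EuclideanSpace ℝ (Fin d)) : ℝ × EuclideanSpace ℝ (Fin d) →L[ℝ] ℝ :=
  (innerSL ℝ (p.2 - p.1 • y)).comp
    ((ContinuousLinearMap.fst ℝ ℝ (EuclideanSpace ℝ (Fin d))).smulRight y -
      ContinuousLinearMap.snd ℝ ℝ (EuclideanSpace ℝ (Fin d)))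

lemma posteriorLogDeriv_apply (p : ℝ × EuclideanSpace ℝ (Fin d)) (y : EuclideanSpace ℝ (Fin d))
    (v : ℝ × EuclideanSpace ℝ (Fin d)) :
    posteriorLogDeriv p y v = inner ℝ (p.2 - p.1 • y) (v.1 • y - v.2) := rfl

lemma norm_posteriorLogDeriv_le (p : ℝ × EuclideanSpace ℝ (Fin d))
    (y : EuclideanSpace ℝ (Fin d)) : ‖posteriorLogDeriv p y‖ ≤ ‖p‖ * (1 + ‖y‖) ^ 2 := by
  refine ContinuousLinearMap.opNorm_le_bound _ (by positivity) fun v => ?_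
  rw [posteriorLogDeriv_apply]
  refine (norm_inner_le_norm _ _).trans ?_
  have h1 : ∀ q : ℝ × EuclideanSpace ℝ (Fin d), ‖q.2‖ + ‖q.1‖ * ‖y‖ ≤ ‖q‖ * (1 + ‖y‖) := fun q => by
    have h2 := norm_fst_le q
    have h3 := norm_snd_le q
    nlinarith [norm_nonneg y]
  have h2 : ‖p.2 - p.1 • y‖ ≤ ‖p‖ * (1 + ‖y‖) :=
    (norm_sub_le _ _).trans (by rw [norm_smul]; exact h1 p)
  have h3 : ‖v.1 • y - v.2‖ ≤ ‖v‖ * (1 + ‖y‖) := by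
    rw [norm_sub_rev]; exact (norm_sub_le _ _).trans (by rw [norm_smul]; exact h1 v)
  calc _ ≤ (‖p‖ * (1 + ‖y‖)) * (‖v‖ * (1 + ‖y‖)) := by gcongr
    _ = _ := by ring

lemma continuous_posteriorLogDeriv : Continuous
    (fun q : (ℝ × EuclideanSpace ℝ (Fin d)) × EuclideanSpace ℝ (Fin d) =>
      posteriorLogDeriv q.1 q.2) := by
  unfold posteriorLogDeriv
  have h1 : Continuous fun q : (ℝ × EuclideanSpace ℝ (Fin d)) × EuclideanSpace ℝ (Fin d) =>
      innerSL ℝ (q.1.2 - q.1.1 • q.2) :=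
    (innerSL ℝ (E := EuclideanSpace ℝ (Fin d))).continuous.comp (by fun_prop)
  have h2 : Continuous fun q : (ℝ × EuclideanSpace ℝ (Fin d)) × EuclideanSpace ℝ (Fin d) =>
      (ContinuousLinearMap.fst ℝ ℝ (EuclideanSpace ℝ (Fin d))).smulRight q.2 :=
    ((ContinuousLinearMap.smulRightL ℝ (ℝ × EuclideanSpace ℝ (Fin d)) (EuclideanSpace ℝ (Fin d))
      (ContinuousLinearMap.fst ℝ ℝ (EuclideanSpace ℝ (Fin d))))).continuous.comp continuous_snd
  exact h1.clm_comp (h2.sub continuous_const)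

variable {ρ : EuclideanSpace ℝ (Fin d) → ℝ} {Q : EuclideanSpace ℝ (Fin d) → F}

lemma posteriorWeight_pos (hρ : HasMoments ρ) (p : ℝ × EuclideanSpace ℝ (Fin d))
    (y : EuclideanSpace ℝ (Fin d)) : 0 < posteriorWeight ρ p y :=
  mul_pos (Real.exp_pos _) (hρ.pos y)

lemma posteriorWeight_le (hρ : HasMoments ρ) (p : ℝ × EuclideanSpace ℝ (Fin d))
    (y : EuclideanSpace ℝ (Fin d)) : posteriorWeight ρ p y ≤ ρ y :=
  mul_le_of_le_one_left (hρ.pos y).le (Real.exp_le_one_iff.2 (neg_nonpos.2 (by positivity)))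

lemma continuous_posteriorWeight (hρ : HasMoments ρ) : Continuous
    (fun q : (ℝ × EuclideanSpace ℝ (Fin d)) × EuclideanSpace ℝ (Fin d) =>
      posteriorWeight ρ q.1 q.2) := by
  have := hρ.continuous
  unfold posteriorWeight
  fun_prop

lemma hasFDerivAt_posteriorWeight (p : ℝ × EuclideanSpace ℝ (Fin d))
    (y : EuclideanSpace ℝ (Fin d)) :
    HasFDerivAt (fun p => posteriorWeight ρ p y)
      (posteriorWeight ρ p y • posteriorLogDeriv p y) p := by
  have h1 : HasFDerivAt (fun p : ℝ × EuclideanSpace ℝ (Fin d) => p.2 - p.1 • y)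
      (ContinuousLinearMap.snd ℝ ℝ (EuclideanSpace ℝ (Fin d)) -
        (ContinuousLinearMap.fst ℝ ℝ (EuclideanSpace ℝ (Fin d))).smulRight y) p :=
    hasFDerivAt_snd.sub (hasFDerivAt_fst.smul_const y)
  have h2 := ((((h1.norm_sq).mul_const (2 : ℝ)⁻¹).neg).exp).mul_const (ρ y)
  unfold posteriorWeight
  simp only [div_eq_mul_inv]
  refine h2.congr_fderiv ?_
  ext v
  · simp [posteriorLogDeriv]
    ring
  · simp [posteriorLogDeriv]
    ring

lemma integrable_posteriorWeight_smul (hρ : HasMoments ρ) (hQ : PolyGrowth Q)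
    (p : ℝ × EuclideanSpace ℝ (Fin d)) : Integrable (fun y => posteriorWeight ρ p y • Q y) := by
  refine (hQ.integrable hρ).mono' (Continuous.aestronglyMeasurable ?_) (.of_forall fun y => ?_)
  · exact ((continuous_posteriorWeight hρ).comp (f := fun y => (p, y)) (by fun_prop)).smul
      hQ.continuous
  · rw [norm_smul, Real.norm_of_nonneg (posteriorWeight_pos hρ p y).le]
    gcongr
    exact posteriorWeight_le hρ p y

/-- Since the Gaussian factor is at most one, on a unit ball around `p` the derivative of the
integrand is dominated by `ρ` times a function of polynomial growth. The same bound gives both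
differentiability and continuity, with no restriction on `σ`. -/
lemma hasFDerivAt_posteriorIntegral (hρ : HasMoments ρ) (hQ : PolyGrowth Q)
    (p : ℝ × EuclideanSpace ℝ (Fin d)) :
    HasFDerivAt (posteriorIntegral ρ Q)
      (∫ y, posteriorWeight ρ p y • (posteriorLogDeriv p y).smulRight (Q y)) p ∧
    ContinuousAt (fun p => ∫ y, posteriorWeight ρ p y • (posteriorLogDeriv p y).smulRight (Q y))
      p := by
  have hwc := continuous_posteriorWeight hρ
  have hLc := continuous_posteriorLogDeriv (d := d)
  have hcont : Continuous (fun q : (ℝ × EuclideanSpace ℝ (Fin d)) × EuclideanSpace ℝ (Fin d) =>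
      posteriorWeight ρ q.1 q.2 • (posteriorLogDeriv q.1 q.2).smulRight (Q q.2)) :=
    hwc.smul (((ContinuousLinearMap.smulRightL ℝ (ℝ × EuclideanSpace ℝ (Fin d)) F).continuous.comp
      hLc).clm_apply (hQ.continuous.comp continuous_snd))
  have hmeas : ∀ p : ℝ × EuclideanSpace ℝ (Fin d), AEStronglyMeasurable
      (fun y => posteriorWeight ρ p y • (posteriorLogDeriv p y).smulRight (Q y)) volume := fun p =>
    (hcont.comp (f := fun y => (p, y)) (by fun_prop)).aestronglyMeasurable
  have hint : Integrable (fun y => (‖p‖ + 1) * (ρ y * ‖(1 + ‖y‖) ^ 2 • Q y‖)) := by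
    refine (PolyGrowth.integrable hρ ?_).const_mul _
    exact PolyGrowth.smul ⟨by fun_prop, 1, 2, fun y => by simp⟩ hQ
  have hbound : ∀ y, ∀ q ∈ Metric.ball p 1,
      ‖posteriorWeight ρ q y • (posteriorLogDeriv q y).smulRight (Q y)‖ ≤
        (‖p‖ + 1) * (ρ y * ‖(1 + ‖y‖) ^ 2 • Q y‖) := by
    intro y q hq
    have hq' : ‖q‖ ≤ ‖p‖ + 1 := by
      rw [Metric.mem_ball, dist_eq_norm] at hq
      linarith [norm_sub_norm_le q p]
    have hρy := (hρ.pos y).le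
    rw [norm_smul, Real.norm_of_nonneg (posteriorWeight_pos hρ q y).le,
      ContinuousLinearMap.norm_smulRight_apply, norm_smul, Real.norm_of_nonneg (by positivity)]
    calc _ ≤ ρ y * (((‖p‖ + 1) * (1 + ‖y‖) ^ 2) * ‖Q y‖) := by
          gcongr
          · exact posteriorWeight_le hρ q y
          · exact (norm_posteriorLogDeriv_le q y).trans (by gcongr)
      _ = _ := by ring
  refine ⟨?_, ?_⟩
  · refine hasFDerivAt_integral_of_dominated_of_fderiv_le (Metric.ball_mem_nhds p one_pos)
      (.of_forall fun q => (integrable_posteriorWeight_smul hρ hQ q).aestronglyMeasurable)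
      (integrable_posteriorWeight_smul hρ hQ p) (hmeas p) (.of_forall hbound) hint
      (.of_forall fun y q _ => ?_)
    refine ((hasFDerivAt_posteriorWeight q y).smul_const (Q y)).congr_fderiv ?_
    ext v <;> simp [smul_smul]
  · refine continuousAt_of_dominated (.of_forall hmeas) ?_ hint (.of_forall fun y => ?_)
    · filter_upwards [Metric.ball_mem_nhds p one_pos] with q hq
      exact .of_forall fun y => hbound y q hq
    · exact (hcont.comp (f := fun p => (p, y)) (by fun_prop)).continuousAt

lemma contDiff_posteriorIntegral (hρ : HasMoments ρ) (hQ : PolyGrowth Q) :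
    ContDiff ℝ 1 (posteriorIntegral ρ Q) := by
  rw [contDiff_one_iff_fderiv]
  refine ⟨fun p => (hasFDerivAt_posteriorIntegral hρ hQ p).1.differentiableAt, ?_⟩
  rw [funext fun p => (hasFDerivAt_posteriorIntegral hρ hQ p).1.fderiv]
  exact continuous_iff_continuousAt.2 fun p => (hasFDerivAt_posteriorIntegral hρ hQ p).2

lemma polyGrowth_posteriorLogDeriv (p v : ℝ × EuclideanSpace ℝ (Fin d)) :
    PolyGrowth (fun y => posteriorLogDeriv p y v) := by
  refine ⟨((continuous_posteriorLogDeriv (d := d)).comp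
    (f := fun y => (p, y)) (by fun_prop)).clm_apply continuous_const, ‖p‖ * ‖v‖, 2, fun y => ?_⟩
  calc _ ≤ ‖p‖ * (1 + ‖y‖) ^ 2 * ‖v‖ :=
        (posteriorLogDeriv p y).le_of_opNorm_le (norm_posteriorLogDeriv_le p y) v
    _ = _ := by ring

lemma fderiv_posteriorIntegral_apply (hρ : HasMoments ρ) (hQ : PolyGrowth Q)
    (p v : ℝ × EuclideanSpace ℝ (Fin d)) :
    fderiv ℝ (posteriorIntegral ρ Q) p v =
      posteriorIntegral ρ (fun y => posteriorLogDeriv p y v • Q y) p := by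
  rw [(hasFDerivAt_posteriorIntegral hρ hQ p).1.fderiv, posteriorIntegral,
    ContinuousLinearMap.integral_apply]
  · rfl
  · have hL : Continuous (fun y : EuclideanSpace ℝ (Fin d) => posteriorLogDeriv p y) :=
      (continuous_posteriorLogDeriv (d := d)).comp (f := fun y => (p, y)) (by fun_prop)
    refine integrable_posteriorWeight_smul hρ
      (Q := fun y => (posteriorLogDeriv p y).smulRight (Q y)) ?_ p
    have h1 : PolyGrowth (fun y => posteriorLogDeriv p y) :=
      ⟨hL, ‖p‖, 2, norm_posteriorLogDeriv_le p⟩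
    exact PolyGrowth.bilin (ContinuousLinearMap.smulRightL ℝ _ F) h1 hQ

/-- The expectation of `Q` under the conditional law of `X₁` given `X₀ + σ X₁ = x`. -/
noncomputable def posteriorExp (ρ : EuclideanSpace ℝ (Fin d) → ℝ)
    (Q : EuclideanSpace ℝ (Fin d) → F) (p : ℝ × EuclideanSpace ℝ (Fin d)) : F :=
  (posteriorIntegral ρ (fun _ => (1 : ℝ)) p)⁻¹ • posteriorIntegral ρ Q p

lemma posteriorIntegral_one_pos (hρ : HasMoments ρ) (p : ℝ × EuclideanSpace ℝ (Fin d)) :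
    0 < posteriorIntegral ρ (fun _ => (1 : ℝ)) p := by
  have hint := integrable_posteriorWeight_smul hρ (PolyGrowth.const (d := d) (1 : ℝ)) p
  refine (integral_pos_iff_support_of_nonneg (fun y => ?_) hint).2 ?_
  · simpa using (posteriorWeight_pos hρ p y).le
  · have : Function.support (fun y => posteriorWeight ρ p y • (1 : ℝ)) = univ := by
      ext y; simpa using (posteriorWeight_pos hρ p y).ne'
    rw [this]
    exact isOpen_univ.measure_pos _ univ_nonempty

lemma posteriorExp_add {R : EuclideanSpace ℝ (Fin d) → F} (hρ : HasMoments ρ)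
    (hQ : PolyGrowth Q) (hR : PolyGrowth R) (p : ℝ × EuclideanSpace ℝ (Fin d)) :
    posteriorExp ρ (fun y => Q y + R y) p = posteriorExp ρ Q p + posteriorExp ρ R p := by
  simp only [posteriorExp, posteriorIntegral, ← smul_add]
  rw [← integral_add (integrable_posteriorWeight_smul hρ hQ p)
    (integrable_posteriorWeight_smul hρ hR p)]
  simp only [smul_add]

variable [CompleteSpace F]

lemma posteriorExp_clm [CompleteSpace G]
    (hρ : HasMoments ρ) (hQ : PolyGrowth Q) (L : F →L[ℝ] G) (p : ℝ × EuclideanSpace ℝ (Fin d)) :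
    posteriorExp ρ (fun y => L (Q y)) p = L (posteriorExp ρ Q p) := by
  simp only [posteriorExp, posteriorIntegral, map_smul]
  rw [← L.integral_comp_comm (integrable_posteriorWeight_smul hρ hQ p)]
  simp only [map_smul]

lemma posteriorExp_const (hρ : HasMoments ρ) (c : F) (p : ℝ × EuclideanSpace ℝ (Fin d)) :
    posteriorExp ρ (fun _ => c) p = c := by
  have h1 := posteriorExp_clm hρ (PolyGrowth.const (d := d) (1 : ℝ))
    (ContinuousLinearMap.toSpanSingleton ℝ c) p
  simp only [ContinuousLinearMap.toSpanSingleton_apply, one_smul] at h1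
  rw [h1, posteriorExp, smul_eq_mul, inv_mul_cancel₀ (posteriorIntegral_one_pos hρ p).ne', one_smul]

lemma posteriorExp_const_smul (hρ : HasMoments ρ) (hQ : PolyGrowth Q) (c : ℝ)
    (p : ℝ × EuclideanSpace ℝ (Fin d)) :
    posteriorExp ρ (fun y => c • Q y) p = c • posteriorExp ρ Q p := by
  simpa using posteriorExp_clm hρ hQ (c • ContinuousLinearMap.id ℝ F) p

lemma posteriorExp_nonneg {q : EuclideanSpace ℝ (Fin d) → ℝ} (hρ : HasMoments ρ)
    (hq : ∀ y, 0 ≤ q y) (p : ℝ × EuclideanSpace ℝ (Fin d)) : 0 ≤ posteriorExp ρ q p :=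
  mul_nonneg (inv_nonneg.2 (posteriorIntegral_one_pos hρ p).le)
    (integral_nonneg fun y => mul_nonneg (posteriorWeight_pos hρ p y).le (hq y))

lemma contDiff_posteriorExp (hρ : HasMoments ρ) (hQ : PolyGrowth Q) :
    ContDiff ℝ 1 (posteriorExp ρ Q) :=
  ((contDiff_posteriorIntegral hρ (PolyGrowth.const 1)).inv fun p =>
    (posteriorIntegral_one_pos hρ p).ne').smul (contDiff_posteriorIntegral hρ hQ)

/-- The derivative of a posterior expectation is a posterior covariance with the score. -/
lemma fderiv_posteriorExp_apply (hρ : HasMoments ρ) (hQ : PolyGrowth Q)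
    (p v : ℝ × EuclideanSpace ℝ (Fin d)) :
    fderiv ℝ (posteriorExp ρ Q) p v =
      posteriorExp ρ (fun y => posteriorLogDeriv p y v • Q y) p -
      posteriorExp ρ (fun y => posteriorLogDeriv p y v) p • posteriorExp ρ Q p := by
  have h1 := ((contDiff_posteriorIntegral hρ
    (PolyGrowth.const (d := d) (1 : ℝ))).differentiable one_ne_zero p).hasFDerivAt
  have h2 := ((contDiff_posteriorIntegral hρ hQ).differentiable one_ne_zero p).hasFDerivAt
  have h0 := (posteriorIntegral_one_pos hρ p).ne'
  have h3 := ((hasDerivAt_inv h0).comp_hasFDerivAt p h1).smul h2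
  have h4 : fderiv ℝ (posteriorExp ρ Q) p = _ := h3.fderiv
  rw [h4]
  simp only [Function.comp, add_apply, smul_apply,
    ContinuousLinearMap.smulRight_apply, fderiv_posteriorIntegral_apply hρ hQ,
    fderiv_posteriorIntegral_apply hρ (PolyGrowth.const (d := d) (1 : ℝ)), posteriorExp,
    smul_eq_mul, mul_one]
  rw [sub_eq_add_neg]
  congr 1
  rw [smul_smul, ← neg_smul]
  congr 1
  field_simp

end Posterior

/-! ### Posterior covariance and the Brascamp–Lieb bound -/

/-- A pointwise form of the second order Taylor bound. -/
lemma hasDerivAt_le_of_symm_diff_le {φ φ' : ℝ → ℝ} {A B : ℝ} (hφ : ∀ t, HasDerivAt φ (φ' t) t)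
    (hA : HasDerivAt φ' A 0) (h : ∀ t, φ t + φ (-t) - 2 * φ 0 ≤ B * t ^ 2) : A ≤ B := by
  by_contra! hlt
  -- If `B < A`, then `ψ' 0 = 0` and `ψ'' 0 = 2 (A - B) > 0`, so `ψ` increases strictly to the right
  -- of `0`, while `h` bounds it there by `ψ 0`.
  set ψ : ℝ → ℝ := fun t => φ t + φ (-t) - B * t ^ 2 with hψ
  set ψ' : ℝ → ℝ := fun t => φ' t - φ' (-t) - 2 * B * t with hψ'
  have hd : ∀ t, HasDerivAt ψ (ψ' t) t := fun t => by
    have h1 := (hφ (-t)).comp t (hasDerivAt_neg t)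
    refine (((hφ t).add h1).sub ((hasDerivAt_pow 2 t).const_mul B)).congr_deriv ?_
    simp only [hψ']; push_cast; ring
  have hd2 : HasDerivAt ψ' (2 * (A - B)) 0 := by
    have h1 : HasDerivAt (fun t => φ' (-t)) (A * (-1)) 0 :=
      HasDerivAt.comp (0 : ℝ) (by simpa using hA) (hasDerivAt_neg 0)
    refine ((hA.sub h1).sub ((hasDerivAt_id (0 : ℝ)).const_mul (2 * B))).congr_deriv ?_
    ring
  have hev : ∀ᶠ t in nhdsWithin (0 : ℝ) (Ioi 0), 0 < ψ' t := by
    have h1 := (hasDerivAt_iff_tendsto_slope.1 hd2).eventually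
      (lt_mem_nhds (show 0 < 2 * (A - B) by linarith))
    have h2 := h1.filter_mono (nhdsWithin_mono 0 (fun t (ht : 0 < t) => ht.ne'))
    filter_upwards [h2, self_mem_nhdsWithin] with t ht ht0
    rw [slope_def_field, show ψ' 0 = 0 by simp [hψ'], sub_zero, sub_zero] at ht
    rw [mem_Ioi] at ht0
    exact (div_pos_iff_of_pos_right ht0).1 ht
  obtain ⟨ε, hε, hεs⟩ := mem_nhdsGT_iff_exists_Ioc_subset.1 hev
  rw [mem_Ioi] at hε
  have hmono : StrictMonoOn ψ (Icc 0 ε) := strictMonoOn_of_deriv_pos (convex_Icc 0 ε)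
    (fun t _ => (hd t).continuousAt.continuousWithinAt) fun t ht => by
      rw [interior_Icc] at ht
      rw [(hd t).deriv]
      exact hεs ⟨ht.1, ht.2.le⟩
  have h1 := hmono (left_mem_Icc.2 hε.le) (right_mem_Icc.2 hε.le) hε
  have h2 := h ε
  simp only [hψ, neg_zero] at h1
  linarith

section Covariance

variable {d : ℕ} {ρ : EuclideanSpace ℝ (Fin d) → ℝ}

/-- The covariance operator of the conditional law of `X₁` given `X₀ + σ X₁ = x`. -/
noncomputable def posteriorCov (ρ : EuclideanSpace ℝ (Fin d) → ℝ)
    (p : ℝ × EuclideanSpace ℝ (Fin d)) (h : EuclideanSpace ℝ (Fin d)) :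
    EuclideanSpace ℝ (Fin d) :=
  posteriorExp ρ (fun y => inner ℝ y h • y) p -
    posteriorExp ρ (fun y => inner ℝ y h) p • posteriorExp ρ (fun y => y) p

lemma polyGrowth_inner_const (h : EuclideanSpace ℝ (Fin d)) :
    PolyGrowth (fun y : EuclideanSpace ℝ (Fin d) => inner ℝ y h) :=
  PolyGrowth.inner .id (.const h)

lemma posteriorExp_inner (hρ : HasMoments ρ) {Q : EuclideanSpace ℝ (Fin d) → EuclideanSpace ℝ (Fin d)}
    (hQ : PolyGrowth Q) (p : ℝ × EuclideanSpace ℝ (Fin d)) (g : EuclideanSpace ℝ (Fin d)) :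
    posteriorExp ρ (fun y => inner ℝ (Q y) g) p = inner ℝ (posteriorExp ρ Q p) g := by
  have := posteriorExp_clm hρ hQ (innerSL ℝ g) p
  simpa [real_inner_comm] using this

lemma inner_posteriorCov (hρ : HasMoments ρ) (p : ℝ × EuclideanSpace ℝ (Fin d))
    (h g : EuclideanSpace ℝ (Fin d)) :
    inner ℝ (posteriorCov ρ p h) g = posteriorExp ρ (fun y => inner ℝ y h * inner ℝ y g) p -
      posteriorExp ρ (fun y => inner ℝ y h) p * posteriorExp ρ (fun y => inner ℝ y g) p := by
  rw [posteriorCov, inner_sub_left, ← posteriorExp_inner hρ ((polyGrowth_inner_const h).smul .id),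
    real_inner_smul_left, ← posteriorExp_inner hρ .id]
  simp only [real_inner_smul_left]

lemma inner_posteriorCov_comm (hρ : HasMoments ρ) (p : ℝ × EuclideanSpace ℝ (Fin d))
    (h g : EuclideanSpace ℝ (Fin d)) :
    inner ℝ (posteriorCov ρ p h) g = inner ℝ h (posteriorCov ρ p g) := by
  rw [real_inner_comm _ h, inner_posteriorCov hρ, inner_posteriorCov hρ]
  congr 1
  · simp only [mul_comm]
  · ring

lemma inner_posteriorCov_self_nonneg (hρ : HasMoments ρ) (p : ℝ × EuclideanSpace ℝ (Fin d))
    (h : EuclideanSpace ℝ (Fin d)) : 0 ≤ inner ℝ (posteriorCov ρ p h) h := by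
  rw [inner_posteriorCov hρ]
  set a := posteriorExp ρ (fun y => inner ℝ y h) p
  have h1 : 0 ≤ posteriorExp ρ (fun y => (inner ℝ y h - a) ^ 2) p :=
    posteriorExp_nonneg hρ (fun y => sq_nonneg _) p
  have h2 : (fun y : EuclideanSpace ℝ (Fin d) => (inner ℝ y h - a) ^ 2) =
      fun y => inner ℝ y h • inner ℝ y h + ((-(2 * a)) • inner ℝ y h + a ^ 2) := by
    ext y; simp only [smul_eq_mul]; ring
  have hi := polyGrowth_inner_const h
  rw [h2, posteriorExp_add hρ (hi.smul hi) (((PolyGrowth.const (-(2 * a))).smul hi).add (.const _)),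
    posteriorExp_add hρ ((PolyGrowth.const (-(2 * a))).smul hi) (.const _),
    posteriorExp_const hρ, posteriorExp_const_smul hρ hi] at h1
  simp only [smul_eq_mul] at h1 ⊢
  change 0 ≤ _ + (-(2 * a) * a + a ^ 2) at h1
  linarith

lemma posteriorLogDeriv_inr (σ : ℝ) (x y h : EuclideanSpace ℝ (Fin d)) :
    posteriorLogDeriv (σ, x) y (0, h) = σ • inner ℝ y h + -inner ℝ x h := by
  simp [posteriorLogDeriv_apply, inner_sub_left, real_inner_smul_left, ← sub_eq_add_neg]

/-- In the direction `h` of `x` the score is `σ ⟨y, h⟩ - ⟨x, h⟩`; its second term does not depend on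
`y` and drops out of the covariance. -/
lemma fderiv_posteriorExp_inr (hρ : HasMoments ρ) (σ : ℝ) (x h : EuclideanSpace ℝ (Fin d)) :
    fderiv ℝ (posteriorExp ρ (fun y => y)) (σ, x) (0, h) = σ • posteriorCov ρ (σ, x) h := by
  have hi := polyGrowth_inner_const h
  have hσ := (PolyGrowth.const (d := d) σ).smul hi
  rw [fderiv_posteriorExp_apply hρ .id]
  simp only [posteriorLogDeriv_inr, add_smul, smul_assoc]
  rw [posteriorExp_add hρ ((PolyGrowth.const (d := d) σ).smul (hi.smul .id))
    ((PolyGrowth.const _).smul .id), posteriorExp_add hρ hσ (.const _), posteriorExp_const hρ,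
    posteriorExp_const_smul hρ hi, posteriorExp_const_smul hρ (hi.smul .id),
    posteriorExp_const_smul hρ .id, posteriorCov]
  simp only [smul_eq_mul]
  module

/-- Differentiating once more gives `∇² log Z = σ² Cov - I`, which converts concavity of `log Z`
into an upper bound on the covariance. -/
lemma hasDerivAt_log_posteriorIntegral (hρ : HasMoments ρ) (σ : ℝ)
    (x h : EuclideanSpace ℝ (Fin d)) (t : ℝ) :
    HasDerivAt (fun t : ℝ => Real.log (posteriorIntegral ρ (fun _ => (1 : ℝ)) (σ, x + t • h)))
      (σ * inner ℝ (posteriorExp ρ (fun y => y) (σ, x + t • h)) h - inner ℝ (x + t • h) h) t := by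
  have h1 := ((contDiff_posteriorIntegral hρ (PolyGrowth.const (d := d) (1 : ℝ))).differentiable
    one_ne_zero (σ, x + t • h)).hasFDerivAt
  have h2 := h1.comp_hasDerivAt t ((hasDerivAt_const t σ).prodMk (hasDerivAt_line x h t))
  refine (h2.log (posteriorIntegral_one_pos hρ _).ne').congr_deriv ?_
  have hi := polyGrowth_inner_const h
  rw [fderiv_posteriorIntegral_apply hρ (PolyGrowth.const (d := d) (1 : ℝ)), div_eq_inv_mul]
  change posteriorExp ρ (fun y => posteriorLogDeriv (σ, x + t • h) y (0, h) • (1 : ℝ)) _ = _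
  simp only [posteriorLogDeriv_inr, smul_eq_mul, mul_one]
  simp only [← smul_eq_mul (a := σ)]
  rw [posteriorExp_add hρ ((PolyGrowth.const (d := d) σ).smul hi) (.const _),
    posteriorExp_const hρ, posteriorExp_const_smul hρ hi, posteriorExp_inner hρ .id,
    sub_eq_add_neg]

lemma hasDerivAt_inner_posteriorExp (hρ : HasMoments ρ) (σ : ℝ)
    (x h : EuclideanSpace ℝ (Fin d)) :
    HasDerivAt (fun t : ℝ => σ * inner ℝ (posteriorExp ρ (fun y => y) (σ, x + t • h)) h -
      inner ℝ (x + t • h) h) (σ ^ 2 * inner ℝ (posteriorCov ρ (σ, x) h) h - ‖h‖ ^ 2) 0 := by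
  have h1 := ((contDiff_posteriorExp hρ (PolyGrowth.id (d := d))).differentiable
    one_ne_zero (σ, x + (0 : ℝ) • h)).hasFDerivAt
  have h2 := h1.comp_hasDerivAt 0 ((hasDerivAt_const 0 σ).prodMk (hasDerivAt_line x h 0))
  have h3 := (h2.inner ℝ (hasDerivAt_const 0 h)).const_mul σ
  have h4 := (hasDerivAt_line x h 0).inner ℝ (hasDerivAt_const 0 h)
  refine (h3.sub h4).congr_deriv ?_
  rw [zero_smul, add_zero, fderiv_posteriorExp_inr hρ]
  simp only [real_inner_smul_left, inner_zero_right, zero_add, real_inner_self_eq_norm_sq]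
  ring

variable {V : EuclideanSpace ℝ (Fin d) → ℝ} {κ : ℝ}

/-- The convexity estimate behind the log-concavity of the law of `X₀ + σ X₁`. -/
lemma midpoint_convex_estimate (hV : ConvexOn ℝ univ (fun x => V x - κ / 2 * ‖x‖ ^ 2)) {σ : ℝ}
    (hκσ : 0 < κ + σ ^ 2) (x h a b : EuclideanSpace ℝ (Fin d)) :
    κ / (κ + σ ^ 2) * ‖h‖ ^ 2 + 2 * (V ((2 : ℝ)⁻¹ • (a + b)) +
        ‖x - σ • ((2 : ℝ)⁻¹ • (a + b))‖ ^ 2 / 2) ≤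
      (V a + ‖x + h - σ • a‖ ^ 2 / 2) + (V b + ‖x - h - σ • b‖ ^ 2 / 2) := by
  have h1 := hV.2 (mem_univ a) (mem_univ b) (show (0 : ℝ) ≤ 2⁻¹ by norm_num)
    (show (0 : ℝ) ≤ 2⁻¹ by norm_num) (by norm_num)
  rw [← smul_add] at h1
  simp only [smul_eq_mul] at h1
  obtain ⟨e, he⟩ : ∃ e : EuclideanSpace ℝ (Fin d), e = (2 : ℝ)⁻¹ • (a - b) := ⟨_, rfl⟩
  obtain ⟨m, hm⟩ : ∃ m : EuclideanSpace ℝ (Fin d), m = (2 : ℝ)⁻¹ • (a + b) := ⟨_, rfl⟩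
  rw [← hm] at h1 ⊢
  have ha : a = m + e := by rw [he, hm]; module
  have hb : b = m - e := by rw [he, hm]; module
  have h2 : ‖a‖ ^ 2 + ‖b‖ ^ 2 = 2 * ‖m‖ ^ 2 + 2 * ‖e‖ ^ 2 := by
    rw [ha, hb, @norm_add_sq_real, @norm_sub_sq_real]; ring
  have h3 : ‖x + h - σ • a‖ ^ 2 + ‖x - h - σ • b‖ ^ 2 =
      2 * ‖x - σ • m‖ ^ 2 + 2 * ‖h - σ • e‖ ^ 2 := by
    rw [show x + h - σ • a = (x - σ • m) + (h - σ • e) by rw [ha]; module,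
      show x - h - σ • b = (x - σ • m) - (h - σ • e) by rw [hb]; module]
    generalize x - σ • m = u
    generalize h - σ • e = w
    rw [@norm_add_sq_real, @norm_sub_sq_real]; ring
  -- Completing the square in `e`: the minimum of `κ ‖e‖² + ‖h - σ e‖²` is `κ / (κ + σ²) ‖h‖²`,
  -- attained at `e = σ / (κ + σ²) h`.
  have h4 : 0 ≤ (κ + σ ^ 2) * ‖e - (σ / (κ + σ ^ 2)) • h‖ ^ 2 := by positivity
  have h5 : (κ + σ ^ 2) * ‖e - (σ / (κ + σ ^ 2)) • h‖ ^ 2 =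
      κ * ‖e‖ ^ 2 + ‖h - σ • e‖ ^ 2 - κ / (κ + σ ^ 2) * ‖h‖ ^ 2 := by
    rw [@norm_sub_sq_real, @norm_sub_sq_real, norm_smul, norm_smul, mul_pow, mul_pow,
      real_inner_smul_right, real_inner_smul_right, real_inner_comm h e, Real.norm_eq_abs,
      Real.norm_eq_abs, sq_abs, sq_abs]
    field_simp
    ring
  nlinarith

/-- Quantitative log-concavity of `Z`: Prékopa–Leindler for the weights at `x + h` and `x - h`,
compared with `c` times the weight at `x`, where `c ^ 2` is the exponential factor. -/
lemma posteriorIntegral_mul_le (hV : ConvexOn ℝ univ (fun x => V x - κ / 2 * ‖x‖ ^ 2))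
    (hρ : HasMoments (fun y => Real.exp (-V y))) {σ : ℝ}
    (hκσ : 0 < κ + σ ^ 2) (x h : EuclideanSpace ℝ (Fin d)) :
    posteriorIntegral (fun y => Real.exp (-V y)) (fun _ => (1 : ℝ)) (σ, x + h) *
      posteriorIntegral (fun y => Real.exp (-V y)) (fun _ => (1 : ℝ)) (σ, x - h) ≤
      Real.exp (-(κ / (κ + σ ^ 2) * ‖h‖ ^ 2)) *
        posteriorIntegral (fun y => Real.exp (-V y)) (fun _ => (1 : ℝ)) (σ, x) ^ 2 := by
  set ρ : EuclideanSpace ℝ (Fin d) → ℝ := fun y => Real.exp (-V y) with hρdef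
  set Z := posteriorIntegral ρ (fun _ => (1 : ℝ)) with hZ
  set c := Real.exp (-(κ / (κ + σ ^ 2) * ‖h‖ ^ 2) / 2) with hc
  have hm : ∀ p, Measurable (fun y => posteriorWeight ρ p y) := fun p =>
    ((continuous_posteriorWeight hρ).comp (f := fun y => (p, y)) (by fun_prop)).measurable
  have hlin : ∀ p, ∫⁻ y, ENNReal.ofReal (posteriorWeight ρ p y) = ENNReal.ofReal (Z p) := fun p => by
    have h1 := integrable_posteriorWeight_smul hρ (PolyGrowth.const (d := d) (1 : ℝ)) p
    simp only [smul_eq_mul, mul_one] at h1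
    rw [hZ, posteriorIntegral, ← ofReal_integral_eq_lintegral_ofReal]
    · simp
    · exact h1
    · exact .of_forall fun y => (posteriorWeight_pos hρ p y).le
  have key := lintegral_mul_le_of_midpoint
    (f := fun y => ENNReal.ofReal (posteriorWeight ρ (σ, x + h) y))
    (g := fun y => ENNReal.ofReal (posteriorWeight ρ (σ, x - h) y))
    (h := fun y => ENNReal.ofReal (c * posteriorWeight ρ (σ, x) y))
    (hm _).ennreal_ofReal (hm _).ennreal_ofReal ((hm _).const_mul c).ennreal_ofReal
    (fun a b => by
      rw [← ENNReal.ofReal_mul (posteriorWeight_pos hρ _ _).le, ← ENNReal.ofReal_pow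
        (mul_nonneg (Real.exp_pos _).le (posteriorWeight_pos hρ _ _).le)]
      refine ENNReal.ofReal_le_ofReal ?_
      simp only [posteriorWeight, hρdef, ← Real.exp_add, ← Real.exp_nat_mul]
      refine Real.exp_le_exp.2 ?_
      have := midpoint_convex_estimate hV hκσ x h a b
      push_cast
      linarith)
  simp only [ENNReal.ofReal_mul (Real.exp_pos _).le, hc] at key
  rw [lintegral_const_mul _ (hm _).ennreal_ofReal, hlin, hlin, hlin,
    ← ENNReal.ofReal_mul (posteriorIntegral_one_pos hρ _).le, ← ENNReal.ofReal_mul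
    (Real.exp_pos _).le, ← ENNReal.ofReal_pow (mul_nonneg (Real.exp_pos _).le
    (posteriorIntegral_one_pos hρ _).le), ENNReal.ofReal_le_ofReal_iff (sq_nonneg _), mul_pow,
    ← Real.exp_nat_mul] at key
  convert key using 3
  push_cast
  ring

/-- The Brascamp–Lieb bound on the posterior covariance. -/
lemma inner_posteriorCov_self_le (hV : ConvexOn ℝ univ (fun x => V x - κ / 2 * ‖x‖ ^ 2))
    (hρ : HasMoments (fun y => Real.exp (-V y))) {σ : ℝ} (hσ : σ ≠ 0)
    (hκσ : 0 < κ + σ ^ 2) (x h : EuclideanSpace ℝ (Fin d)) :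
    inner ℝ (posteriorCov (fun y => Real.exp (-V y)) (σ, x) h) h ≤ ‖h‖ ^ 2 / (κ + σ ^ 2) := by
  -- Taking logarithms bounds the symmetric second difference of `log Z`, whence `σ² Cov - 1 ≤ -κ /
  -- (κ + σ²)`; dividing by `σ²` is where `σ ≠ 0` enters.
  have h1 := hasDerivAt_le_of_symm_diff_le (B := -(κ / (κ + σ ^ 2) * ‖h‖ ^ 2))
    (hasDerivAt_log_posteriorIntegral hρ σ x h) (hasDerivAt_inner_posteriorExp hρ σ x h)
    (fun t => by
      have h2 := posteriorIntegral_mul_le hV hρ hκσ x (t • h)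
      have hp := posteriorIntegral_one_pos hρ
      have h3 := Real.log_le_log (mul_pos (hp _) (hp _)) h2
      rw [Real.log_mul (hp _).ne' (hp _).ne', Real.log_mul (Real.exp_pos _).ne'
        (pow_pos (hp _) 2).ne', Real.log_exp, Real.log_pow, norm_smul, mul_pow, Real.norm_eq_abs,
        sq_abs] at h3
      rw [zero_smul, add_zero, neg_smul, ← sub_eq_add_neg]
      push_cast at h3
      linarith)
  have hσ2 : 0 < σ ^ 2 := by positivity
  have h3 : σ ^ 2 * inner ℝ (posteriorCov (fun y => Real.exp (-V y)) (σ, x) h) h ≤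
      σ ^ 2 * (‖h‖ ^ 2 / (κ + σ ^ 2)) := by
    have : σ ^ 2 * (‖h‖ ^ 2 / (κ + σ ^ 2)) = ‖h‖ ^ 2 - κ / (κ + σ ^ 2) * ‖h‖ ^ 2 := by
      field_simp
      ring
    linarith
  exact le_of_mul_le_mul_left h3 hσ2

end Covariance

/-! ### The standard Gaussian: density and moments -/

section Gaussian

variable {d : ℕ}

/-- The unnormalised density of the standard Gaussian. -/
noncomputable def gaussWeight (z : EuclideanSpace ℝ (Fin d)) : ℝ := Real.exp (-(‖z‖ ^ 2 / 2))

/-- The normalising constant of `gaussWeight`. -/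
noncomputable def gaussNorm (d : ℕ) : ℝ := ∫ z : EuclideanSpace ℝ (Fin d), gaussWeight z

lemma gaussWeight_pos (z : EuclideanSpace ℝ (Fin d)) : 0 < gaussWeight z := Real.exp_pos _

lemma hasMoments_gaussWeight : HasMoments (gaussWeight (d := d)) :=
  hasMoments_exp_neg (a := 1) (b := 1 / 2) one_pos
    (fun x => by nlinarith [sq_nonneg (‖x‖ - 1)]) (by fun_prop)

lemma integrable_gaussWeight : Integrable (gaussWeight (d := d)) := by
  simpa using hasMoments_gaussWeight.integrable 0

lemma gaussNorm_pos : 0 < gaussNorm d := by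
  refine (integral_pos_iff_support_of_nonneg (fun y => (gaussWeight_pos y).le)
    integrable_gaussWeight).2 ?_
  have : Function.support (gaussWeight (d := d)) = univ := by
    ext y; simpa using (gaussWeight_pos y).ne'
  rw [this]
  exact isOpen_univ.measure_pos _ univ_nonempty

lemma integral_gaussWeight_mul_cexp (t : EuclideanSpace ℝ (Fin d)) :
    ∫ z, (gaussWeight z : ℂ) * Complex.exp (inner ℝ z t * Complex.I) =
      gaussNorm d * Complex.exp (-‖t‖ ^ 2 / 2) := by
  have hb : 0 < (2⁻¹ : ℂ).re := by norm_num
  have h1 : ∀ c : ℂ, ∫ z : EuclideanSpace ℝ (Fin d), (gaussWeight z : ℂ) *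
      Complex.exp (c * inner ℝ z t) = (Real.pi / (2⁻¹ : ℂ)) ^ (Module.finrank ℝ
        (EuclideanSpace ℝ (Fin d)) / 2 : ℂ) * Complex.exp (c ^ 2 * ‖t‖ ^ 2 / (4 * 2⁻¹)) := by
    intro c
    rw [← GaussianFourier.integral_cexp_neg_mul_sq_norm_add hb c t]
    congr with z
    rw [gaussWeight, Complex.ofReal_exp, ← Complex.exp_add, real_inner_comm]
    congr 1
    push_cast
    ring
  have h0 : (gaussNorm d : ℂ) = (Real.pi / (2⁻¹ : ℂ)) ^ (Module.finrank ℝ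
        (EuclideanSpace ℝ (Fin d)) / 2 : ℂ) := by
    have := h1 0
    simp only [zero_mul, Complex.exp_zero, mul_one, ne_eq, OfNat.ofNat_ne_zero, not_false_eq_true,
      zero_pow, zero_div] at this
    rw [← this, gaussNorm]
    exact integral_ofReal.symm
  have h2 := h1 Complex.I
  rw [← h0] at h2
  simp only [mul_comm _ Complex.I]
  rw [h2, Complex.I_sq]
  congr 2
  ring

/-- Both measures have characteristic function `exp (-‖t‖² / 2)`. -/
lemma stdGaussian_eq_withDensity : stdGaussian (EuclideanSpace ℝ (Fin d)) =
    volume.withDensity (fun z => ENNReal.ofReal ((gaussNorm d)⁻¹ * gaussWeight z)) := by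
  have hC := gaussNorm_pos (d := d)
  have hg0 : ∀ z : EuclideanSpace ℝ (Fin d), 0 ≤ (gaussNorm d)⁻¹ * gaussWeight z := fun z =>
    mul_nonneg (inv_nonneg.2 hC.le) (gaussWeight_pos _).le
  have hgi : Integrable (fun z : EuclideanSpace ℝ (Fin d) => (gaussNorm d)⁻¹ * gaussWeight z) :=
    integrable_gaussWeight.const_mul _
  have : IsFiniteMeasure (volume.withDensity
      (fun z : EuclideanSpace ℝ (Fin d) => ENNReal.ofReal ((gaussNorm d)⁻¹ * gaussWeight z))) :=
    isFiniteMeasure_withDensity_ofReal hgi.2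
  refine Measure.ext_of_charFun (funext fun t => ?_)
  rw [charFun_stdGaussian, charFun_apply, integral_withDensity_eq_integral_toReal_smul
    (by have := (hasMoments_gaussWeight (d := d)).continuous; fun_prop) (by simp)]
  simp only [ENNReal.toReal_ofReal (hg0 _), Complex.real_smul, Complex.ofReal_mul, mul_assoc]
  rw [integral_const_mul, integral_gaussWeight_mul_cexp, ← mul_assoc, ← Complex.ofReal_mul,
    inv_mul_cancel₀ hC.ne', Complex.ofReal_one, one_mul]

lemma integral_stdGaussian_eq {F : Type*} [NormedAddCommGroup F] [NormedSpace ℝ F]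
    (f : EuclideanSpace ℝ (Fin d) → F) :
    ∫ z, f z ∂(stdGaussian (EuclideanSpace ℝ (Fin d))) =
      (gaussNorm d)⁻¹ • ∫ z, gaussWeight z • f z := by
  have hC := gaussNorm_pos (d := d)
  rw [stdGaussian_eq_withDensity, integral_withDensity_eq_integral_toReal_smul
    (by have := (hasMoments_gaussWeight (d := d)).continuous; fun_prop) (by simp),
    ← integral_smul]
  congr with z
  rw [ENNReal.toReal_ofReal (mul_nonneg (inv_nonneg.2 hC.le) (gaussWeight_pos _).le), smul_smul]

variable {F : Type*} [NormedAddCommGroup F] [NormedSpace ℝ F]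

/-- The integral of `Q` against `gaussWeight`. -/
noncomputable def gaussIntegral (Q : EuclideanSpace ℝ (Fin d) → F) : F :=
  ∫ z, gaussWeight z • Q z

lemma integrable_gaussWeight_smul {Q : EuclideanSpace ℝ (Fin d) → F} (hQ : PolyGrowth Q) :
    Integrable (fun z => gaussWeight z • Q z) := by
  refine (hQ.integrable hasMoments_gaussWeight).mono'
    (hasMoments_gaussWeight.continuous.smul hQ.continuous).aestronglyMeasurable
    (.of_forall fun z => ?_)
  rw [norm_smul, Real.norm_of_nonneg (gaussWeight_pos _).le]

lemma gaussIntegral_one : gaussIntegral (fun _ : EuclideanSpace ℝ (Fin d) => (1 : ℝ)) =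
    gaussNorm d := by
  simp [gaussIntegral, gaussNorm]

lemma gaussIntegral_of_odd {Q : EuclideanSpace ℝ (Fin d) → F} (hQ : ∀ z, Q (-z) = -Q z) :
    gaussIntegral Q = 0 := by
  have h1 : gaussIntegral Q = -gaussIntegral Q := by
    conv_lhs => rw [gaussIntegral, ← integral_neg_eq_self]
    rw [gaussIntegral, ← integral_neg]
    congr with z
    rw [hQ, smul_neg, gaussWeight, gaussWeight, norm_neg]
  have h2 : (2 : ℝ) • gaussIntegral Q = 0 := by
    rw [two_smul]
    nth_rewrite 2 [h1]
    exact add_neg_cancel _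
  exact (smul_eq_zero.1 h2).resolve_left two_ne_zero

lemma gaussIntegral_inner_smul (h : EuclideanSpace ℝ (Fin d)) :
    gaussIntegral (fun z : EuclideanSpace ℝ (Fin d) => inner ℝ z h • z) = gaussNorm d • h := by
  have hC := gaussNorm_pos (d := d)
  refine ext_inner_right ℝ fun g => ?_
  have h1 := covarianceBilin_apply (μ := stdGaussian (EuclideanSpace ℝ (Fin d)))
    IsGaussian.memLp_two_id h g
  simp only [id_eq, integral_id_stdGaussian, sub_zero, covarianceBilin_stdGaussian] at h1
  rw [integral_stdGaussian_eq, innerSL_apply_apply, smul_eq_mul,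
    eq_inv_mul_iff_mul_eq₀ hC.ne'] at h1
  have hpg : PolyGrowth (fun z : EuclideanSpace ℝ (Fin d) => inner ℝ z h • z) :=
    (polyGrowth_inner_const h).smul .id
  rw [real_inner_smul_left, h1, gaussIntegral, real_inner_comm,
    ← integral_inner (integrable_gaussWeight_smul hpg)]
  congr with z
  rw [real_inner_smul_right, real_inner_smul_right, smul_eq_mul, real_inner_comm h z]

end Gaussian

/-! ### First-order expansion in the noise level -/

section Noise

variable {d : ℕ} {F : Type*} [NormedAddCommGroup F] [NormedSpace ℝ F]

/-- The integral of `Q` against the unnormalised conditional density of `Z` given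
`τ Z + X₁ = x`, where `p = (τ, x)`, `Z` is standard Gaussian and `X₁` has density `ρ`. -/
noncomputable def noiseIntegral (ρ : EuclideanSpace ℝ (Fin d) → ℝ)
    (Q : EuclideanSpace ℝ (Fin d) → F) (p : ℝ × EuclideanSpace ℝ (Fin d)) : F :=
  ∫ z, (gaussWeight z * ρ (p.2 - p.1 • z)) • Q z

/-- The difference quotient `(ρ (x - τ z) - ρ x) / τ`, extended continuously to `τ = 0`. -/
noncomputable def noiseQuot (ρ : EuclideanSpace ℝ (Fin d) → ℝ)
    (p : ℝ × EuclideanSpace ℝ (Fin d)) (z : EuclideanSpace ℝ (Fin d)) : ℝ :=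
  -∫ s in (0 : ℝ)..1, fderiv ℝ ρ (p.2 - (s * p.1) • z) z

/-- The first order remainder of `noiseIntegral` at `τ = 0`, divided by `τ`. -/
noncomputable def noiseCorr (ρ : EuclideanSpace ℝ (Fin d) → ℝ)
    (Q : EuclideanSpace ℝ (Fin d) → F) (p : ℝ × EuclideanSpace ℝ (Fin d)) : F :=
  ∫ z, (gaussWeight z * noiseQuot ρ p z) • Q z

variable {ρ : EuclideanSpace ℝ (Fin d) → ℝ} {Q : EuclideanSpace ℝ (Fin d) → F} {M : ℝ}

lemma continuous_noiseQuot (hρ : ContDiff ℝ 1 ρ) : Continuous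
    (fun q : (ℝ × EuclideanSpace ℝ (Fin d)) × EuclideanSpace ℝ (Fin d) =>
      noiseQuot ρ q.1 q.2) := by
  have hc := hρ.continuous_fderiv one_ne_zero
  unfold noiseQuot
  refine (intervalIntegral.continuous_parametric_intervalIntegral_of_continuous' ?_ 0 1).neg
  simp only [Function.uncurry_def]
  fun_prop

lemma density_sub_smul (hρ : ContDiff ℝ 1 ρ) (p : ℝ × EuclideanSpace ℝ (Fin d))
    (z : EuclideanSpace ℝ (Fin d)) :
    ρ (p.2 - p.1 • z) = ρ p.2 + p.1 * noiseQuot ρ p z := by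
  have hc := hρ.continuous_fderiv one_ne_zero
  have h1 : ∀ s : ℝ, HasDerivAt (fun s : ℝ => ρ (p.2 - (s * p.1) • z))
      (-(p.1 * fderiv ℝ ρ (p.2 - (s * p.1) • z) z)) s := fun s => by
    have h2 : HasDerivAt (fun s : ℝ => p.2 - (s * p.1) • z) (-((1 * p.1) • z)) s :=
      (((hasDerivAt_id s).mul_const p.1).smul_const z).const_sub p.2
    have h3 := (hρ.differentiable one_ne_zero (p.2 - (s * p.1) • z)).hasFDerivAt.comp_hasDerivAt
      s h2
    refine h3.congr_deriv ?_
    simp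
  have h4 := intervalIntegral.integral_eq_sub_of_hasDerivAt (a := 0) (b := 1) (fun s _ => h1 s)
    (Continuous.intervalIntegrable (by fun_prop) 0 1)
  rw [intervalIntegral.integral_neg, intervalIntegral.integral_const_mul] at h4
  simp only [one_mul, zero_mul, zero_smul, sub_zero] at h4
  rw [noiseQuot]
  linarith

/-- The gradient of `ρ` need not be globally bounded, so there are two regimes. If `|τ| ‖z‖ ≤ 1`,
the segment stays in a fixed ball; otherwise the difference quotient is at most `M / |τ| ≤ M ‖z‖` by
boundedness of `ρ`. -/
lemma exists_abs_noiseQuot_le (hρ : ContDiff ℝ 1 ρ) (h0 : ∀ y, 0 ≤ ρ y) (hM : ∀ y, ρ y ≤ M)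
    (R : ℝ) : ∃ C, 0 ≤ C ∧ ∀ p : ℝ × EuclideanSpace ℝ (Fin d), ‖p‖ ≤ R →
      ∀ z, |noiseQuot ρ p z| ≤ C * ‖z‖ := by
  have hc := hρ.continuous_fderiv one_ne_zero
  obtain ⟨L, hL⟩ := (isCompact_closedBall (0 : EuclideanSpace ℝ (Fin d)) (R + 1)).exists_bound_of_continuousOn
    hc.continuousOn
  have hM0 : 0 ≤ M := (h0 0).trans (hM 0)
  refine ⟨|L| + M, by positivity, fun p hp z => ?_⟩
  by_cases hz : |p.1| * ‖z‖ ≤ 1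
  · have h1 : ‖∫ s in (0 : ℝ)..1, fderiv ℝ ρ (p.2 - (s * p.1) • z) z‖ ≤ (|L| * ‖z‖) * |1 - 0| := by
      refine intervalIntegral.norm_integral_le_of_norm_le_const fun s hs => ?_
      rw [uIoc_of_le zero_le_one] at hs
      refine (ContinuousLinearMap.le_opNorm _ _).trans ?_
      gcongr
      refine (hL _ ?_).trans (le_abs_self L)
      rw [mem_closedBall_zero_iff]
      have h2 := norm_sub_le p.2 ((s * p.1) • z)
      have h3 : ‖(s * p.1) • z‖ ≤ 1 := by
        rw [norm_smul, Real.norm_eq_abs, abs_mul, abs_of_pos hs.1, mul_assoc]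
        exact mul_le_one₀ hs.2 (by positivity) hz
      linarith [norm_snd_le p]
    rw [noiseQuot, abs_neg]
    rw [Real.norm_eq_abs] at h1
    refine h1.trans ?_
    norm_num
    nlinarith [norm_nonneg z]
  · push Not at hz
    have h1 := density_sub_smul hρ p z
    have h2 : |p.1| * |noiseQuot ρ p z| ≤ M := by
      rw [← abs_mul, abs_le]
      constructor <;> linarith [h0 (p.2 - p.1 • z), hM (p.2 - p.1 • z), h0 p.2, hM p.2]
    have h3 : 0 < |p.1| := by
      by_contra h
      have : |p.1| = 0 := le_antisymm (not_lt.1 h) (abs_nonneg _)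
      rw [this] at hz
      norm_num at hz
    have h4 : |p.1| * |noiseQuot ρ p z| ≤ |p.1| * (M * ‖z‖) := by nlinarith
    have h5 := le_of_mul_le_mul_left h4 h3
    nlinarith [abs_nonneg L, norm_nonneg z]

lemma integrable_noiseCorr (hρ : ContDiff ℝ 1 ρ) (h0 : ∀ y, 0 ≤ ρ y) (hM : ∀ y, ρ y ≤ M)
    (hQ : PolyGrowth Q) (p : ℝ × EuclideanSpace ℝ (Fin d)) :
    Integrable (fun z => (gaussWeight z * noiseQuot ρ p z) • Q z) := by
  obtain ⟨C, hC0, hC⟩ := exists_abs_noiseQuot_le hρ h0 hM ‖p‖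
  have hq : PolyGrowth (fun z => noiseQuot ρ p z) :=
    PolyGrowth.id.of_le ((continuous_noiseQuot hρ).comp (f := fun z => (p, z)) (by fun_prop))
      (fun z => hC p le_rfl z) hC0
  simpa only [smul_smul] using integrable_gaussWeight_smul (hq.smul hQ)

lemma continuous_noiseCorr (hρ : ContDiff ℝ 1 ρ) (h0 : ∀ y, 0 ≤ ρ y) (hM : ∀ y, ρ y ≤ M)
    (hQ : PolyGrowth Q) : Continuous (noiseCorr ρ Q) := by
  refine continuous_iff_continuousAt.2 fun p => ?_
  obtain ⟨C, hC0, hC⟩ := exists_abs_noiseQuot_le hρ h0 hM (‖p‖ + 1)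
  have hg := hasMoments_gaussWeight (d := d)
  refine continuousAt_of_dominated
    (.of_forall fun q => (integrable_noiseCorr hρ h0 hM hQ q).aestronglyMeasurable)
    (bound := fun z => C * (gaussWeight z * ‖‖z‖ • Q z‖)) ?_ ?_ (.of_forall fun z => ?_)
  · filter_upwards [Metric.ball_mem_nhds p one_pos] with q hq
    have hq' : ‖q‖ ≤ ‖p‖ + 1 := by
      rw [Metric.mem_ball, dist_eq_norm] at hq
      linarith [norm_sub_norm_le q p]
    refine .of_forall fun z => ?_
    rw [norm_smul, norm_smul, norm_mul, Real.norm_of_nonneg (gaussWeight_pos z).le, norm_norm]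
    have := mul_le_mul_of_nonneg_left (hC q hq' z)
      (mul_nonneg (gaussWeight_pos z).le (norm_nonneg (Q z)))
    rw [Real.norm_eq_abs]
    linarith
  · refine (PolyGrowth.integrable hg (PolyGrowth.smul ⟨by fun_prop, 1, 1, fun z => ?_⟩ hQ)).const_mul C
    simp
  · have := (continuous_noiseQuot hρ).comp
      (f := fun p : ℝ × EuclideanSpace ℝ (Fin d) => (p, z)) (by fun_prop)
    exact ((continuous_const.mul this).smul continuous_const).continuousAt

/-- For odd `Q` the leading term vanishes and a factor `τ` remains, which absorbs one negative power
of `τ`. -/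
lemma noiseIntegral_eq (hρ : ContDiff ℝ 1 ρ) (h0 : ∀ y, 0 ≤ ρ y) (hM : ∀ y, ρ y ≤ M)
    (hQ : PolyGrowth Q) (p : ℝ × EuclideanSpace ℝ (Fin d)) :
    noiseIntegral ρ Q p = ρ p.2 • gaussIntegral Q + p.1 • noiseCorr ρ Q p := by
  rw [gaussIntegral, noiseCorr, noiseIntegral, ← integral_smul, ← integral_smul,
    ← integral_add (f := fun z => ρ p.2 • gaussWeight z • Q z)
      (g := fun z => p.1 • (gaussWeight z * noiseQuot ρ p z) • Q z)
      ((integrable_gaussWeight_smul hQ).smul (ρ p.2))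
      ((integrable_noiseCorr hρ h0 hM hQ p).smul p.1)]
  congr with z
  rw [density_sub_smul hρ, smul_smul, smul_smul, ← add_smul]
  congr 1
  ring

lemma continuous_noiseIntegral (hρ : ContDiff ℝ 1 ρ) (h0 : ∀ y, 0 ≤ ρ y) (hM : ∀ y, ρ y ≤ M)
    (hQ : PolyGrowth Q) : Continuous (noiseIntegral ρ Q) := by
  have h1 := continuous_noiseCorr hρ h0 hM hQ
  have h2 := hρ.continuous
  rw [funext (noiseIntegral_eq hρ h0 hM hQ)]
  fun_prop

lemma noiseIntegral_one_pos (hρ : Continuous ρ) (h0 : ∀ y, 0 < ρ y) (hM : ∀ y, ρ y ≤ M)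
    (p : ℝ × EuclideanSpace ℝ (Fin d)) : 0 < noiseIntegral ρ (fun _ => (1 : ℝ)) p := by
  have hg := hasMoments_gaussWeight (d := d)
  have hpos : ∀ z, 0 < gaussWeight z * ρ (p.2 - p.1 • z) := fun z =>
    mul_pos (gaussWeight_pos z) (h0 _)
  have hint : Integrable fun z => gaussWeight z * ρ (p.2 - p.1 • z) := by
    refine (integrable_gaussWeight.mul_const M).mono' (Continuous.aestronglyMeasurable ?_)
      (.of_forall fun z => ?_)
    · have := hg.continuous
      fun_prop
    · rw [Real.norm_of_nonneg (hpos z).le]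
      exact mul_le_mul_of_nonneg_left (hM _) (gaussWeight_pos z).le
  simp only [noiseIntegral, smul_eq_mul, mul_one]
  refine (integral_pos_iff_support_of_nonneg (fun y => (hpos y).le) hint).2 ?_
  have : Function.support (fun z => gaussWeight z * ρ (p.2 - p.1 • z)) = univ := by
    ext y; simpa using ⟨(gaussWeight_pos _).ne', (h0 _).ne'⟩
  rw [this]
  exact isOpen_univ.measure_pos _ univ_nonempty

/-- Substitution `z = τ⁻¹ (x - y)`; the Jacobian does not depend on `Q` and cancels in quotients. -/
lemma posteriorIntegral_comp_sub {τ : ℝ} (hτ : τ ≠ 0) (x : EuclideanSpace ℝ (Fin d)) :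
    posteriorIntegral ρ (fun y => Q (τ⁻¹ • (x - y))) (τ⁻¹, τ⁻¹ • x) =
      |((τ⁻¹) ^ Module.finrank ℝ (EuclideanSpace ℝ (Fin d)))⁻¹| • noiseIntegral ρ Q (τ, x) := by
  rw [noiseIntegral, ← Measure.integral_comp_smul, ← integral_sub_left_eq_self _ volume x,
    posteriorIntegral]
  congr with y
  simp only [posteriorWeight, gaussWeight, ← smul_sub]
  rw [smul_smul, mul_inv_cancel₀ hτ, one_smul, sub_sub_cancel]

/-- The conditional law of `Z = (x - X₁) / τ`, seen from `X₁` and from `Z`. -/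
lemma posteriorExp_comp_sub {τ : ℝ} (hτ : τ ≠ 0) (x : EuclideanSpace ℝ (Fin d)) :
    posteriorExp ρ (fun y => Q (τ⁻¹ • (x - y))) (τ⁻¹, τ⁻¹ • x) =
      (noiseIntegral ρ (fun _ => (1 : ℝ)) (τ, x))⁻¹ • noiseIntegral ρ Q (τ, x) := by
  have hc : |((τ⁻¹) ^ Module.finrank ℝ (EuclideanSpace ℝ (Fin d)))⁻¹| ≠ 0 := by
    simp [hτ]
  rw [posteriorExp, posteriorIntegral_comp_sub hτ x,
    posteriorIntegral_comp_sub (Q := fun _ => (1 : ℝ)) hτ x, smul_smul, smul_eq_mul, mul_inv]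
  congr 1
  field_simp

end Noise

/-! ### Regularity of the conditional mean of the noise down to noise level zero -/

section NoiseMean

variable {d : ℕ} {F : Type*} [NormedAddCommGroup F] [NormedSpace ℝ F]
variable {ρ : EuclideanSpace ℝ (Fin d) → ℝ} {Q : EuclideanSpace ℝ (Fin d) → F} {M : ℝ}

lemma noiseIntegral_add {R : EuclideanSpace ℝ (Fin d) → F} (hρ : Continuous ρ)
    (h0 : ∀ y, 0 ≤ ρ y) (hM : ∀ y, ρ y ≤ M) (hQ : PolyGrowth Q) (hR : PolyGrowth R)
    (p : ℝ × EuclideanSpace ℝ (Fin d)) :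
    noiseIntegral ρ (fun z => Q z + R z) p = noiseIntegral ρ Q p + noiseIntegral ρ R p := by
  have hint : ∀ {R : EuclideanSpace ℝ (Fin d) → F}, PolyGrowth R →
      Integrable (fun z => (gaussWeight z * ρ (p.2 - p.1 • z)) • R z) := by
    intro R hR
    have hq : PolyGrowth (fun z => ρ (p.2 - p.1 • z)) :=
      (PolyGrowth.const (d := d) (1 : ℝ)).of_le (by fun_prop) (c := M)
        (fun z => by rw [Real.norm_of_nonneg (h0 _)]; simpa using hM _) ((h0 0).trans (hM 0))
    simpa only [smul_smul] using integrable_gaussWeight_smul (hq.smul hR)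
  simp only [noiseIntegral, smul_add]
  exact integral_add (hint hQ) (hint hR)

lemma noiseIntegral_const_smul (c : ℝ) (p : ℝ × EuclideanSpace ℝ (Fin d)) :
    noiseIntegral ρ (fun z => c • Q z) p = c • noiseIntegral ρ Q p := by
  simp only [noiseIntegral, smul_comm _ c]
  exact integral_smul c _

/-- The conditional expectation of `Z` given `τ Z + X₁ = x`, as a function of `p = (τ, x)`. -/
noncomputable def noiseMean (ρ : EuclideanSpace ℝ (Fin d) → ℝ)
    (p : ℝ × EuclideanSpace ℝ (Fin d)) : EuclideanSpace ℝ (Fin d) :=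
  (noiseIntegral ρ (fun _ => (1 : ℝ)) p)⁻¹ • noiseIntegral ρ (fun z => z) p

lemma noiseMean_eq_smul (hρ : ContDiff ℝ 1 ρ) (h0 : ∀ y, 0 ≤ ρ y) (hM : ∀ y, ρ y ≤ M)
    (p : ℝ × EuclideanSpace ℝ (Fin d)) : noiseMean ρ p =
      p.1 • (noiseIntegral ρ (fun _ => (1 : ℝ)) p)⁻¹ • noiseCorr ρ (fun z => z) p := by
  rw [noiseMean, noiseIntegral_eq hρ h0 hM PolyGrowth.id,
    gaussIntegral_of_odd (Q := fun z : EuclideanSpace ℝ (Fin d) => z) (fun _ => rfl),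
    smul_zero, zero_add, smul_comm]

lemma noiseMean_of_ne (hρ : HasMoments ρ) {p : ℝ × EuclideanSpace ℝ (Fin d)} (hp : p.1 ≠ 0) :
    noiseMean ρ p =
      p.1⁻¹ • (p.2 - posteriorExp ρ (fun y => y) (p.1⁻¹, p.1⁻¹ • p.2)) := by
  have h1 := posteriorExp_comp_sub (ρ := ρ) (Q := fun z => z) hp p.2
  have h2 : (fun y => p.1⁻¹ • (p.2 - y)) = fun y => p.1⁻¹ • p.2 + (-p.1⁻¹) • y := by
    ext1 y; module
  rw [noiseMean, ← h1, h2, posteriorExp_add hρ (.const _) ((PolyGrowth.const _).smul .id),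
    posteriorExp_const hρ, posteriorExp_const_smul hρ .id]
  module

/-- The derivative of `noiseMean` at `p` in the direction `v`. -/
noncomputable def noiseMeanDeriv (ρ : EuclideanSpace ℝ (Fin d) → ℝ)
    (p v : ℝ × EuclideanSpace ℝ (Fin d)) : EuclideanSpace ℝ (Fin d) :=
  v.1 • ((noiseIntegral ρ (fun _ => (1 : ℝ)) p)⁻¹ •
      (noiseCorr ρ (fun z => ‖z‖ ^ 2 • z) p - noiseCorr ρ (fun z => z) p) -
    ((noiseIntegral ρ (fun _ => (1 : ℝ)) p)⁻¹ * (noiseIntegral ρ (fun _ => (1 : ℝ)) p)⁻¹ *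
      noiseIntegral ρ (fun z => ‖z‖ ^ 2) p) • noiseCorr ρ (fun z => z) p) +
  (noiseIntegral ρ (fun _ => (1 : ℝ)) p)⁻¹ •
    (noiseCorr ρ (fun _ => (1 : ℝ)) p • v.2 - noiseCorr ρ (fun z => inner ℝ z v.2 • z) p) +
  (p.1 * (noiseIntegral ρ (fun _ => (1 : ℝ)) p)⁻¹ * (noiseIntegral ρ (fun _ => (1 : ℝ)) p)⁻¹ *
    noiseCorr ρ (fun z => inner ℝ z v.2) p) • noiseCorr ρ (fun z => z) p

lemma polyGrowth_norm_sq : PolyGrowth (fun z : EuclideanSpace ℝ (Fin d) => ‖z‖ ^ 2) := by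
  simpa only [real_inner_self_eq_norm_sq] using PolyGrowth.inner (d := d) .id .id

lemma continuous_noiseMeanDeriv (hρ : ContDiff ℝ 1 ρ) (h0 : ∀ y, 0 < ρ y) (hM : ∀ y, ρ y ≤ M)
    (v : ℝ × EuclideanSpace ℝ (Fin d)) : Continuous (fun p => noiseMeanDeriv ρ p v) := by
  have h0' := fun y => (h0 y).le
  have hA := (continuous_noiseIntegral hρ h0' hM (PolyGrowth.const (1 : ℝ))).inv₀
    fun p => (noiseIntegral_one_pos hρ.continuous h0 hM p).ne'
  have h1 := continuous_noiseCorr hρ h0' hM (polyGrowth_norm_sq.smul PolyGrowth.id)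
  have h2 := continuous_noiseCorr hρ h0' hM PolyGrowth.id
  have h3 := continuous_noiseIntegral hρ h0' hM polyGrowth_norm_sq
  have h4 := continuous_noiseCorr hρ h0' hM (PolyGrowth.const (1 : ℝ))
  have h5 := continuous_noiseCorr hρ h0' hM ((polyGrowth_inner_const v.2).smul PolyGrowth.id)
  have h6 := continuous_noiseCorr hρ h0' hM (polyGrowth_inner_const v.2)
  exact ((((hA.smul (h1.sub h2)).sub (((hA.mul hA).mul h3).smul h2)).const_smul v.1).add
    (hA.smul ((h4.smul continuous_const).sub h5))).add
    ((((continuous_fst.mul hA).mul hA).mul h6).smul h2)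

/-- The chain rule through the posterior mean produces negative powers of `τ`. Rewritten as noise
integrals, the odd Gaussian moments vanish, the second moment is a multiple of the identity, and
every such power cancels; the resulting formula is continuous through `τ = 0`. -/
lemma fderiv_noiseMean_apply_of_ne (hm : HasMoments ρ) (hρ : ContDiff ℝ 1 ρ)
    (hM : ∀ y, ρ y ≤ M) {p : ℝ × EuclideanSpace ℝ (Fin d)} (hp : p.1 ≠ 0) :
    ∃ D : ℝ × EuclideanSpace ℝ (Fin d) →L[ℝ] EuclideanSpace ℝ (Fin d),
      HasFDerivAt (noiseMean ρ) D p ∧ ∀ v, D v = noiseMeanDeriv ρ p v := by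
  have h0' := fun y => (hm.pos y).le
  have hA := noiseIntegral_one_pos hρ.continuous hm.pos hM p
  have h1 : HasFDerivAt (fun p : ℝ × EuclideanSpace ℝ (Fin d) => p.1⁻¹)
      (-(p.1 ^ 2)⁻¹ • ContinuousLinearMap.fst ℝ ℝ (EuclideanSpace ℝ (Fin d))) p :=
    (hasDerivAt_inv hp).comp_hasFDerivAt p hasFDerivAt_fst
  have h2 := h1.prodMk (h1.smul hasFDerivAt_snd)
  have h3 := ((contDiff_posteriorExp hm PolyGrowth.id).differentiable one_ne_zero
    (p.1⁻¹, p.1⁻¹ • p.2)).hasFDerivAt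
  have h4 := h1.smul (hasFDerivAt_snd.sub (h3.comp p h2))
  refine ⟨_, h4.congr_of_eventuallyEq ?_, fun v => ?_⟩
  · filter_upwards [continuous_fst.continuousAt.eventually_ne hp] with q hq
    exact noiseMean_of_ne hm hq
  have hw : PolyGrowth (fun y => p.1⁻¹ • (p.2 - y)) := by
    have := (PolyGrowth.const (p.1⁻¹ • p.2)).add
      ((PolyGrowth.const (d := d) (-p.1⁻¹)).smul PolyGrowth.id)
    convert this using 2 with y
    module
  -- The image of `v` under the derivative of `(τ, x) ↦ (τ⁻¹, τ⁻¹ x)` at `p`.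
  set v' : ℝ × EuclideanSpace ℝ (Fin d) :=
    (-(p.1 ^ 2)⁻¹ * v.1, p.1⁻¹ • v.2 + (-(p.1 ^ 2)⁻¹ * v.1) • p.2) with hv'
  set m := posteriorExp ρ (fun y => y) (p.1⁻¹, p.1⁻¹ • p.2) with hmdef
  -- The score in terms of the noise variable `w = τ⁻¹ (x - y)`.
  have hl : (fun y => posteriorLogDeriv (p.1⁻¹, p.1⁻¹ • p.2) y v') = fun y =>
      (p.1⁻¹ * v.1) • ‖p.1⁻¹ • (p.2 - y)‖ ^ 2 +
        (-p.1⁻¹) • inner ℝ (p.1⁻¹ • (p.2 - y)) v.2 := by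
    ext1 y
    have e : v'.1 • y - v'.2 = (p.1⁻¹ * v.1) • (p.1⁻¹ • (p.2 - y)) + (-p.1⁻¹) • v.2 := by
      simp only [hv']
      match_scalars <;> field_simp
    rw [posteriorLogDeriv_apply, e, ← smul_sub]
    generalize p.1⁻¹ • (p.2 - y) = w
    rw [inner_add_right, real_inner_smul_right,
      real_inner_smul_right, real_inner_self_eq_norm_sq, smul_eq_mul, smul_eq_mul]
  have hlp := polyGrowth_posteriorLogDeriv (p.1⁻¹, p.1⁻¹ • p.2) v'
  -- Substitution of `y = x - τ w` in the second factor.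
  have e1 : posteriorExp ρ (fun y => posteriorLogDeriv (p.1⁻¹, p.1⁻¹ • p.2) y v' • y)
      (p.1⁻¹, p.1⁻¹ • p.2) =
      posteriorExp ρ (fun y => posteriorLogDeriv (p.1⁻¹, p.1⁻¹ • p.2) y v')
        (p.1⁻¹, p.1⁻¹ • p.2) • p.2 + (-p.1) • posteriorExp ρ (fun y =>
        posteriorLogDeriv (p.1⁻¹, p.1⁻¹ • p.2) y v' • (p.1⁻¹ • (p.2 - y)))
          (p.1⁻¹, p.1⁻¹ • p.2) := by
    rw [← posteriorExp_const_smul hm (hlp.smul hw)]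
    have e2 := posteriorExp_clm hm hlp
      (ContinuousLinearMap.toSpanSingleton ℝ p.2) (p.1⁻¹, p.1⁻¹ • p.2)
    simp only [ContinuousLinearMap.toSpanSingleton_apply] at e2
    rw [← e2, ← posteriorExp_add hm (hlp.smul (.const _))
      ((PolyGrowth.const _).smul (hlp.smul hw))]
    congr 1
    ext1 y
    match_scalars <;> field_simp
    ring
  have e3 : posteriorExp ρ (fun y => posteriorLogDeriv (p.1⁻¹, p.1⁻¹ • p.2) y v')
      (p.1⁻¹, p.1⁻¹ • p.2) = (noiseIntegral ρ (fun _ => (1 : ℝ)) p)⁻¹ *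
      (p.1⁻¹ * v.1 * noiseIntegral ρ (fun z => ‖z‖ ^ 2) p +
        (-p.1⁻¹) * (p.1 * noiseCorr ρ (fun z => inner ℝ z v.2) p)) := by
    rw [hl, posteriorExp_comp_sub (Q := fun z => (p.1⁻¹ * v.1) • ‖z‖ ^ 2 +
      (-p.1⁻¹) • inner ℝ z v.2) hp p.2,
      noiseIntegral_add hρ.continuous h0' hM ((PolyGrowth.const _).smul polyGrowth_norm_sq)
        ((PolyGrowth.const _).smul (polyGrowth_inner_const _)),
      noiseIntegral_const_smul, noiseIntegral_const_smul,
      noiseIntegral_eq hρ h0' hM (polyGrowth_inner_const v.2),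
      gaussIntegral_of_odd (Q := fun z => inner ℝ z v.2) (fun z => inner_neg_left _ _)]
    simp
  have e4 : posteriorExp ρ (fun y =>
        posteriorLogDeriv (p.1⁻¹, p.1⁻¹ • p.2) y v' • (p.1⁻¹ • (p.2 - y)))
          (p.1⁻¹, p.1⁻¹ • p.2) = (noiseIntegral ρ (fun _ => (1 : ℝ)) p)⁻¹ •
      ((p.1⁻¹ * v.1) • (p.1 • noiseCorr ρ (fun z => ‖z‖ ^ 2 • z) p) +
        (-p.1⁻¹) • ((ρ p.2 * gaussNorm d) • v.2 +
          p.1 • noiseCorr ρ (fun z => inner ℝ z v.2 • z) p)) := by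
    have hl' : (fun y => posteriorLogDeriv (p.1⁻¹, p.1⁻¹ • p.2) y v' • (p.1⁻¹ • (p.2 - y))) =
        fun y => (p.1⁻¹ * v.1) • (‖p.1⁻¹ • (p.2 - y)‖ ^ 2 • (p.1⁻¹ • (p.2 - y))) +
        (-p.1⁻¹) • (inner ℝ (p.1⁻¹ • (p.2 - y)) v.2 • (p.1⁻¹ • (p.2 - y))) := by
      ext1 y
      rw [congrFun hl y, add_smul, smul_assoc, smul_assoc]
    rw [hl', posteriorExp_comp_sub (Q := fun z => (p.1⁻¹ * v.1) • (‖z‖ ^ 2 • z) +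
      (-p.1⁻¹) • (inner ℝ z v.2 • z)) hp p.2,
      noiseIntegral_add hρ.continuous h0' hM
        ((PolyGrowth.const _).smul (polyGrowth_norm_sq.smul .id))
        ((PolyGrowth.const _).smul ((polyGrowth_inner_const _).smul .id)),
      noiseIntegral_const_smul, noiseIntegral_const_smul,
      noiseIntegral_eq hρ h0' hM ((polyGrowth_inner_const v.2).smul .id),
      noiseIntegral_eq hρ h0' hM (polyGrowth_norm_sq.smul .id),
      gaussIntegral_of_odd (Q := fun z : EuclideanSpace ℝ (Fin d) => ‖z‖ ^ 2 • z)
        (fun z => by simp), gaussIntegral_inner_smul]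
    simp [smul_smul]
  have hn := noiseMean_of_ne hm hp
  rw [noiseMean_eq_smul hρ h0' hM p, ← hmdef] at hn
  have hmeq : m = p.2 - p.1 • (p.1 • (noiseIntegral ρ (fun _ => (1 : ℝ)) p)⁻¹ •
      noiseCorr ρ (fun z => z) p) := by
    rw [hn, smul_smul, mul_inv_cancel₀ hp, one_smul, sub_sub_cancel]
  -- Up to a term of order `τ`, the Gaussian second moment contributes the normalisation itself. The
  -- leading part of the derivative of the posterior mean is then `v.2`, which cancels the `v.2`
  -- from `x` and removes a factor `τ⁻¹`.
  have hk : ρ p.2 * gaussNorm d = noiseIntegral ρ (fun _ => (1 : ℝ)) p -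
      p.1 * noiseCorr ρ (fun _ => (1 : ℝ)) p := by
    rw [noiseIntegral_eq hρ h0' hM (PolyGrowth.const (1 : ℝ)), gaussIntegral_one]
    simp
  have h5 := fderiv_posteriorExp_apply hm PolyGrowth.id (p.1⁻¹, p.1⁻¹ • p.2) v'
  rw [e1, e3, e4, ← hmdef, hk, hmeq] at h5
  have h6 : (p.1⁻¹ • (ContinuousLinearMap.snd ℝ ℝ (EuclideanSpace ℝ (Fin d)) -
      (fderiv ℝ (posteriorExp ρ fun y => y) (p.1⁻¹, p.1⁻¹ • p.2)).comp
        ((-(p.1 ^ 2)⁻¹ • ContinuousLinearMap.fst ℝ ℝ (EuclideanSpace ℝ (Fin d))).prod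
          (p.1⁻¹ • ContinuousLinearMap.snd ℝ ℝ (EuclideanSpace ℝ (Fin d)) +
            (-(p.1 ^ 2)⁻¹ • ContinuousLinearMap.fst ℝ ℝ
              (EuclideanSpace ℝ (Fin d))).smulRight p.2))) +
      (-(p.1 ^ 2)⁻¹ • ContinuousLinearMap.fst ℝ ℝ (EuclideanSpace ℝ (Fin d))).smulRight
        (p.2 - m)) v =
      p.1⁻¹ • (v.2 - fderiv ℝ (posteriorExp ρ fun y => y) (p.1⁻¹, p.1⁻¹ • p.2) v') +
        (-(p.1 ^ 2)⁻¹ * v.1) • (p.2 - m) := by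
    simp [hv']
  refine h6.trans ?_
  rw [h5, hmeq, noiseMeanDeriv]
  have hA' := hA.ne'
  generalize noiseIntegral ρ (fun _ => (1 : ℝ)) p = A at *
  match_scalars <;> field_simp <;> ring

/-- By `noiseMean_eq_smul` the function is `τ` times a continuous function `c`, hence differentiable
at `(0, x)` with derivative `c (0, x) dτ`. -/
lemma hasFDerivAt_noiseMean_zero (hρ : ContDiff ℝ 1 ρ) (h0 : ∀ y, 0 < ρ y)
    (hM : ∀ y, ρ y ≤ M) (x : EuclideanSpace ℝ (Fin d)) :
    HasFDerivAt (noiseMean ρ) ((ContinuousLinearMap.fst ℝ ℝ (EuclideanSpace ℝ (Fin d))).smulRight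
      ((noiseIntegral ρ (fun _ => (1 : ℝ)) (0, x))⁻¹ • noiseCorr ρ (fun z => z) (0, x)))
      (0, x) := by
  have h0' := fun y => (h0 y).le
  have hA := (continuous_noiseIntegral hρ h0' hM (PolyGrowth.const (1 : ℝ))).inv₀
    fun p => (noiseIntegral_one_pos hρ.continuous h0 hM p).ne'
  have hc := hA.smul (continuous_noiseCorr hρ h0' hM PolyGrowth.id)
  rw [hasFDerivAt_iff_isLittleO]
  have h1 : (fun q : ℝ × EuclideanSpace ℝ (Fin d) => noiseMean ρ q - noiseMean ρ (0, x) -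
      (ContinuousLinearMap.fst ℝ ℝ (EuclideanSpace ℝ (Fin d))).smulRight
      ((noiseIntegral ρ (fun _ => (1 : ℝ)) (0, x))⁻¹ • noiseCorr ρ (fun z => z) (0, x))
      (q - (0, x))) = fun q => q.1 • ((noiseIntegral ρ (fun _ => (1 : ℝ)) q)⁻¹ •
        noiseCorr ρ (fun z => z) q -
      (noiseIntegral ρ (fun _ => (1 : ℝ)) (0, x))⁻¹ • noiseCorr ρ (fun z => z) (0, x)) := by
    ext1 q
    rw [noiseMean_eq_smul hρ h0' hM, noiseMean_eq_smul hρ h0' hM]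
    simp [smul_sub]
  rw [h1]
  have h2 : (fun q : ℝ × EuclideanSpace ℝ (Fin d) => q.1) =O[nhds (0, x)]
      (fun q => ‖q - (0, x)‖) := by
    refine Asymptotics.IsBigO.of_bound 1 (.of_forall fun q => ?_)
    have := norm_fst_le (q - (0, x))
    simpa using this
  have h3 : (fun q : ℝ × EuclideanSpace ℝ (Fin d) => (noiseIntegral ρ (fun _ => (1 : ℝ)) q)⁻¹ •
        noiseCorr ρ (fun z => z) q - (noiseIntegral ρ (fun _ => (1 : ℝ)) (0, x))⁻¹ •
          noiseCorr ρ (fun z => z) (0, x)) =o[nhds (0, x)] (fun _ => (1 : ℝ)) := by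
    rw [Asymptotics.isLittleO_one_iff]
    exact tendsto_sub_nhds_zero_iff.2 (hc.tendsto (0, x))
  have h4 := h2.smul_isLittleO h3
  simp only [smul_eq_mul, mul_one] at h4
  exact Asymptotics.isLittleO_norm_right.1 h4

/-- At `τ = 0` the difference quotient is `-∇ρ(x) · z`, which is odd in `z`. -/
lemma noiseCorr_zero_of_even (hQ : ∀ z, Q (-z) = Q z) (x : EuclideanSpace ℝ (Fin d)) :
    noiseCorr ρ Q (0, x) = 0 := by
  have h1 := gaussIntegral_of_odd (Q := fun z => noiseQuot ρ (0, x) z • Q z) fun z => by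
    simp [hQ, noiseQuot]
  rw [gaussIntegral] at h1
  simpa only [noiseCorr, mul_smul] using h1

/-- The conditional expectation of the noise is `C¹` jointly in the noise level and the
position, down to noise level zero. -/
lemma contDiff_noiseMean (hm : HasMoments ρ) (hρ : ContDiff ℝ 1 ρ) (hM : ∀ y, ρ y ≤ M) :
    ContDiff ℝ 1 (noiseMean ρ) := by
  have h0' := fun y => (hm.pos y).le
  have key : ∀ p, ∃ D : ℝ × EuclideanSpace ℝ (Fin d) →L[ℝ] EuclideanSpace ℝ (Fin d),
      HasFDerivAt (noiseMean ρ) D p ∧ ∀ v, D v = noiseMeanDeriv ρ p v := by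
    rintro ⟨τ, x⟩
    by_cases hp : τ = 0
    swap
    · exact fderiv_noiseMean_apply_of_ne hm hρ hM hp
    subst hp
    refine ⟨_, hasFDerivAt_noiseMean_zero hρ hm.pos hM x, fun v => ?_⟩
    have hline : ∀ τ : ℝ, HasDerivAt (fun τ : ℝ => (τ, x)) (1, 0) τ := fun τ =>
      (hasDerivAt_id τ).prodMk (hasDerivAt_const τ x)
    have h1 : HasDerivAt (fun τ : ℝ => noiseMean ρ (τ, x)) _ 0 :=
      HasFDerivAt.comp_hasDerivAt (l := noiseMean ρ) (f := fun τ : ℝ => (τ, x)) 0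
        (hasFDerivAt_noiseMean_zero hρ hm.pos hM x) (hline 0)
    -- The `τ`-derivative at zero is also the limit of the derivatives for `τ ≠ 0`. This identifies
    -- it with the formula without evaluating the Gaussian integrals; the terms in `v.2` vanish by
    -- parity.
    have h2 : HasDerivAt (fun τ : ℝ => noiseMean ρ (τ, x)) (noiseMeanDeriv ρ (0, x) (1, 0)) 0 := by
      refine hasDerivAt_of_hasDerivAt_of_ne (g := fun τ => noiseMeanDeriv ρ (τ, x) (1, 0))
        (fun τ hτ => ?_) h1.continuousAt ?_
      · obtain ⟨D, hD, hDv⟩ := fderiv_noiseMean_apply_of_ne hm hρ hM (p := (τ, x)) hτ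
        rw [← hDv]
        exact hD.comp_hasDerivAt τ (hline τ)
      · exact ((continuous_noiseMeanDeriv hρ hm.pos hM (1, 0)).comp
          (f := fun τ : ℝ => (τ, x)) (by fun_prop)).continuousAt
    have h3 := h1.unique h2
    have e1 := noiseCorr_zero_of_even (ρ := ρ) (Q := fun _ => (1 : ℝ)) (fun _ => rfl) x
    have e2 : ∀ h, noiseCorr ρ (fun z => inner ℝ z h • z) (0, x) = 0 := fun h =>
      noiseCorr_zero_of_even (by simp) x
    simp only [noiseMeanDeriv, e1, e2, zero_smul, sub_zero, smul_zero, add_zero, zero_mul,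
      one_smul, ContinuousLinearMap.smulRight_apply, ContinuousLinearMap.coe_fst'] at h3 ⊢
    rw [h3]
  choose D hD hDv using key
  rw [contDiff_one_iff_fderiv]
  refine ⟨fun p => (hD p).differentiableAt, ?_⟩
  rw [continuous_clm_apply]
  intro v
  simp only [fun p => (hD p).fderiv, hDv]
  exact continuous_noiseMeanDeriv hρ hm.pos hM v

end NoiseMean

/-! ### One-sided Lipschitz bounds and norms of symmetric operators -/

section OneSided

variable {E : Type*} [NormedAddCommGroup E] [InnerProductSpace ℝ E]

lemma inner_sub_le_of_fderiv_le {F : E → E} {l : ℝ} (hF : Differentiable ℝ F)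
    (hl : ∀ x h, inner ℝ (fderiv ℝ F x h) h ≤ l * ‖h‖ ^ 2) (x y : E) :
    inner ℝ (F x - F y) (x - y) ≤ l * ‖x - y‖ ^ 2 := by
  have h1 : ∀ t : ℝ, HasDerivAt (fun t : ℝ => inner ℝ (F (y + t • (x - y))) (x - y))
      (inner ℝ (fderiv ℝ F (y + t • (x - y)) (x - y)) (x - y)) t := fun t => by
    have h2 : HasDerivAt (fun t : ℝ => y + t • (x - y)) (x - y) t := by
      simpa using ((hasDerivAt_id t).smul_const (x - y)).const_add y
    have h3 := ((hF (y + t • (x - y))).hasFDerivAt.comp_hasDerivAt t h2).inner ℝ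
      (hasDerivAt_const t (x - y))
    simpa using h3
  have h4 := image_sub_le_mul_sub_of_deriv_le (fun t => (h1 t).differentiableAt)
    (fun t => (h1 t).deriv.le.trans (hl _ _)) (zero_le_one : (0 : ℝ) ≤ 1)
  simp only [one_smul, zero_smul, add_zero, add_sub_cancel, sub_zero, mul_one] at h4
  rw [inner_sub_left]
  exact h4

lemma norm_le_of_abs_inner_self_le {T : E →L[ℝ] E} (hT : T.IsSymmetric) {C : ℝ} (hC : 0 ≤ C)
    (h : ∀ x, |inner ℝ (T x) x| ≤ C * ‖x‖ ^ 2) : ‖T‖ ≤ C := by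
  rw [ContinuousLinearMap.norm_eq_iSup_rayleighQuotient T hT]
  refine ciSup_le fun x => ?_
  rw [ContinuousLinearMap.rayleighQuotient, abs_div, abs_of_nonneg (sq_nonneg ‖x‖)]
  exact div_le_of_le_mul₀ (sq_nonneg _) hC (h x)

end OneSided

/-! ### The drift of the trigonometric interpolant -/

section AngularField

variable {d : ℕ} {ρ V : EuclideanSpace ℝ (Fin d) → ℝ} {κ M : ℝ}

/-- The drift of the trigonometric interpolant `cos θ X₀ + sin θ X₁`, where `X₁` has
density `ρ`. -/
noncomputable def angularField (ρ : EuclideanSpace ℝ (Fin d) → ℝ) (θ : ℝ)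
    (x : EuclideanSpace ℝ (Fin d)) : EuclideanSpace ℝ (Fin d) :=
  -(Real.tan θ • x) +
    (Real.cos θ)⁻¹ • posteriorExp ρ (fun y => y) (Real.tan θ, (Real.cos θ)⁻¹ • x)

/-- The conventions for division by zero give the right value at `θ = π/2`: there the drift is
`E[-X₀ | X₁] = 0`. -/
lemma angularField_of_cos_eq_zero {θ : ℝ} (hc : Real.cos θ = 0)
    (x : EuclideanSpace ℝ (Fin d)) : angularField ρ θ x = 0 := by
  simp [angularField, Real.tan_eq_sin_div_cos, hc]

/-- From `x = cos θ X₀ + sin θ X₁` one has `-sin θ X₀ + cos θ X₁ = cot θ x - X₀ / sin θ`, and `x /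
sin θ` is `X₁` observed with noise level `cot θ`. -/
lemma angularField_of_sin_ne_zero (hm : HasMoments ρ) (hρ : ContDiff ℝ 1 ρ) (hM : ∀ y, ρ y ≤ M)
    {θ : ℝ} (hs : Real.sin θ ≠ 0) (x : EuclideanSpace ℝ (Fin d)) :
    angularField ρ θ x = (Real.cos θ / Real.sin θ) • x -
      (Real.sin θ)⁻¹ • noiseMean ρ (Real.cos θ / Real.sin θ, (Real.sin θ)⁻¹ • x) := by
  by_cases hc : Real.cos θ = 0
  · rw [angularField_of_cos_eq_zero hc, noiseMean_eq_smul hρ (fun y => (hm.pos y).le) hM]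
    simp [hc]
  · rw [noiseMean_of_ne hm (by simp [hc, hs]), angularField, Real.tan_eq_sin_div_cos]
    simp only [inv_div, smul_smul]
    have e : Real.sin θ / Real.cos θ * (Real.sin θ)⁻¹ = (Real.cos θ)⁻¹ := by field_simp
    rw [e]
    have h1 := Real.sin_sq_add_cos_sq θ
    have e2 : Real.cos θ / Real.sin θ =
        -(Real.sin θ / Real.cos θ) + (Real.cos θ)⁻¹ * (Real.sin θ)⁻¹ := by
      field_simp
      linarith
    rw [e2]
    match_scalars <;> field_simp
    ring

/-- Two charts: the posterior mean with `σ = tan θ` where `sin θ = 0`, and the noise mean with `τ =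
cot θ` elsewhere, including `θ = π/2`. -/
lemma contDiff_angularField (hm : HasMoments ρ) (hρ : ContDiff ℝ 1 ρ) (hM : ∀ y, ρ y ≤ M) :
    ContDiff ℝ 1 (fun p : ℝ × EuclideanSpace ℝ (Fin d) => angularField ρ p.1 p.2) := by
  rw [contDiff_iff_contDiffAt]
  intro p
  have hcos : ContDiffAt ℝ 1 (fun p : ℝ × EuclideanSpace ℝ (Fin d) => Real.cos p.1) p := by
    fun_prop
  have hsin : ContDiffAt ℝ 1 (fun p : ℝ × EuclideanSpace ℝ (Fin d) => Real.sin p.1) p := by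
    fun_prop
  by_cases hs : Real.sin p.1 = 0
  · have hc : Real.cos p.1 ≠ 0 := fun hc => by
      have := Real.sin_sq_add_cos_sq p.1
      simp [hs, hc] at this
    have hci := hcos.inv hc
    have htan : ContDiffAt ℝ 1 (fun p : ℝ × EuclideanSpace ℝ (Fin d) => Real.tan p.1) p := by
      simp only [Real.tan_eq_sin_div_cos]
      exact hsin.div hcos hc
    unfold angularField
    exact (htan.smul contDiffAt_snd).neg.add (hci.smul
      ((contDiff_posteriorExp hm PolyGrowth.id).contDiffAt.comp p
        (htan.prodMk (hci.smul contDiffAt_snd))))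
  · have hsi := hsin.inv hs
    have hdiv := hcos.div hsin hs
    refine ContDiffAt.congr_of_eventuallyEq ((hdiv.smul contDiffAt_snd).sub (hsi.smul
      ((contDiff_noiseMean hm hρ hM).contDiffAt.comp p
        (hdiv.prodMk (hsi.smul contDiffAt_snd))))) ?_
    have hcont : Continuous fun p : ℝ × EuclideanSpace ℝ (Fin d) => Real.sin p.1 := by fun_prop
    filter_upwards [hcont.continuousAt.eventually_ne hs] with q hq
    exact angularField_of_sin_ne_zero hm hρ hM hq q.2

lemma fderiv_angularField_of_cos_eq_zero {θ : ℝ} (hc : Real.cos θ = 0)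
    (x : EuclideanSpace ℝ (Fin d)) : fderiv ℝ (angularField ρ θ) x = 0 := by
  rw [funext (angularField_of_cos_eq_zero hc)]
  simp

lemma fderiv_angularField_apply (hm : HasMoments ρ) (θ : ℝ) (x h : EuclideanSpace ℝ (Fin d)) :
    fderiv ℝ (angularField ρ θ) x h = -(Real.tan θ • h) + ((Real.cos θ)⁻¹ ^ 2 * Real.tan θ) •
      posteriorCov ρ (Real.tan θ, (Real.cos θ)⁻¹ • x) h := by
  have h1 := ((contDiff_posteriorExp hm PolyGrowth.id).differentiable one_ne_zero
    (Real.tan θ, (Real.cos θ)⁻¹ • x)).hasFDerivAt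
  have h2 : HasFDerivAt (fun x : EuclideanSpace ℝ (Fin d) => (Real.tan θ, (Real.cos θ)⁻¹ • x))
      ((0 : EuclideanSpace ℝ (Fin d) →L[ℝ] ℝ).prod
        ((Real.cos θ)⁻¹ • ContinuousLinearMap.id ℝ (EuclideanSpace ℝ (Fin d)))) x :=
    (hasFDerivAt_const _ _).prodMk ((hasFDerivAt_id x).const_smul (Real.cos θ)⁻¹)
  have h3 : HasFDerivAt (angularField ρ θ) _ x :=
    ((hasFDerivAt_id x).const_smul (Real.tan θ)).neg.add
      ((h1.comp x h2).const_smul (Real.cos θ)⁻¹)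
  rw [h3.fderiv]
  have h4 := fderiv_posteriorExp_inr hm (Real.tan θ) ((Real.cos θ)⁻¹ • x) ((Real.cos θ)⁻¹ • h)
  have h5 : posteriorCov ρ (Real.tan θ, (Real.cos θ)⁻¹ • x) ((Real.cos θ)⁻¹ • h) =
      (Real.cos θ)⁻¹ • posteriorCov ρ (Real.tan θ, (Real.cos θ)⁻¹ • x) h := by
    refine ext_inner_right ℝ fun g => ?_
    rw [inner_posteriorCov_comm hm, real_inner_smul_left, ← inner_posteriorCov_comm hm,
      real_inner_smul_left]
  simp only [add_apply, neg_apply,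
    smul_apply, ContinuousLinearMap.comp_apply,
    ContinuousLinearMap.prod_apply, zero_apply, ContinuousLinearMap.id_apply]
  rw [h4, h5]
  module

lemma isSymmetric_fderiv_angularField (hm : HasMoments ρ) (θ : ℝ)
    (x : EuclideanSpace ℝ (Fin d)) : (fderiv ℝ (angularField ρ θ) x).IsSymmetric := by
  intro g h
  change inner ℝ (fderiv ℝ (angularField ρ θ) x g) h = inner ℝ g (fderiv ℝ (angularField ρ θ) x h)
  rw [fderiv_angularField_apply hm, fderiv_angularField_apply hm]
  simp only [inner_add_left, inner_add_right, inner_neg_left, inner_neg_right,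
    real_inner_smul_left, real_inner_smul_right, inner_posteriorCov_comm hm]

lemma cos_nonneg_sin_nonneg {θ : ℝ} (hθ : θ ∈ Icc 0 (Real.pi / 2)) :
    0 ≤ Real.cos θ ∧ 0 ≤ Real.sin θ :=
  ⟨Real.cos_nonneg_of_neg_pi_div_two_le_of_le (by linarith [hθ.1, Real.pi_pos]) hθ.2,
    Real.sin_nonneg_of_nonneg_of_le_pi hθ.1 (by linarith [hθ.2, Real.pi_pos])⟩

/-- Brascamp–Lieb with `σ = tan θ`. The constant is `q' / (2 q)` for `q = κ cos² θ + sin² θ`. The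
endpoints are separate: the field vanishes where `cos θ = 0`, and the covariance has coefficient
zero where `sin θ = 0`. -/
lemma inner_fderiv_angularField_le (hV : ConvexOn ℝ univ (fun x => V x - κ / 2 * ‖x‖ ^ 2))
    (hκ : 0 ≤ κ) (hm : HasMoments (fun y => Real.exp (-V y))) {θ : ℝ}
    (hθ : θ ∈ Icc 0 (Real.pi / 2)) (x h : EuclideanSpace ℝ (Fin d)) :
    inner ℝ (fderiv ℝ (angularField (fun y => Real.exp (-V y)) θ) x h) h ≤
      (Real.sin θ * Real.cos θ * (1 - κ) / (κ * Real.cos θ ^ 2 + Real.sin θ ^ 2)) * ‖h‖ ^ 2 := by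
  obtain ⟨hc0, hs0⟩ := cos_nonneg_sin_nonneg hθ
  rcases hc0.eq_or_lt with hc | hc
  · rw [fderiv_angularField_of_cos_eq_zero hc.symm, ← hc]
    simp
  rw [fderiv_angularField_apply hm, inner_add_left, inner_neg_left, real_inner_smul_left,
    real_inner_smul_left, real_inner_self_eq_norm_sq]
  rcases hs0.eq_or_lt with hs | hs
  · simp [Real.tan_eq_sin_div_cos, ← hs]
  have ht : 0 < Real.tan θ := by rw [Real.tan_eq_sin_div_cos]; positivity
  have h1 := inner_posteriorCov_self_le hV hm ht.ne' (by positivity) ((Real.cos θ)⁻¹ • x) h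
  have h2 := mul_le_mul_of_nonneg_left h1
    (show 0 ≤ (Real.cos θ)⁻¹ ^ 2 * Real.tan θ by positivity)
  have h3 : (Real.cos θ)⁻¹ ^ 2 * Real.tan θ * (‖h‖ ^ 2 / (κ + Real.tan θ ^ 2)) =
      (Real.sin θ * Real.cos θ * (1 - κ) / (κ * Real.cos θ ^ 2 + Real.sin θ ^ 2)) * ‖h‖ ^ 2 +
        Real.tan θ * ‖h‖ ^ 2 := by
    have h4 := Real.sin_sq_add_cos_sq θ
    have h5 : κ * Real.cos θ ^ 2 + Real.sin θ ^ 2 ≠ 0 := by positivity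
    have h6 : (1 : ℝ) = Real.sin θ ^ 2 + Real.cos θ ^ 2 := h4.symm
    have h7 : (Real.cos θ)⁻¹ ^ 2 * Real.tan θ / (κ + Real.tan θ ^ 2) =
        Real.sin θ / Real.cos θ / (κ * Real.cos θ ^ 2 + Real.sin θ ^ 2) := by
      rw [Real.tan_eq_sin_div_cos]
      field_simp
    calc _ = ((Real.cos θ)⁻¹ ^ 2 * Real.tan θ / (κ + Real.tan θ ^ 2)) * ‖h‖ ^ 2 := by ring
      _ = _ := by
        rw [h7, Real.tan_eq_sin_div_cos]
        field_simp
        nlinarith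
  linarith

lemma le_inner_fderiv_angularField (hm : HasMoments ρ) {θ : ℝ}
    (hθ : θ ∈ Icc 0 (Real.pi / 2)) (x h : EuclideanSpace ℝ (Fin d)) :
    -Real.tan θ * ‖h‖ ^ 2 ≤ inner ℝ (fderiv ℝ (angularField ρ θ) x h) h := by
  obtain ⟨hc0, hs0⟩ := cos_nonneg_sin_nonneg hθ
  have ht : 0 ≤ Real.tan θ := by rw [Real.tan_eq_sin_div_cos]; positivity
  rw [fderiv_angularField_apply hm, inner_add_left, inner_neg_left, real_inner_smul_left,
    real_inner_smul_left, real_inner_self_eq_norm_sq]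
  have := mul_nonneg (show 0 ≤ (Real.cos θ)⁻¹ ^ 2 * Real.tan θ by positivity)
    (inner_posteriorCov_self_nonneg hm (Real.tan θ, (Real.cos θ)⁻¹ • x) h)
  linarith

lemma exists_norm_fderiv_angularField_le
    (hV : ConvexOn ℝ univ (fun x => V x - κ / 2 * ‖x‖ ^ 2))
    (hκ : 0 ≤ κ) (hm : HasMoments (fun y => Real.exp (-V y))) {θ : ℝ}
    (hθ : θ ∈ Icc 0 (Real.pi / 2)) :
    ∃ C : ℝ, ∀ x, ‖fderiv ℝ (angularField (fun y => Real.exp (-V y)) θ) x‖ ≤ C := by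
  set l := Real.sin θ * Real.cos θ * (1 - κ) / (κ * Real.cos θ ^ 2 + Real.sin θ ^ 2) with hl
  refine ⟨|l| + |Real.tan θ|, fun x => norm_le_of_abs_inner_self_le
    (isSymmetric_fderiv_angularField hm θ x) (by positivity) fun h => ?_⟩
  have h1 := inner_fderiv_angularField_le hV hκ hm hθ x h
  have h2 := le_inner_fderiv_angularField hm hθ x h
  rw [← hl] at h1
  rw [abs_le]
  constructor <;> nlinarith [le_abs_self l, le_abs_self (Real.tan θ), abs_nonneg l,
    abs_nonneg (Real.tan θ), sq_nonneg ‖h‖]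

lemma inner_angularField_growth (hV : ConvexOn ℝ univ (fun x => V x - κ / 2 * ‖x‖ ^ 2))
    (hκ : 0 ≤ κ) (hm : HasMoments (fun y => Real.exp (-V y)))
    (hW : ContDiff ℝ 1 (fun p : ℝ × EuclideanSpace ℝ (Fin d) =>
      angularField (fun y => Real.exp (-V y)) p.1 p.2)) {δ : ℝ} (hδ : 0 < δ) :
    ∃ C : ℝ, ∀ θ ∈ Icc δ (Real.pi / 2), ∀ x,
      inner ℝ (angularField (fun y => Real.exp (-V y)) θ x) x ≤ C * (1 + ‖x‖ ^ 2) := by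
  set W := angularField (fun y => Real.exp (-V y)) with hWdef
  obtain ⟨B, hB⟩ := (isCompact_Icc (a := δ) (b := Real.pi / 2)).exists_bound_of_continuousOn
    (f := fun θ => W θ 0) (hW.continuous.comp (f := fun θ : ℝ => (θ, (0 :
      EuclideanSpace ℝ (Fin d)))) (by fun_prop)).continuousOn
  refine ⟨(Real.sin δ)⁻¹ + |B|, fun θ hθ x => ?_⟩
  have hθ' : θ ∈ Icc 0 (Real.pi / 2) := ⟨hδ.le.trans hθ.1, hθ.2⟩
  obtain ⟨hc0, -⟩ := cos_nonneg_sin_nonneg hθ'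
  have hsδ : 0 < Real.sin δ := Real.sin_pos_of_pos_of_lt_pi hδ
    (by linarith [hθ.1, hθ.2, Real.pi_pos])
  have hss : Real.sin δ ≤ Real.sin θ := Real.sin_le_sin_of_le_of_le_pi_div_two
    (by linarith [Real.pi_pos]) hθ.2 hθ.1
  have hs : 0 < Real.sin θ := hsδ.trans_le hss
  -- For `κ = 0` the left side is `cot θ`, so no bound uniform down to `θ = 0` is available; this is
  -- why `δ` appears.
  have hl : Real.sin θ * Real.cos θ * (1 - κ) / (κ * Real.cos θ ^ 2 + Real.sin θ ^ 2) ≤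
      (Real.sin δ)⁻¹ := by
    refine le_trans ?_ (inv_anti₀ hsδ hss)
    rw [div_le_iff₀ (by positivity), inv_mul_eq_div, le_div_iff₀ hs]
    have h1 := Real.cos_le_one θ
    have h2 : 0 ≤ Real.sin θ ^ 2 * Real.cos θ * κ := by positivity
    have h3 : Real.sin θ ^ 2 * Real.cos θ ≤ Real.sin θ ^ 2 * 1 := by gcongr
    have h4 : 0 ≤ κ * Real.cos θ ^ 2 := by positivity
    nlinarith
  have h1 := inner_sub_le_of_fderiv_le
    (fun x => (hasFDerivAt_slice hW θ x).differentiableAt)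
    (fun x h => inner_fderiv_angularField_le hV hκ hm hθ' x h) x 0
  rw [sub_zero, inner_sub_left] at h1
  have h2 : inner ℝ (W θ 0) x ≤ |B| * ‖x‖ := (real_inner_le_norm _ _).trans
    (by gcongr; exact (hB θ hθ).trans (le_abs_self B))
  have h3 := mul_le_mul_of_nonneg_right hl (sq_nonneg ‖x‖)
  have h4 : 0 ≤ (Real.sin δ)⁻¹ := by positivity
  have h5 : |B| * ‖x‖ ≤ |B| * (1 + ‖x‖ ^ 2) := by
    gcongr
    nlinarith [sq_nonneg (‖x‖ - 1)]
  nlinarith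

end AngularField

/-! ### Conditional expectations of linear combinations -/

section ConditionalExpectation

variable {d : ℕ} {Ω : Type*} [MeasurableSpace Ω] {P : Measure Ω} [IsProbabilityMeasure P]
  {X₀ X₁ : Ω → EuclideanSpace ℝ (Fin d)} {ρ : EuclideanSpace ℝ (Fin d) → ℝ}

lemma measurePreserving_shear (σ : ℝ) : MeasurePreserving
    (fun q : EuclideanSpace ℝ (Fin d) × EuclideanSpace ℝ (Fin d) => (q.1, q.2 + σ • q.1))
    (volume.prod volume) (volume.prod volume) :=
  (MeasurePreserving.id volume).skew_product (g := fun y z => z + σ • y)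
    (by simp only [Function.uncurry_def]; fun_prop)
    (.of_forall fun y => (measurePreserving_add_right volume (σ • y)).map_eq)

lemma continuous_posteriorWeight_swap (hm : HasMoments ρ) (σ : ℝ) :
    Continuous (fun q : EuclideanSpace ℝ (Fin d) × EuclideanSpace ℝ (Fin d) =>
      posteriorWeight ρ (σ, q.2) q.1) :=
  (continuous_posteriorWeight hm).comp
    (f := fun q : EuclideanSpace ℝ (Fin d) × EuclideanSpace ℝ (Fin d) => ((σ, q.2), q.1))
    (by fun_prop)

lemma measurable_noisy_density (hm : HasMoments ρ) (σ : ℝ) :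
    Measurable (fun q : EuclideanSpace ℝ (Fin d) × EuclideanSpace ℝ (Fin d) =>
      ENNReal.ofReal ((gaussNorm d)⁻¹ * posteriorWeight ρ (σ, q.2) q.1)) :=
  ((continuous_posteriorWeight_swap hm σ).measurable.const_mul _).ennreal_ofReal

/-- The joint law of `X₁` and `X₀ + σ X₁`. -/
lemma map_prodMk_noisy (hX₀ : Measurable X₀) (hX₁ : Measurable X₁)
    (hlaw₀ : P.map X₀ = stdGaussian (EuclideanSpace ℝ (Fin d)))
    (hlaw₁ : P.map X₁ = volume.withDensity (fun y => ENNReal.ofReal (ρ y)))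
    (hindep : IndepFun X₀ X₁ P) (hm : HasMoments ρ) (σ : ℝ) :
    P.map (fun ω => (X₁ ω, X₀ ω + σ • X₁ ω)) =
      (volume.prod volume).withDensity (fun q =>
        ENNReal.ofReal ((gaussNorm d)⁻¹ * posteriorWeight ρ (σ, q.2) q.1)) := by
  have hρ := hm.continuous
  have hg := (hasMoments_gaussWeight (d := d)).continuous
  have hwm := measurable_noisy_density hm σ
  have h1 := (indepFun_iff_map_prod_eq_prod_map_map hX₁.aemeasurable hX₀.aemeasurable).1 hindep.symm
  rw [hlaw₀, hlaw₁, stdGaussian_eq_withDensity,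
    prod_withDensity (by fun_prop) (by fun_prop)] at h1
  have h2 : P.map (fun ω => (X₁ ω, X₀ ω + σ • X₁ ω)) =
      (P.map fun ω => (X₁ ω, X₀ ω)).map (fun q => (q.1, q.2 + σ • q.1)) := by
    rw [Measure.map_map (by fun_prop) (by fun_prop)]
    rfl
  rw [h2, h1]
  ext s hs
  rw [Measure.map_apply (by fun_prop) hs, withDensity_apply _ hs,
    withDensity_apply _ (hs.preimage (by fun_prop)),
    ← (measurePreserving_shear σ).setLIntegral_comp_preimage hs hwm]
  refine lintegral_congr fun q => ?_
  rw [← ENNReal.ofReal_mul (hm.pos _).le]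
  congr 1
  simp only [posteriorWeight, gaussWeight, add_sub_cancel_right]
  ring

omit [IsProbabilityMeasure P] in
lemma integrable_of_map_withDensity (hX₁ : Measurable X₁)
    (hlaw₁ : P.map X₁ = volume.withDensity (fun y => ENNReal.ofReal (ρ y)))
    (hm : HasMoments ρ) : Integrable X₁ P := by
  have hρ := hm.continuous
  have h1 : Integrable (fun y : EuclideanSpace ℝ (Fin d) => y) (P.map X₁) := by
    rw [hlaw₁, integrable_withDensity_iff_integrable_smul' (by fun_prop) (by simp)]
    refine (PolyGrowth.id.integrable hm).mono'
      (hρ.measurable.ennreal_ofReal.ennreal_toReal.smul measurable_id).aestronglyMeasurable (.of_forall fun y => ?_)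
    rw [norm_smul, ENNReal.toReal_ofReal (hm.pos y).le, Real.norm_of_nonneg (hm.pos y).le]
  exact h1.comp_measurable hX₁

omit [IsProbabilityMeasure P] in
lemma integrable_of_map_stdGaussian (hX₀ : Measurable X₀)
    (hlaw₀ : P.map X₀ = stdGaussian (EuclideanSpace ℝ (Fin d))) :
    Integrable X₀ P ∧ ∫ ω, X₀ ω ∂P = 0 := by
  have h1 : Integrable (fun y : EuclideanSpace ℝ (Fin d) => y) (P.map X₀) := by
    rw [hlaw₀]
    exact IsGaussian.integrable_id
  refine ⟨h1.comp_measurable hX₀, ?_⟩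
  rw [← integral_map (φ := X₀) hX₀.aemeasurable (f := fun y => y) (by fun_prop), hlaw₀]
  exact integral_id_stdGaussian

/-- The conditional expectation of `X₁` given `X₀ + σ X₁`. -/
lemma condExp_noisy (hX₀ : Measurable X₀) (hX₁ : Measurable X₁)
    (hlaw₀ : P.map X₀ = stdGaussian (EuclideanSpace ℝ (Fin d)))
    (hlaw₁ : P.map X₁ = volume.withDensity (fun y => ENNReal.ofReal (ρ y)))
    (hindep : IndepFun X₀ X₁ P) (hm : HasMoments ρ) (σ : ℝ) :
    (fun ω => posteriorExp ρ (fun y => y) (σ, X₀ ω + σ • X₁ ω)) =ᵐ[P]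
      P[X₁ | MeasurableSpace.comap (fun ω => X₀ ω + σ • X₁ ω) inferInstance] := by
  have hpair := map_prodMk_noisy hX₀ hX₁ hlaw₀ hlaw₁ hindep hm σ
  have hY : Measurable fun ω => X₀ ω + σ • X₁ ω := by fun_prop
  have hT : Measurable fun ω => (X₁ ω, X₀ ω + σ • X₁ ω) := by fun_prop
  have hC := gaussNorm_pos (d := d)
  have hwc := continuous_posteriorWeight_swap hm σ
  have hwm := measurable_noisy_density hm σ
  have hw0 : ∀ q : EuclideanSpace ℝ (Fin d) × EuclideanSpace ℝ (Fin d),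
      0 ≤ (gaussNorm d)⁻¹ * posteriorWeight ρ (σ, q.2) q.1 := fun q =>
    mul_nonneg (inv_nonneg.2 hC.le) (posteriorWeight_pos hm _ _).le
  have hmc : Continuous fun x => posteriorExp ρ (fun y => y) (σ, x) :=
    (contDiff_posteriorExp hm PolyGrowth.id).continuous.comp (f := fun x => (σ, x)) (by fun_prop)
  have hmc2 : Continuous fun q : EuclideanSpace ℝ (Fin d) × EuclideanSpace ℝ (Fin d) =>
      posteriorExp ρ (fun y => y) (σ, q.2) := hmc.comp continuous_snd
  have hX₁i := integrable_of_map_withDensity hX₁ hlaw₁ hm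
  have hint1 : Integrable (fun q : EuclideanSpace ℝ (Fin d) × EuclideanSpace ℝ (Fin d) =>
      ((gaussNorm d)⁻¹ * posteriorWeight ρ (σ, q.2) q.1) • q.1) (volume.prod volume) := by
    have h1 : Integrable (fun q : EuclideanSpace ℝ (Fin d) × EuclideanSpace ℝ (Fin d) => q.1)
        (P.map fun ω => (X₁ ω, X₀ ω + σ • X₁ ω)) :=
      (integrable_map_measure (by fun_prop) hT.aemeasurable).2 hX₁i
    rw [hpair, integrable_withDensity_iff_integrable_smul' hwm (by simp)] at h1
    simpa only [ENNReal.toReal_ofReal (hw0 _)] using h1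
  have hid : ∀ x, ∫ y, ((gaussNorm d)⁻¹ * posteriorWeight ρ (σ, x) y) • y =
      (gaussNorm d)⁻¹ • posteriorIntegral ρ (fun y => y) (σ, x) := fun x => by
    simp only [mul_smul]
    exact integral_smul _ _
  -- Integrated in `y` against the joint density, `y` and its posterior mean give the same result;
  -- this is the whole identity of conditional expectations.
  have hcst : ∀ x, ∫ y, ((gaussNorm d)⁻¹ * posteriorWeight ρ (σ, x) y) •
      posteriorExp ρ (fun y => y) (σ, x) =
      (gaussNorm d)⁻¹ • posteriorIntegral ρ (fun y => y) (σ, x) := fun x => by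
    have h0 := posteriorIntegral_one_pos hm (σ, x)
    have h1 : ∫ y, posteriorWeight ρ (σ, x) y = posteriorIntegral ρ (fun _ => (1 : ℝ)) (σ, x) := by
      simp [posteriorIntegral]
    rw [integral_smul_const, integral_const_mul, h1, posteriorExp, smul_smul, mul_assoc,
      mul_inv_cancel₀ h0.ne', mul_one]
  have hint2 : Integrable (fun q : EuclideanSpace ℝ (Fin d) × EuclideanSpace ℝ (Fin d) =>
      ((gaussNorm d)⁻¹ * posteriorWeight ρ (σ, q.2) q.1) •
        posteriorExp ρ (fun y => y) (σ, q.2)) (volume.prod volume) := by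
    have hmeas : Continuous (fun q : EuclideanSpace ℝ (Fin d) × EuclideanSpace ℝ (Fin d) =>
        ((gaussNorm d)⁻¹ * posteriorWeight ρ (σ, q.2) q.1) •
          posteriorExp ρ (fun y => y) (σ, q.2)) := (continuous_const.mul hwc).smul hmc2
    refine (integrable_prod_iff' hmeas.aestronglyMeasurable).2
      ⟨.of_forall fun x => ?_, ?_⟩
    · have := integrable_posteriorWeight_smul hm
        (PolyGrowth.const (d := d) (1 : ℝ)) (σ, x)
      simp only [smul_eq_mul, mul_one] at this
      exact (this.const_mul (gaussNorm d)⁻¹).smul_const (posteriorExp ρ (fun y => y) (σ, x))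
    -- The slice integral of the norm of the posterior mean equals the norm of the slice integral of
    -- `y`, so integrability follows from that of `X₁`.
    · have h1 := hint1.integral_prod_right.norm
      refine h1.congr (.of_forall fun x => ?_)
      simp only
      rw [hid, ← hcst]
      have h2 : ∀ y, ‖((gaussNorm d)⁻¹ * posteriorWeight ρ (σ, x) y) •
          posteriorExp ρ (fun y => y) (σ, x)‖ = ((gaussNorm d)⁻¹ * posteriorWeight ρ (σ, x) y) *
          ‖posteriorExp ρ (fun y => y) (σ, x)‖ := fun y => by
        rw [norm_smul, Real.norm_of_nonneg (hw0 (y, x))]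
      rw [integral_smul_const, norm_smul, Real.norm_of_nonneg (integral_nonneg fun y => hw0 (y, x)),
        ← integral_mul_const]
      exact integral_congr_ae (.of_forall fun y => (h2 y).symm)
  have hmi : Integrable (fun ω => posteriorExp ρ (fun y => y) (σ, X₀ ω + σ • X₁ ω)) P := by
    have h1 : Integrable (fun q : EuclideanSpace ℝ (Fin d) × EuclideanSpace ℝ (Fin d) =>
        posteriorExp ρ (fun y => y) (σ, q.2)) (P.map fun ω => (X₁ ω, X₀ ω + σ • X₁ ω)) := by
      rw [hpair, integrable_withDensity_iff_integrable_smul' hwm (by simp)]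
      simpa only [ENNReal.toReal_ofReal (hw0 _)] using hint2
    exact (integrable_map_measure hmc2.aestronglyMeasurable hT.aemeasurable).1 h1
  refine ae_eq_condExp_of_forall_setIntegral_eq hY.comap_le hX₁i
    (fun s _ _ => hmi.integrableOn) ?_ ?_
  swap
  · exact (hmc.stronglyMeasurable.comp_measurable
      (comap_measurable _)).aestronglyMeasurable
  rintro _ ⟨B, hB, rfl⟩ -
  have key : ∀ f : EuclideanSpace ℝ (Fin d) × EuclideanSpace ℝ (Fin d) → EuclideanSpace ℝ (Fin d),
      Continuous f → Integrable (fun q : EuclideanSpace ℝ (Fin d) × EuclideanSpace ℝ (Fin d) =>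
        ((gaussNorm d)⁻¹ * posteriorWeight ρ (σ, q.2) q.1) • f q) (volume.prod volume) →
      ∫ ω in (fun ω => X₀ ω + σ • X₁ ω) ⁻¹' B, f (X₁ ω, X₀ ω + σ • X₁ ω) ∂P =
        ∫ x in B, ∫ y, ((gaussNorm d)⁻¹ * posteriorWeight ρ (σ, x) y) • f (y, x) := by
    intro f hf hfi
    have hBm : MeasurableSet ((univ : Set (EuclideanSpace ℝ (Fin d))) ×ˢ B) :=
      MeasurableSet.univ.prod hB
    have e1 : (fun ω => X₀ ω + σ • X₁ ω) ⁻¹' B =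
        (fun ω => (X₁ ω, X₀ ω + σ • X₁ ω)) ⁻¹' (univ ×ˢ B) := by
      ext ω; simp
    rw [e1, ← setIntegral_map (μ := P) (f := f) hBm hf.aestronglyMeasurable hT.aemeasurable,
      hpair, setIntegral_withDensity_eq_setIntegral_toReal_smul hwm (by simp) f hBm]
    simp only [ENNReal.toReal_ofReal (hw0 _)]
    rw [← Measure.prod_restrict, Measure.restrict_univ]
    refine integral_prod_symm _ ?_
    have := hfi.integrableOn (s := univ ×ˢ B)
    rwa [IntegrableOn, ← Measure.prod_restrict, Measure.restrict_univ] at this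
  rw [key (fun q => q.1) continuous_fst hint1,
    key (fun q => posteriorExp ρ (fun y => y) (σ, q.2)) hmc2 hint2]
  simp only [hid, hcst]

omit [MeasurableSpace Ω] in
lemma comap_const_smul {a : ℝ} (ha : a ≠ 0) (Y : Ω → EuclideanSpace ℝ (Fin d)) :
    MeasurableSpace.comap (fun ω => a • Y ω) inferInstance =
      MeasurableSpace.comap Y inferInstance := by
  have h1 : MeasurableEmbedding (fun y : EuclideanSpace ℝ (Fin d) => a • y) :=
    measurableEmbedding_const_smul₀ ha
  have h2 : (fun ω => a • Y ω) = (fun y : EuclideanSpace ℝ (Fin d) => a • y) ∘ Y := rfl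
  rw [h2, ← MeasurableSpace.comap_comp, h1.comap_eq]

/-- The conditional expectation of `a' X₀ + b' X₁` given `a X₀ + b X₁`. -/
lemma condExp_linearCombination (hX₀ : Measurable X₀) (hX₁ : Measurable X₁)
    (hlaw₀ : P.map X₀ = stdGaussian (EuclideanSpace ℝ (Fin d)))
    (hlaw₁ : P.map X₁ = volume.withDensity (fun y => ENNReal.ofReal (ρ y)))
    (hindep : IndepFun X₀ X₁ P) (hm : HasMoments ρ) {a : ℝ} (ha : a ≠ 0) (b a' b' : ℝ) :
    (fun ω => (a' / a) • (a • X₀ ω + b • X₁ ω) + (b' - a' * b / a) •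
        posteriorExp ρ (fun y => y) (b / a, a⁻¹ • (a • X₀ ω + b • X₁ ω))) =ᵐ[P]
      P[fun ω => a' • X₀ ω + b' • X₁ ω |
        MeasurableSpace.comap (fun ω => a • X₀ ω + b • X₁ ω) inferInstance] := by
  have hY : (fun ω => a • X₀ ω + b • X₁ ω) = fun ω => a • (X₀ ω + (b / a) • X₁ ω) := by
    ext1 ω
    rw [smul_add, smul_smul, mul_div_cancel₀ _ ha]
  have hcomap : MeasurableSpace.comap (fun ω => a • X₀ ω + b • X₁ ω) inferInstance =
      MeasurableSpace.comap (fun ω => X₀ ω + (b / a) • X₁ ω) inferInstance := by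
    rw [hY, comap_const_smul ha]
  have hS : Measurable fun ω => a • X₀ ω + b • X₁ ω := by fun_prop
  have hX₁i := integrable_of_map_withDensity hX₁ hlaw₁ hm
  have hX₀i := (integrable_of_map_stdGaussian hX₀ hlaw₀).1
  have hSi : Integrable (fun ω => a • X₀ ω + b • X₁ ω) P := (hX₀i.smul a).add (hX₁i.smul b)
  have h1 := condExp_noisy hX₀ hX₁ hlaw₀ hlaw₁ hindep hm (b / a)
  rw [← hcomap] at h1
  set m := MeasurableSpace.comap (fun ω => a • X₀ ω + b • X₁ ω) inferInstance with hmdef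
  have hle : m ≤ _ := hS.comap_le
  -- Eliminating `X₀` leaves a multiple of the conditioning variable and a multiple of `X₁`.
  have h2 : (fun ω => a' • X₀ ω + b' • X₁ ω) =
      (a' / a) • (fun ω => a • X₀ ω + b • X₁ ω) + (b' - a' * b / a) • X₁ := by
    ext1 ω
    simp only [Pi.add_apply, Pi.smul_apply]
    match_scalars <;> field_simp
    ring
  rw [h2]
  have h3 := condExp_add (hSi.smul (a' / a)) (hX₁i.smul (b' - a' * b / a)) m
  have h4 := condExp_smul (μ := P) (a' / a) (fun ω => a • X₀ ω + b • X₁ ω) m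
  have h5 := condExp_smul (μ := P) (b' - a' * b / a) X₁ m
  have h6 : P[fun ω => a • X₀ ω + b • X₁ ω | m] = fun ω => a • X₀ ω + b • X₁ ω :=
    condExp_of_stronglyMeasurable hle (comap_measurable _).stronglyMeasurable hSi
  filter_upwards [h1, h3, h4, h5] with ω e1 e3 e4 e5
  rw [e3, Pi.add_apply, e4, e5, Pi.smul_apply, Pi.smul_apply, h6, ← e1]
  congr 4
  rw [smul_add, smul_smul, smul_smul, inv_mul_cancel₀ ha, one_smul, inv_mul_eq_div]

/-- The conditional expectation of `a' X₀ + b' X₁` given `X₁`. -/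
lemma condExp_linearCombination_right (hX₀ : Measurable X₀) (hX₁ : Measurable X₁)
    (hlaw₀ : P.map X₀ = stdGaussian (EuclideanSpace ℝ (Fin d)))
    (hX₁i : Integrable X₁ P) (hindep : IndepFun X₀ X₁ P) (a' b' : ℝ) :
    (fun ω => b' • X₁ ω) =ᵐ[P]
      P[fun ω => a' • X₀ ω + b' • X₁ ω | MeasurableSpace.comap X₁ inferInstance] := by
  obtain ⟨hX₀i, hX₀0⟩ := integrable_of_map_stdGaussian hX₀ hlaw₀
  have h3 := condExp_add (hX₀i.smul a') (hX₁i.smul b')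
    (MeasurableSpace.comap X₁ inferInstance)
  have h4 := condExp_smul (μ := P) a' X₀ (MeasurableSpace.comap X₁ inferInstance)
  have h5 := condExp_smul (μ := P) b' X₁ (MeasurableSpace.comap X₁ inferInstance)
  have h6 : P[X₁ | MeasurableSpace.comap X₁ inferInstance] = X₁ :=
    condExp_of_stronglyMeasurable hX₁.comap_le (comap_measurable _).stronglyMeasurable hX₁i
  have h7 := condExp_indep_eq (μ := P) hX₀.comap_le hX₁.comap_le
    (f := X₀) (comap_measurable X₀).stronglyMeasurable hindep
  have h8 : (fun ω => a' • X₀ ω + b' • X₁ ω) = a' • X₀ + b' • X₁ := rfl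
  rw [h8]
  filter_upwards [h3, h4, h5, h7] with ω e3 e4 e5 e7
  rw [e3, Pi.add_apply, e4, e5, Pi.smul_apply, Pi.smul_apply, h6, e7, hX₀0, smul_zero, zero_add]

/-- The law of a nontrivial combination `a X₀ + b X₁` charges every nonempty open set. -/
lemma isOpenPosMeasure_map_linearCombination (hX₀ : Measurable X₀) (hX₁ : Measurable X₁)
    (hlaw₀ : P.map X₀ = stdGaussian (EuclideanSpace ℝ (Fin d)))
    (hlaw₁ : P.map X₁ = volume.withDensity (fun y => ENNReal.ofReal (ρ y)))
    (hindep : IndepFun X₀ X₁ P) (hm : HasMoments ρ) {a b : ℝ} (hab : a ≠ 0 ∨ b ≠ 0) :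
    (P.map fun ω => a • X₀ ω + b • X₁ ω).IsOpenPosMeasure := by
  have hρ := hm.continuous
  have hg := (hasMoments_gaussWeight (d := d)).continuous
  have hC := gaussNorm_pos (d := d)
  have : (P.map X₀).IsOpenPosMeasure := by
    rw [hlaw₀, stdGaussian_eq_withDensity]
    refine Measure.AbsolutelyContinuous.isOpenPosMeasure (μ := volume)
      (withDensity_absolutelyContinuous' ?_ ?_)
    · fun_prop
    · refine .of_forall fun z => ?_
      simpa using mul_pos (inv_pos.2 hC) (gaussWeight_pos z)
  have : (P.map X₁).IsOpenPosMeasure := by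
    rw [hlaw₁]
    refine Measure.AbsolutelyContinuous.isOpenPosMeasure (μ := volume)
      (withDensity_absolutelyContinuous' ?_ ?_)
    · fun_prop
    · refine .of_forall fun z => ?_
      simpa using hm.pos z
  have h1 := (indepFun_iff_map_prod_eq_prod_map_map hX₀.aemeasurable hX₁.aemeasurable).1 hindep
  have : IsProbabilityMeasure (P.map X₁) := Measure.isProbabilityMeasure_map hX₁.aemeasurable
  have h2 : (P.map fun ω => (X₀ ω, X₁ ω)).IsOpenPosMeasure := by rw [h1]; infer_instance
  have h3 : P.map (fun ω => a • X₀ ω + b • X₁ ω) =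
      (P.map fun ω => (X₀ ω, X₁ ω)).map (fun q => a • q.1 + b • q.2) := by
    rw [Measure.map_map (by fun_prop) (by fun_prop)]
    rfl
  rw [h3]
  refine (show Continuous fun q : EuclideanSpace ℝ (Fin d) × EuclideanSpace ℝ (Fin d) =>
    a • q.1 + b • q.2 by fun_prop).isOpenPosMeasure_map fun x => ?_
  rcases hab with h | h
  · exact ⟨(a⁻¹ • x, 0), by simp [smul_smul, h]⟩
  · exact ⟨(0, b⁻¹ • x), by simp [smul_smul, h]⟩

end ConditionalExpectation

/-! ### Separation of trajectories of the angular field -/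

section AngularFlow

variable {d : ℕ} {V : EuclideanSpace ℝ (Fin d) → ℝ} {κ : ℝ}

/-- Two integral curves of the angular field separate at most like
`√(κ cos² θ + sin² θ)`. -/
lemma norm_sub_sq_le_of_isCurveOn_angularField
    (hV : ConvexOn ℝ univ (fun x => V x - κ / 2 * ‖x‖ ^ 2))
    (hκ : 0 < κ) (hm : HasMoments (fun y => Real.exp (-V y)))
    (hW : ContDiff ℝ 1 (fun p : ℝ × EuclideanSpace ℝ (Fin d) =>
      angularField (fun y => Real.exp (-V y)) p.1 p.2)) {X Y : ℝ → EuclideanSpace ℝ (Fin d)}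
    (hX : IsCurveOn (angularField (fun y => Real.exp (-V y))) (Real.pi / 2) X)
    (hY : IsCurveOn (angularField (fun y => Real.exp (-V y))) (Real.pi / 2) Y)
    {θ : ℝ} (hθ : θ ∈ Icc 0 (Real.pi / 2)) :
    ‖X θ - Y θ‖ ^ 2 ≤
      (Real.cos θ ^ 2 + Real.sin θ ^ 2 / κ) * ‖X 0 - Y 0‖ ^ 2 := by
  set W := angularField (fun y => Real.exp (-V y)) with hWdef
  -- Since `q' / 2 = sin θ cos θ (1 - κ)`, the one-sided Lipschitz constant of the field is exactly
  -- `q' / (2 q)`, and the quotient `‖X - Y‖ ^ 2 / q` is nonincreasing. The initial value `q 0 = κ`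
  -- must be positive.
  set q : ℝ → ℝ := fun θ => κ * Real.cos θ ^ 2 + Real.sin θ ^ 2 with hq
  have hqpos : ∀ θ, 0 < q θ := fun θ => by
    have h1 := Real.sin_sq_add_cos_sq θ
    rcases (sq_nonneg (Real.cos θ)).eq_or_lt with h | h
    · simp only [hq]; rw [← h] at h1 ⊢; linarith
    · simp only [hq]; positivity
  have hqd : ∀ θ, HasDerivAt q (2 * (Real.sin θ * Real.cos θ * (1 - κ))) θ := fun θ => by
    refine ((((Real.hasDerivAt_cos θ).pow 2).const_mul κ).add
      ((Real.hasDerivAt_sin θ).pow 2)).congr_deriv ?_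
    push_cast
    ring
  have hd : ∀ θ ∈ Icc 0 (Real.pi / 2), HasDerivWithinAt (fun θ => ‖X θ - Y θ‖ ^ 2 / q θ)
      ((2 * inner ℝ (X θ - Y θ) (W θ (X θ) - W θ (Y θ)) * q θ -
        ‖X θ - Y θ‖ ^ 2 * (2 * (Real.sin θ * Real.cos θ * (1 - κ)))) / q θ ^ 2)
      (Icc 0 (Real.pi / 2)) θ := fun θ hθ =>
    (((hX θ hθ).sub (hY θ hθ)).norm_sq).div (hqd θ).hasDerivWithinAt (hqpos θ).ne'
  have hanti : AntitoneOn (fun θ => ‖X θ - Y θ‖ ^ 2 / q θ) (Icc 0 (Real.pi / 2)) := by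
    refine antitoneOn_of_hasDerivWithinAt_nonpos (convex_Icc _ _)
      (fun θ hθ => (hd θ hθ).continuousWithinAt)
      (fun θ hθ => (hd θ (interior_subset hθ)).mono interior_subset) fun θ hθ => ?_
    refine div_nonpos_of_nonpos_of_nonneg ?_ (sq_nonneg _)
    have h1 := inner_sub_le_of_fderiv_le
      (fun x => (hasFDerivAt_slice hW θ x).differentiableAt)
      (fun x h => inner_fderiv_angularField_le hV hκ.le hm (interior_subset hθ) x h) (X θ) (Y θ)
    rw [real_inner_comm, div_mul_eq_mul_div, le_div_iff₀ (hqpos θ)] at h1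
    linarith
  have h1 := hanti ⟨le_rfl, by positivity⟩ hθ hθ.1
  have h2 : q 0 = κ := by simp [hq]
  simp only [h2] at h1
  rw [div_le_div_iff₀ (hqpos θ) hκ] at h1
  have h3 : (Real.cos θ ^ 2 + Real.sin θ ^ 2 / κ) * ‖X 0 - Y 0‖ ^ 2 =
      (‖X 0 - Y 0‖ ^ 2 * q θ) / κ := by
    simp only [hq]
    field_simp
  rw [h3, le_div_iff₀ hκ]
  exact h1

end AngularFlow

/-! ### Polar coordinates of the schedule -/

section Polar

variable {α β : ℝ → ℝ}

/-- The radial part of a schedule. -/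
noncomputable def scheduleRadius (α β : ℝ → ℝ) (t : ℝ) : ℝ := Real.sqrt (α t ^ 2 + β t ^ 2)

/-- The angular part of a schedule. -/
noncomputable def scheduleAngle (α β : ℝ → ℝ) (t : ℝ) : ℝ := (Complex.mk (α t) (β t)).arg

namespace IsInterpolantCoeff

variable (h : IsInterpolantCoeff α β)
include h

lemma nonneg {t : ℝ} (ht : t ∈ Icc (0 : ℝ) 1) : 0 ≤ α t ∧ 0 ≤ β t := by
  rcases ht.1.eq_or_lt with h0 | h0
  · rw [← h0, h.α_zero, h.β_zero]; norm_num
  rcases ht.2.eq_or_lt with h1 | h1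
  · rw [h1, h.α_one, h.β_one]; norm_num
  exact ⟨(h.α_pos t ⟨h0, h1⟩).le, (h.β_pos t ⟨h0, h1⟩).le⟩

lemma sq_add_sq_pos {t : ℝ} (ht : t ∈ Icc (0 : ℝ) 1) : 0 < α t ^ 2 + β t ^ 2 := by
  rcases ht.1.eq_or_lt with h0 | h0
  · rw [← h0, h.α_zero, h.β_zero]; norm_num
  rcases ht.2.eq_or_lt with h1 | h1
  · rw [h1, h.α_one, h.β_one]; norm_num
  have := h.α_pos t ⟨h0, h1⟩
  positivity

lemma radius_pos {t : ℝ} (ht : t ∈ Icc (0 : ℝ) 1) : 0 < scheduleRadius α β t :=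
  Real.sqrt_pos.2 (h.sq_add_sq_pos ht)

lemma radius_sq {t : ℝ} (ht : t ∈ Icc (0 : ℝ) 1) :
    scheduleRadius α β t ^ 2 = α t ^ 2 + β t ^ 2 :=
  Real.sq_sqrt (h.sq_add_sq_pos ht).le

lemma α_ne_zero {t : ℝ} (ht : t ∈ Icc (0 : ℝ) 1) (ht1 : t ≠ 1) : α t ≠ 0 := by
  rcases ht.1.eq_or_lt with h0 | h0
  · rw [← h0, h.α_zero]; norm_num
  · exact (h.α_pos t ⟨h0, lt_of_le_of_ne ht.2 ht1⟩).ne'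

omit h in
lemma norm_complex_mk (t : ℝ) : ‖Complex.mk (α t) (β t)‖ = scheduleRadius α β t := by
  rw [Complex.norm_def, Complex.normSq_mk, scheduleRadius, sq, sq]

lemma cos_angle {t : ℝ} (ht : t ∈ Icc (0 : ℝ) 1) :
    Real.cos (scheduleAngle α β t) = α t / scheduleRadius α β t := by
  have h0 : Complex.mk (α t) (β t) ≠ 0 := by
    rw [← norm_pos_iff, norm_complex_mk]
    exact h.radius_pos ht
  rw [scheduleAngle, Complex.cos_arg h0, norm_complex_mk]

omit h in
lemma sin_angle (t : ℝ) :
    Real.sin (scheduleAngle α β t) = β t / scheduleRadius α β t := by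
  rw [scheduleAngle, Complex.sin_arg, norm_complex_mk]

lemma angle_mem {t : ℝ} (ht : t ∈ Icc (0 : ℝ) 1) :
    scheduleAngle α β t ∈ Icc 0 (Real.pi / 2) := by
  obtain ⟨h1, h2⟩ := h.nonneg ht
  exact ⟨Complex.arg_nonneg_iff.2 h2, (le_abs_self _).trans (Complex.abs_arg_le_pi_div_two_iff.2 h1)⟩

lemma hasDerivWithinAt_α {t : ℝ} (ht : t ∈ Icc (0 : ℝ) 1) :
    HasDerivWithinAt α (timeDeriv α t) (Icc 0 1) t :=
  (h.contDiff_α.differentiableOn two_ne_zero t ht).hasDerivWithinAt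

lemma hasDerivWithinAt_β {t : ℝ} (ht : t ∈ Icc (0 : ℝ) 1) :
    HasDerivWithinAt β (timeDeriv β t) (Icc 0 1) t :=
  (h.contDiff_β.differentiableOn two_ne_zero t ht).hasDerivWithinAt

lemma contDiffOn_timeDeriv_α : ContDiffOn ℝ 1 (timeDeriv α) (Icc 0 1) :=
  h.contDiff_α.derivWithin (uniqueDiffOn_Icc zero_lt_one) (by norm_num)

lemma contDiffOn_timeDeriv_β : ContDiffOn ℝ 1 (timeDeriv β) (Icc 0 1) :=
  h.contDiff_β.derivWithin (uniqueDiffOn_Icc zero_lt_one) (by norm_num)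

lemma contDiffOn_radius : ContDiffOn ℝ 1 (scheduleRadius α β) (Icc 0 1) :=
  (((h.contDiff_α.of_le one_le_two).pow 2).add ((h.contDiff_β.of_le one_le_two).pow 2)).sqrt
    fun _ ht => (h.sq_add_sq_pos ht).ne'

lemma hasDerivWithinAt_radius {t : ℝ} (ht : t ∈ Icc (0 : ℝ) 1) :
    HasDerivWithinAt (scheduleRadius α β)
      ((α t * timeDeriv α t + β t * timeDeriv β t) / scheduleRadius α β t ^ 2 *
        scheduleRadius α β t) (Icc 0 1) t := by
  have hr := (h.radius_pos ht).ne'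
  refine ((((h.hasDerivWithinAt_α ht).pow 2).add ((h.hasDerivWithinAt_β ht).pow 2)).sqrt
    (h.sq_add_sq_pos ht).ne').congr_deriv ?_
  change _ / (2 * scheduleRadius α β t) = _
  field_simp
  push_cast
  ring

/-- The angle is the imaginary part of `log (α + i β)`, with derivative `Im ((α̇ + i β̇) / (α + i
β))`; the curve stays in the closed first quadrant minus the origin, hence off the branch cut. -/
lemma hasDerivWithinAt_angle {t : ℝ} (ht : t ∈ Icc (0 : ℝ) 1) :
    HasDerivWithinAt (scheduleAngle α β)
      ((α t * timeDeriv β t - timeDeriv α t * β t) / scheduleRadius α β t ^ 2) (Icc 0 1) t := by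
  have hr := (h.radius_pos ht).ne'
  have h1 : HasDerivWithinAt (fun t => (α t : ℂ) + β t * Complex.I)
      ((timeDeriv α t : ℂ) + timeDeriv β t * Complex.I) (Icc 0 1) t :=
    (h.hasDerivWithinAt_α ht).ofReal_comp.add
      ((h.hasDerivWithinAt_β ht).ofReal_comp.mul_const Complex.I)
  have hmk : ∀ t, (α t : ℂ) + β t * Complex.I = Complex.mk (α t) (β t) := fun t =>
    (Complex.mk_eq_add_mul_I _ _).symm
  simp only [hmk] at h1
  have hslit : Complex.mk (α t) (β t) ∈ Complex.slitPlane := by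
    rw [Complex.mem_slitPlane_iff]
    obtain ⟨h2, h3⟩ := h.nonneg ht
    rcases h2.eq_or_lt with h4 | h4
    · right
      intro h5
      have h6 := h.sq_add_sq_pos ht
      simp only at h5
      rw [← h4, h5] at h6
      norm_num at h6
    · exact .inl h4
  have h2 := h1.clog_real hslit
  have h3 := (Complex.imCLM.hasFDerivAt.comp_hasDerivWithinAt t h2)
  have h4 : scheduleAngle α β = Complex.imCLM ∘ fun t => Complex.log (Complex.mk (α t) (β t)) := by
    ext t
    simp [scheduleAngle, Complex.log_im]
  rw [h4]
  refine h3.congr_deriv ?_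
  rw [Complex.imCLM_apply, Complex.div_im, Complex.normSq_mk, h.radius_sq ht]
  have h6 := (h.sq_add_sq_pos ht).ne'
  have h7 : α t * α t + β t * β t ≠ 0 := by rwa [← sq, ← sq]
  simp
  field_simp

lemma contDiffOn_angle : ContDiffOn ℝ 1 (scheduleAngle α β) (Icc 0 1) := by
  rw [contDiffOn_one_iff_derivWithin (uniqueDiffOn_Icc zero_lt_one)]
  refine ⟨fun t ht => (h.hasDerivWithinAt_angle ht).differentiableWithinAt, ?_⟩
  have h1 := h.contDiffOn_timeDeriv_α.continuousOn
  have h2 := h.contDiffOn_timeDeriv_β.continuousOn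
  refine ContinuousOn.congr (((h.contDiff_α.continuousOn.mul h2).sub
    (h1.mul h.contDiff_β.continuousOn)).div (h.contDiffOn_radius.continuousOn.pow 2)
    fun t ht => (pow_pos (h.radius_pos ht) 2).ne') fun t ht => ?_
  exact (h.hasDerivWithinAt_angle ht).derivWithin (uniqueDiffOn_Icc zero_lt_one t ht)

end IsInterpolantCoeff

end Polar

/-! ### The drift in polar coordinates -/

section RadialField

variable {d : ℕ} {ρ V : EuclideanSpace ℝ (Fin d) → ℝ} {κ M : ℝ}

/-- The drift of a linear interpolant in polar coordinates: a dilation plus a rescaled angular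
field. -/
noncomputable def radialField (ρ : EuclideanSpace ℝ (Fin d) → ℝ) (a b θ c : ℝ)
    (x : EuclideanSpace ℝ (Fin d)) : EuclideanSpace ℝ (Fin d) :=
  a • x + b • angularField ρ θ (c • x)

lemma contDiff_radialField (hm : HasMoments ρ) (hρ : ContDiff ℝ 1 ρ) (hM : ∀ y, ρ y ≤ M)
    {a b θ c : ℝ → ℝ} (ha : ContDiff ℝ 1 a) (hb : ContDiff ℝ 1 b) (hθ : ContDiff ℝ 1 θ)
    (hc : ContDiff ℝ 1 c) : ContDiff ℝ 1 (fun p : ℝ × EuclideanSpace ℝ (Fin d) =>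
      radialField ρ (a p.1) (b p.1) (θ p.1) (c p.1) p.2) := by
  have h1 : ContDiff ℝ 1 fun p : ℝ × EuclideanSpace ℝ (Fin d) => (θ p.1, c p.1 • p.2) := by
    fun_prop
  have h2 := (contDiff_angularField hm hρ hM).comp h1
  simp only [Function.comp_def] at h2
  unfold radialField
  fun_prop

lemma hasFDerivAt_radialField (hm : HasMoments ρ) (hρ : ContDiff ℝ 1 ρ) (hM : ∀ y, ρ y ≤ M)
    (a b θ c : ℝ) (x : EuclideanSpace ℝ (Fin d)) : HasFDerivAt (radialField ρ a b θ c)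
      (a • ContinuousLinearMap.id ℝ (EuclideanSpace ℝ (Fin d)) +
        (b * c) • fderiv ℝ (angularField ρ θ) (c • x)) x := by
  have h1 := hasFDerivAt_slice (contDiff_angularField hm hρ hM) θ (c • x)
  have h2 := ((hasFDerivAt_id x).const_smul a).add
    ((h1.comp x ((hasFDerivAt_id x).const_smul c)).const_smul b)
  refine HasFDerivAt.congr_fderiv h2 ?_
  ext1 h
  simp [smul_smul]

lemma isSymmetric_fderiv_radialField (hm : HasMoments ρ) (hρ : ContDiff ℝ 1 ρ)
    (hM : ∀ y, ρ y ≤ M) (a b θ c : ℝ) (x : EuclideanSpace ℝ (Fin d)) :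
    (fderiv ℝ (radialField ρ a b θ c) x).IsSymmetric := by
  intro g h
  have h1 : inner ℝ (fderiv ℝ (angularField ρ θ) (c • x) g) h =
      inner ℝ g (fderiv ℝ (angularField ρ θ) (c • x) h) :=
    isSymmetric_fderiv_angularField hm θ (c • x) g h
  change inner ℝ (fderiv ℝ (radialField ρ a b θ c) x g) h =
    inner ℝ g (fderiv ℝ (radialField ρ a b θ c) x h)
  rw [(hasFDerivAt_radialField hm hρ hM a b θ c x).fderiv]
  simp [inner_add_left, inner_add_right, real_inner_smul_left, real_inner_smul_right, h1]

lemma exists_norm_fderiv_radialField_le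
    (hV : ConvexOn ℝ univ (fun x => V x - κ / 2 * ‖x‖ ^ 2))
    (hκ : 0 ≤ κ) (hm : HasMoments (fun y => Real.exp (-V y)))
    (hρ : ContDiff ℝ 1 (fun y => Real.exp (-V y))) (hM : ∀ y, Real.exp (-V y) ≤ M)
    (a b c : ℝ) {θ : ℝ} (hθ : θ ∈ Icc 0 (Real.pi / 2)) :
    ∃ C : ℝ, ∀ x, ‖fderiv ℝ (radialField (fun y => Real.exp (-V y)) a b θ c) x‖ ≤ C := by
  obtain ⟨C, hC⟩ := exists_norm_fderiv_angularField_le hV hκ hm hθ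
  refine ⟨‖a • ContinuousLinearMap.id ℝ (EuclideanSpace ℝ (Fin d))‖ + ‖b * c‖ * C, fun x => ?_⟩
  rw [(hasFDerivAt_radialField hm hρ hM a b θ c x).fderiv]
  refine (norm_add_le _ _).trans (add_le_add le_rfl ?_)
  rw [norm_smul]
  exact mul_le_mul_of_nonneg_left (hC _) (norm_nonneg _)

/-- The angular Jacobian enters with coefficient `b * c`, which is `θ̇` for the schedule; an upper
bound on it survives only if this coefficient is nonnegative. -/
lemma fderiv_radialField_le
    (hV : ConvexOn ℝ univ (fun x => V x - κ / 2 * ‖x‖ ^ 2))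
    (hκ : 0 ≤ κ) (hm : HasMoments (fun y => Real.exp (-V y)))
    (hρ : ContDiff ℝ 1 (fun y => Real.exp (-V y))) (hM : ∀ y, Real.exp (-V y) ≤ M)
    {a b c : ℝ} (hbc : 0 ≤ b * c) {θ : ℝ} (hθ : θ ∈ Icc 0 (Real.pi / 2))
    (x : EuclideanSpace ℝ (Fin d)) :
    fderiv ℝ (radialField (fun y => Real.exp (-V y)) a b θ c) x ≤
      (a + b * c * (Real.sin θ * Real.cos θ * (1 - κ) /
        (κ * Real.cos θ ^ 2 + Real.sin θ ^ 2))) •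
        ContinuousLinearMap.id ℝ (EuclideanSpace ℝ (Fin d)) := by
  rw [ContinuousLinearMap.le_def, ContinuousLinearMap.isPositive_def]
  constructor
  · intro g h
    have h1 : inner ℝ (fderiv ℝ (radialField (fun y => Real.exp (-V y)) a b θ c) x g) h =
        inner ℝ g (fderiv ℝ (radialField (fun y => Real.exp (-V y)) a b θ c) x h) :=
      isSymmetric_fderiv_radialField hm hρ hM a b θ c x g h
    simp [inner_sub_left, inner_sub_right, real_inner_smul_left, real_inner_smul_right, h1]
  · intro h
    have h1 := mul_le_mul_of_nonneg_left
      (inner_fderiv_angularField_le hV hκ hm hθ (c • x) h) hbc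
    rw [(hasFDerivAt_radialField hm hρ hM a b θ c x).fderiv]
    simp only [ContinuousLinearMap.reApplyInnerSelf_apply, sub_apply, add_apply, smul_apply,
      ContinuousLinearMap.id_apply, inner_sub_left, inner_add_left, real_inner_smul_left,
      real_inner_self_eq_norm_sq, RCLike.re_to_real]
    nlinarith

end RadialField

/-! ### The drift and the flow of a general schedule -/

section ScheduleDrift

variable {d : ℕ} {α β : ℝ → ℝ} {ρ V : EuclideanSpace ℝ (Fin d) → ℝ} {κ M : ℝ}

/-- The drift of the linear interpolant with schedule `α`, `β`. -/
noncomputable def scheduleDrift (α β : ℝ → ℝ) (ρ : EuclideanSpace ℝ (Fin d) → ℝ) (t : ℝ) :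
    EuclideanSpace ℝ (Fin d) → EuclideanSpace ℝ (Fin d) :=
  radialField ρ
    ((α t * timeDeriv α t + β t * timeDeriv β t) / scheduleRadius α β t ^ 2)
    ((α t * timeDeriv β t - timeDeriv α t * β t) / scheduleRadius α β t)
    (scheduleAngle α β t) (scheduleRadius α β t)⁻¹

lemma scheduleDrift_of_α_ne_zero (h : IsInterpolantCoeff α β) {t : ℝ} (ht : t ∈ Icc (0 : ℝ) 1)
    (hα : α t ≠ 0) (x : EuclideanSpace ℝ (Fin d)) : scheduleDrift α β ρ t x =
      (timeDeriv α t / α t) • x + (timeDeriv β t - timeDeriv α t * β t / α t) •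
        posteriorExp ρ (fun y => y) (β t / α t, (α t)⁻¹ • x) := by
  have hr := (h.radius_pos ht).ne'
  have hr2 := h.radius_sq ht
  have htan : Real.tan (scheduleAngle α β t) = β t / α t := by
    rw [Real.tan_eq_sin_div_cos, h.cos_angle ht, IsInterpolantCoeff.sin_angle]
    field_simp
  have hx : (Real.cos (scheduleAngle α β t))⁻¹ • (scheduleRadius α β t)⁻¹ • x = (α t)⁻¹ • x := by
    rw [smul_smul, h.cos_angle ht]
    congr 1
    field_simp
  rw [scheduleDrift, radialField, angularField, htan, hx, h.cos_angle ht]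
  match_scalars
  · field_simp
    rw [hr2]
    ring
  · field_simp

lemma scheduleDrift_one (h : IsInterpolantCoeff α β) (x : EuclideanSpace ℝ (Fin d)) :
    scheduleDrift α β ρ 1 x = timeDeriv β 1 • x := by
  have ht : (1 : ℝ) ∈ Icc (0 : ℝ) 1 := ⟨zero_le_one, le_rfl⟩
  have hc : Real.cos (scheduleAngle α β 1) = 0 := by simp [h.cos_angle ht, h.α_one]
  rw [scheduleDrift, radialField, angularField_of_cos_eq_zero hc, h.radius_sq ht]
  simp [h.α_one, h.β_one]

/-- The polar coefficients involve `α̇` and `β̇`, so they are `C¹` because the schedule is `C²`.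
They extend to `C¹` functions on the line, and symmetry survives because it holds for arbitrary
coefficients. -/
lemma exists_contDiff_eq_scheduleDrift (h : IsInterpolantCoeff α β)
    (hm : HasMoments ρ) (hρ : ContDiff ℝ 1 ρ) (hM : ∀ y, ρ y ≤ M) :
    ∃ v : ℝ → EuclideanSpace ℝ (Fin d) → EuclideanSpace ℝ (Fin d),
      ContDiff ℝ 1 (fun p : ℝ × EuclideanSpace ℝ (Fin d) => v p.1 p.2) ∧
      (∀ t x, (fderiv ℝ (v t) x).IsSymmetric) ∧
      ∀ t ∈ Icc (0 : ℝ) 1, v t = scheduleDrift α β ρ t := by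
  have hα := h.contDiff_α.of_le one_le_two
  have hβ := h.contDiff_β.of_le one_le_two
  have hα' := h.contDiffOn_timeDeriv_α
  have hβ' := h.contDiffOn_timeDeriv_β
  have hr := h.contDiffOn_radius
  have hr0 : ∀ t ∈ Icc (0 : ℝ) 1, scheduleRadius α β t ≠ 0 := fun t ht => (h.radius_pos ht).ne'
  obtain ⟨A, hA, hAe⟩ := exists_contDiff_eqOn_Icc (((hα.mul hα').add (hβ.mul hβ')).div (hr.pow 2)
    fun t ht => pow_ne_zero 2 (hr0 t ht))
  obtain ⟨B, hB, hBe⟩ := exists_contDiff_eqOn_Icc (((hα.mul hβ').sub (hα'.mul hβ)).div hr hr0)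
  obtain ⟨Θ, hΘ, hΘe⟩ := exists_contDiff_eqOn_Icc h.contDiffOn_angle
  obtain ⟨C, hC, hCe⟩ := exists_contDiff_eqOn_Icc (hr.inv hr0)
  refine ⟨fun t => radialField ρ (A t) (B t) (Θ t) (C t),
    contDiff_radialField hm hρ hM hA hB hΘ hC,
    fun t x => isSymmetric_fderiv_radialField hm hρ hM _ _ _ _ x, fun t ht => ?_⟩
  simp only [hAe ht, hBe ht, hΘe ht, hCe ht, scheduleDrift]
  rfl

lemma fderiv_scheduleDrift_le (h : IsInterpolantCoeff α β)
    (hV : ConvexOn ℝ univ (fun x => V x - κ / 2 * ‖x‖ ^ 2))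
    (hκ : 0 ≤ κ) (hm : HasMoments (fun y => Real.exp (-V y)))
    (hρ : ContDiff ℝ 1 (fun y => Real.exp (-V y))) (hM : ∀ y, Real.exp (-V y) ≤ M)
    {t : ℝ} (ht : t ∈ Icc (0 : ℝ) 1) (hmono : 0 ≤ α t * timeDeriv β t - timeDeriv α t * β t)
    (hpos : 0 < κ * α t ^ 2 + β t ^ 2) (x : EuclideanSpace ℝ (Fin d)) :
    fderiv ℝ (scheduleDrift α β (fun y => Real.exp (-V y)) t) x ≤
      ((κ * α t * timeDeriv α t + β t * timeDeriv β t) / (κ * α t ^ 2 + β t ^ 2)) •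
        ContinuousLinearMap.id ℝ (EuclideanSpace ℝ (Fin d)) := by
  have hr := h.radius_pos ht
  have hr2 := h.radius_sq ht
  have hr2' := h.sq_add_sq_pos ht
  have h1 := fderiv_radialField_le hV hκ hm hρ hM
    (a := (α t * timeDeriv α t + β t * timeDeriv β t) / scheduleRadius α β t ^ 2)
    (b := (α t * timeDeriv β t - timeDeriv α t * β t) / scheduleRadius α β t)
    (c := (scheduleRadius α β t)⁻¹) (by positivity) (h.angle_mem ht) x
  refine h1.trans_eq ?_
  congr 1
  rw [h.cos_angle ht, IsInterpolantCoeff.sin_angle]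
  have e1 : κ * (α t / scheduleRadius α β t) ^ 2 + (β t / scheduleRadius α β t) ^ 2 =
      (κ * α t ^ 2 + β t ^ 2) / (α t ^ 2 + β t ^ 2) := by
    rw [div_pow, div_pow, hr2]
    ring
  have e2 : β t / scheduleRadius α β t * (α t / scheduleRadius α β t) =
      β t * α t / (α t ^ 2 + β t ^ 2) := by
    rw [div_mul_div_comm, ← sq, hr2]
  have e3 : (α t * timeDeriv β t - timeDeriv α t * β t) / scheduleRadius α β t *
      (scheduleRadius α β t)⁻¹ =
      (α t * timeDeriv β t - timeDeriv α t * β t) / (α t ^ 2 + β t ^ 2) := by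
    rw [← hr2]
    field_simp
  obtain ⟨K, hK⟩ : ∃ K, K = κ * α t ^ 2 + β t ^ 2 := ⟨_, rfl⟩
  have hK0 : K ≠ 0 := hK ▸ hpos.ne'
  rw [e1, e2, e3, hr2, ← hK]
  field_simp
  rw [hK]
  ring

/-- The flow of the drift, together with its Lipschitz constants. -/
lemma exists_flow_scheduleDrift (h : IsInterpolantCoeff α β)
    (hV : ConvexOn ℝ univ (fun x => V x - κ / 2 * ‖x‖ ^ 2))
    (hκ : 0 ≤ κ) (hm : HasMoments (fun y => Real.exp (-V y)))
    (hρ : ContDiff ℝ 1 (fun y => Real.exp (-V y))) (hM : ∀ y, Real.exp (-V y) ≤ M) :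
    ∃ f : ℝ → EuclideanSpace ℝ (Fin d) → EuclideanSpace ℝ (Fin d),
      IsFlow (scheduleDrift α β (fun y => Real.exp (-V y))) f ∧
      (∀ t ∈ Icc (0 : ℝ) 1, Differentiable ℝ (f t)) ∧
      (0 < κ → ∀ t ∈ Icc (0 : ℝ) 1, ∀ x y,
        ‖f t x - f t y‖ ≤ Real.sqrt (α t ^ 2 + β t ^ 2 / κ) * ‖x - y‖) := by
  have hW := contDiff_angularField hm hρ hM
  obtain ⟨g, hg0, hg, hgd⟩ := exists_flow hW (T := Real.pi / 2) (by positivity)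
    fun δ hδ => inner_angularField_growth hV hκ hm hW hδ
  have h0 : (0 : ℝ) ∈ Icc (0 : ℝ) 1 := ⟨le_rfl, zero_le_one⟩
  have hθ0 : scheduleAngle α β 0 = 0 := by
    rw [scheduleAngle, h.α_zero, h.β_zero]
    exact Complex.arg_one
  have hr0 : scheduleRadius α β 0 = 1 := by
    rw [scheduleRadius, h.α_zero, h.β_zero]
    norm_num
  -- The flow is `r_t g_{θ_t}`. The chain rule needs only `θ_t ∈ [0, π/2]`, so the angle may move
  -- backwards.
  refine ⟨fun t x => scheduleRadius α β t • g (scheduleAngle α β t) x, fun x => ⟨?_, ?_⟩, ?_, ?_⟩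
  · simp only [hθ0, hr0, hg0, one_smul]
  · intro t ht
    have hr := (h.radius_pos ht).ne'
    have h1 := (hg x (scheduleAngle α β t) (h.angle_mem ht)).scomp t
      (h.hasDerivWithinAt_angle ht) (fun s hs => h.angle_mem hs)
    have h2 := (h.hasDerivWithinAt_radius ht).smul h1
    refine h2.congr_deriv ?_
    have e : (scheduleRadius α β t)⁻¹ • scheduleRadius α β t • g (scheduleAngle α β t) x =
        g (scheduleAngle α β t) x := by
      rw [smul_smul, inv_mul_cancel₀ hr, one_smul]
    simp only [Function.comp, scheduleDrift, radialField, e]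
    match_scalars <;> field_simp
  · exact fun t ht => (hgd _ (h.angle_mem ht)).const_smul (scheduleRadius α β t)
  · intro hκ' t ht x y
    have hr := h.radius_pos ht
    have h1 := norm_sub_sq_le_of_isCurveOn_angularField hV hκ' hm hW (hg x) (hg y) (h.angle_mem ht)
    simp only [hg0] at h1
    rw [← smul_sub, norm_smul, Real.norm_of_nonneg hr.le]
    refine abs_le_of_sq_le_sq' ?_ (by positivity) |>.2
    rw [mul_pow, mul_pow, Real.sq_sqrt (by positivity)]
    -- The angular bound rescales exactly: `r² (cos² θ + sin² θ / κ) = α² + β² / κ`.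
    calc _ ≤ scheduleRadius α β t ^ 2 * ((Real.cos (scheduleAngle α β t) ^ 2 +
          Real.sin (scheduleAngle α β t) ^ 2 / κ) * ‖x - y‖ ^ 2) := by gcongr
      _ = _ := by
        rw [h.cos_angle ht, IsInterpolantCoeff.sin_angle]
        field_simp

variable {Ω : Type*} [MeasurableSpace Ω] {P : Measure Ω} [IsProbabilityMeasure P]
  {X₀ X₁ : Ω → EuclideanSpace ℝ (Fin d)}

lemma isDrift_scheduleDrift (h : IsInterpolantCoeff α β)
    (hm : HasMoments ρ) (hρ : ContDiff ℝ 1 ρ) (hM : ∀ y, ρ y ≤ M)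
    (hX₀ : Measurable X₀) (hX₁ : Measurable X₁)
    (hlaw₀ : P.map X₀ = stdGaussian (EuclideanSpace ℝ (Fin d)))
    (hlaw₁ : P.map X₁ = volume.withDensity (fun y => ENNReal.ofReal (ρ y)))
    (hindep : IndepFun X₀ X₁ P) : IsDrift P α β X₀ X₁ (scheduleDrift α β ρ) := by
  intro t ht
  refine ⟨continuous_iff_continuousAt.2 fun x =>
    (hasFDerivAt_radialField hm hρ hM _ _ _ _ x).continuousAt, ?_⟩
  by_cases ht1 : t = 1
  · subst ht1
    have h1 := condExp_linearCombination_right hX₀ hX₁ hlaw₀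
      (integrable_of_map_withDensity hX₁ hlaw₁ hm) hindep (timeDeriv α 1) (timeDeriv β 1)
    have h2 : interpolant α β X₀ X₁ 1 = X₁ := by
      ext1 ω
      simp [interpolant, h.α_one, h.β_one]
    rw [h2]
    simp only [scheduleDrift_one h]
    exact h1
  · simp only [scheduleDrift_of_α_ne_zero h ht (h.α_ne_zero ht ht1)]
    exact condExp_linearCombination hX₀ hX₁ hlaw₀ hlaw₁ hindep hm (h.α_ne_zero ht ht1) (β t)
      (timeDeriv α t) (timeDeriv β t)

/-- Two continuous functions that agree almost everywhere for a measure charging every nonempty open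
set are equal. -/
lemma IsDrift.eq_of_isDrift (h : IsInterpolantCoeff α β) (hm : HasMoments ρ)
    (hX₀ : Measurable X₀) (hX₁ : Measurable X₁)
    (hlaw₀ : P.map X₀ = stdGaussian (EuclideanSpace ℝ (Fin d)))
    (hlaw₁ : P.map X₁ = volume.withDensity (fun y => ENNReal.ofReal (ρ y)))
    (hindep : IndepFun X₀ X₁ P)
    {v w : ℝ → EuclideanSpace ℝ (Fin d) → EuclideanSpace ℝ (Fin d)}
    (hv : IsDrift P α β X₀ X₁ v) (hw : IsDrift P α β X₀ X₁ w) {t : ℝ}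
    (ht : t ∈ Icc (0 : ℝ) 1) : w t = v t := by
  obtain ⟨hvc, hve⟩ := hv t ht
  obtain ⟨hwc, hwe⟩ := hw t ht
  have hab : α t ≠ 0 ∨ β t ≠ 0 := by
    by_contra! hab
    have := h.sq_add_sq_pos ht
    simp [hab.1, hab.2] at this
  have := isOpenPosMeasure_map_linearCombination hX₀ hX₁ hlaw₀ hlaw₁ hindep hm hab
  refine (Continuous.ae_eq_iff_eq (P.map fun ω => α t • X₀ ω + β t • X₁ ω) hwc hvc).1 ?_
  refine (ae_map_iff (by fun_prop) (measurableSet_eq_fun hwc.measurable hvc.measurable)).2 ?_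
  exact hwe.trans hve.symm

end ScheduleDrift

/-! ### The main theorem -/

theorem theorem1 {d : ℕ} {Ω : Type*} [MeasurableSpace Ω] (P : Measure Ω) [IsProbabilityMeasure P]
    (X₀ X₁ : Ω → EuclideanSpace ℝ (Fin d)) (hX₀ : Measurable X₀) (hX₁ : Measurable X₁)
    (V₁ : EuclideanSpace ℝ (Fin d) → ℝ) (κ : ℝ) (hκ : 0 ≤ κ)
    (hV₁ : IsLogConcavePotential κ V₁)
    (hlaw₀ : P.map X₀ = stdGaussian (EuclideanSpace ℝ (Fin d)))
    (hlaw₁ : P.map X₁ = gibbsMeasure V₁)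
    (hindep : IndepFun X₀ X₁ P)
    (α β : ℝ → ℝ) (hαβ : IsInterpolantCoeff α β) :
    -- the drift exists and is unique
    ∃ v : ℝ → EuclideanSpace ℝ (Fin d) → EuclideanSpace ℝ (Fin d),
      IsDrift P α β X₀ X₁ v ∧
      (∀ w, IsDrift P α β X₀ X₁ w → ∀ t ∈ Icc (0 : ℝ) 1, w t = v t) ∧
      -- it is a gradient field, with a bounded symmetric Jacobian that is bounded above
      (∃ φ : ℝ → EuclideanSpace ℝ (Fin d) → ℝ,
        IsC1C1 φ ∧
        (∀ t ∈ Icc (0 : ℝ) 1, v t = gradient (φ t)) ∧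
        (∀ t ∈ Icc (0 : ℝ) 1,
          Differentiable ℝ (v t) ∧
          (∀ x, fderiv ℝ (v t) x = hessian (φ t) x) ∧
          (∀ x, (fderiv ℝ (v t) x).IsSymmetric) ∧
          (∃ C : ℝ, ∀ x, ‖fderiv ℝ (v t) x‖ ≤ C) ∧
          (0 ≤ α t * timeDeriv β t - timeDeriv α t * β t →
            0 < κ * α t ^ 2 + β t ^ 2 →
            ∀ x, fderiv ℝ (v t) x ≤
              ((κ * α t * timeDeriv α t + β t * timeDeriv β t) / (κ * α t ^ 2 + β t ^ 2)) •
                ContinuousLinearMap.id ℝ (EuclideanSpace ℝ (Fin d))))) ∧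
      -- the flow map exists, is unique, and is Lipschitz with the stated constant
      (∃ f : ℝ → EuclideanSpace ℝ (Fin d) → EuclideanSpace ℝ (Fin d),
        IsFlow v f ∧
        (∀ g, IsFlow v g → ∀ t ∈ Icc (0 : ℝ) 1, g t = f t) ∧
        (∀ t ∈ Icc (0 : ℝ) 1, Differentiable ℝ (f t)) ∧
        (0 < κ → ∀ t ∈ Icc (0 : ℝ) 1, ∀ x,
          ‖fderiv ℝ (f t) x‖ ≤ Real.sqrt (α t ^ 2 + β t ^ 2 / κ)) ∧
        (0 < κ → ∀ x, ‖fderiv ℝ (f 1) x‖ ≤ 1 / Real.sqrt κ)) := by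
  have hV := hV₁.convexOn_sub_sq
  have hVc : Continuous V₁ := hV₁.1.continuous
  -- Finiteness of `e^{-V₁}` comes from its being a law. With convexity it yields linear growth of
  -- `V₁`, hence all moments and a bounded density, even when `κ = 0`.
  have hfin : IsFiniteMeasure (gibbsMeasure V₁) := by
    have := Measure.isProbabilityMeasure_map (μ := P) hX₁.aemeasurable
    rw [hlaw₁] at this
    infer_instance
  obtain ⟨a, b, ha, hab⟩ := (hV₁.convexOn hκ).exists_linear_lower_bound hVc hfin
  have hm := hasMoments_exp_neg ha hab hVc
  have hρ : ContDiff ℝ 1 (fun y => Real.exp (-V₁ y)) := (hV₁.1.of_le one_le_two).neg.exp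
  have hM : ∀ y, Real.exp (-V₁ y) ≤ Real.exp b := fun y => Real.exp_le_exp.2 (by
    have := hab y
    have := mul_nonneg ha.le (norm_nonneg y)
    linarith)
  have hdrift := isDrift_scheduleDrift hαβ hm hρ hM hX₀ hX₁ hlaw₀ hlaw₁ hindep
  obtain ⟨v, hv, hvs, hve⟩ := exists_contDiff_eq_scheduleDrift hαβ hm hρ hM
  have hvd : IsDrift P α β X₀ X₁ v := fun t ht => by
    rw [hve t ht]
    exact hdrift t ht
  obtain ⟨φ, hφ, hgrad⟩ := exists_isC1C1_gradient hv hvs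
  obtain ⟨f, hf, hfd, hfl⟩ := exists_flow_scheduleDrift hαβ hV hκ hm hρ hM
  have hlip : 0 < κ → ∀ t ∈ Icc (0 : ℝ) 1, ∀ x,
      ‖fderiv ℝ (f t) x‖ ≤ Real.sqrt (α t ^ 2 + β t ^ 2 / κ) := fun hκ' t ht x =>
    norm_fderiv_le_of_lip' ℝ (Real.sqrt_nonneg _) (.of_forall fun y => hfl hκ' t ht y x)
  refine ⟨v, hvd, fun w hw t ht => hvd.eq_of_isDrift hαβ hm hX₀ hX₁ hlaw₀ hlaw₁ hindep hw ht,
    ⟨φ, hφ, fun t _ => (hgrad t).symm, fun t ht => ⟨fun x =>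
      (hasFDerivAt_slice hv t x).differentiableAt, fun x => by rw [hessian, hgrad t],
      hvs t, ?_, fun hmono hpos x => ?_⟩⟩,
    ⟨f, fun x => ⟨(hf x).1, fun t ht => ?_⟩, fun g hg t ht => ?_, hfd, hlip, fun hκ' x => ?_⟩⟩
  · rw [hve t ht]
    exact exists_norm_fderiv_radialField_le hV hκ hm hρ hM _ _ _ (hαβ.angle_mem ht)
  · rw [hve t ht]
    exact fderiv_scheduleDrift_le hαβ hV hκ hm hρ hM ht hmono hpos x
  · rw [hve t ht]
    exact (hf x).2 t ht
  · ext1 x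
    refine IsCurveOn.eqOn hv (hg x).2 (u₂ := fun t => f t x) (fun t ht => ?_) ?_ ht
    · rw [hve t ht]
      exact (hf x).2 t ht
    · rw [(hg x).1, (hf x).1]
  · refine (hlip hκ' 1 ⟨zero_le_one, le_rfl⟩ x).trans_eq ?_
    rw [hαβ.α_one, hαβ.β_one]
    simp
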